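/- Let $\lambda_0\in\mathbb R$ and, for $0<a<b<c$, let $\Gamma$ be the curve $w^2=((\lambda-\lambda_0)^2+a^2)((\lambda-\lambda_0)^2+b^2)((\lambda-\lambda_0)^2+c^2)$, with points $P_\infty^\pm$ at infinity where $w\sim\pm\lambda^3$. Put $$A_+=\int_{a^2}^{b^2}\!\frac{ds}{\sqrt{(s-a^2)(b^2-s)(c^2-s)}},\quad B_+=\int_{b^2}^{c^2}\!\frac{ds}{\sqrt{(s-a^2)(s-b^2)(c^2-s)}},$$ $$A_-=\int_0^{a^2}\!\frac{ds}{\sqrt{s(a^2-s)(b^2-s)(c^2-s)}},\quad B_-=\int_{a^2}^{b^2}\!\frac{ds}{\sqrt{s(s-a^2)(b^2-s)(c^2-s)}},\quad B_-^1=\int_{c^2}^\infty\!\frac{ds}{\sqrt{s(s-a^2)(s-b^2)(s-c^2)}},$$ $$D_-=\frac12\int_0^{a^2}\!\frac{s\,ds}{\sqrt{s(a^2-s)(b^2-s)(c^2-s)}},\quad F_-=\frac12\int_{c^2}^\infty\!\Big(\frac{s}{\sqrt{s(s-a^2)(s-b^2)(s-c^2)}}-\frac1s\Big)ds,$$ $\mathfrak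 b_\pm=B_\pm/A_\pm$, $\delta=B_-^1/A_-$, $K_0=ic\,e^{D_-\delta-F_-}$. With the Jacobi theta functions $\vartheta_2(u|\tau)=2\sum_{m\ge1}h^{(m-1/2)^2}\cos((2m-1)\pi u)$, $\vartheta_3(u|\tau)=1+2\sum_{m\ge1}h^{m^2}\cos(2m\pi u)$, $h=e^{\pi i\tau}$, let $$H(u_1,u_2)=\vartheta_3(u_1)\vartheta_3(u_2)+\vartheta_2(u_1)\vartheta_3(u_2)+\vartheta_3(u_1)\vartheta_2(u_2)-\vartheta_2(u_1)\vartheta_2(u_2),$$ where the functions of $u_1$ have $\tau=2i\mathfrak b_-$ and those of $u_2$ have $\tau=2i\mathfrak b_+$. Let $\Omega_1,\Omega_2$ be the Abelian integrals of the second kind on $\Gamma$, with poles only at $P_\infty^\pm$ and zero $a$-periods, based at the branch point $\lambda_0+ic$ and continued along the ray $\lambda_0+iy$, $y\ge c$, to $P_\infty^\pm$, with $\Omega_1=\mp i(\lambda+K_1+O(\lambda^{-1}))$, $\Omega_2=\mp i(2\lambda^2+K_2+O(\lambda^{-1}))$ at $P^\pm_\infty$. Here the cycle $a_1$ encircles $[\lambda_0-ia,\lambda_0+ia]$,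 and $a_2$ goes around $[\lambda_0+ia,\lambda_0+ib]$ and around its image under $(w,\lambda)\mapsto(w,2\lambda_0-\lambda)$ with opposite orientation; thus $P(\lambda)\,d\lambda/w$ has zero $a$-periods if and only if $$\int_{-a}^{a}\frac{P(\lambda_0+iy)\,dy}{\sqrt{(a^2-y^2)(b^2-y^2)(c^2-y^2)}}=0,\qquad \int_a^b\frac{(P(\lambda_0+iy)-P(\lambda_0-iy))\,dy}{\sqrt{(y^2-a^2)(b^2-y^2)(c^2-y^2)}}=0 .$$ Consider the two-phase solution with initial phase $Z=(Z_1,Z_2)$ of the focusing nonlinear Schrödinger equation $ip_t+p_{xx}+2|p|^2p=0$, $$p(x,t)=-2iK_0\,\frac{H(u_1+i\delta,u_2+1)}{H(u_1,u_2)}\,e^{2iK_1x+2iK_2t},\qquad u_1=\frac{4t}{A_-}+2Z_1,\quad u_2=\frac{2x}{A_+}+\frac{8\lambda_0t}{A_+}+2Z_2 .$$ Then the constants $K_1$ and $K_2$ exist and are uniquely determined for all $0<a<b<c$, and for all real $x,t$: 1. If $0<a<b$ are fixed and $Z=(0,1/4)$, then $p(x,t)\to a\exp\{-2i\lambda_0x-2i(2\lambda_0^2-a^2)t\}$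 as $c\to b^+$. 2. If $0<b<c$ are fixed and $Z=(1/4,0)$, then $p(x,t)\to c\exp\{-2i\lambda_0x-2i(2\lambda_0^2-c^2)t-i\varphi/2\}$ as $a\to b^-$, where $\varphi=\arccos\frac{c^2-2b^2}{c^2}$. -/

import Mathlib

open Filter Topology Asymptotics MeasureTheory Polynomial

namespace FocusingNLS

noncomputable section

/-! The spectral curve is the genus two curve
`Γ : w² = ((λ - λ₀)² + a²) ((λ - λ₀)² + b²) ((λ - λ₀)² + c²)`, `0 < a < b < c`, with branch points
`λ₀ ± i a`, `λ₀ ± i b`, `λ₀ ± i c`; it covers the elliptic curves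
`Γ₊ : χ² = (t + a²)(t + b²)(t + c²)` and `Γ₋ : χ² = t (t + a²)(t + b²)(t + c²)`
through `t = (λ - λ₀)²`. The integrals below are taken in the variable `-t`. -/

/-- The Jacobi theta function `ϑ₃(u|τ) = 1 + 2 ∑_{m ≥ 1} h^{m²} cos (2mπu)`, `h = e^{πiτ}`. -/
def theta3 (u τ : ℂ) : ℂ := jacobiTheta₂ u τ

/-- The Jacobi theta function `ϑ₂(u|τ) = 2 ∑_{m ≥ 1} h^{(m-1/2)²} cos ((2m-1)πu)`,
`h = e^{πiτ}`. -/
def theta2 (u τ : ℂ) : ℂ :=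
  Complex.exp (Real.pi * Complex.I * τ / 4 + Real.pi * Complex.I * u) * jacobiTheta₂ (u + τ / 2) τ

/-- The cosine series of `ϑ₃`. -/
theorem hasSum_theta3 (u : ℂ) {τ : ℂ} (hτ : 0 < τ.im) :
    HasSum (fun m : ℕ => 2 * (Complex.exp (Real.pi * Complex.I * τ * ((m : ℂ) + 1) ^ 2) *
      Complex.cos (2 * ((m : ℂ) + 1) * Real.pi * u))) (theta3 u τ - 1) := by
  have h := (hasSum_jacobiTheta₂_term u hτ).nat_add_neg
  have h0 := (hasSum_nat_add_iff' 1).mpr h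
  have e : theta3 u τ - 1 = jacobiTheta₂ u τ + jacobiTheta₂_term 0 u τ -
      ∑ i ∈ Finset.range 1, (jacobiTheta₂_term ((i : ℕ) : ℤ) u τ +
        jacobiTheta₂_term (-((i : ℕ) : ℤ)) u τ) := by
    simp [theta3, jacobiTheta₂_term]
  rw [e]
  refine h0.congr_fun ?_
  intro m
  simp only [jacobiTheta₂_term, Complex.cos]
  rw [mul_div_assoc', mul_div_assoc', mul_div_cancel_left₀ _ (two_ne_zero), mul_add,
    ← Complex.exp_add, ← Complex.exp_add]
  push_cast
  congr 2 <;> ring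

/-- The cosine series of `ϑ₂`. -/
theorem hasSum_theta2 (u : ℂ) {τ : ℂ} (hτ : 0 < τ.im) :
    HasSum (fun m : ℕ => 2 * (Complex.exp (Real.pi * Complex.I * τ * ((m : ℂ) + 1 / 2) ^ 2) *
      Complex.cos ((2 * (m : ℂ) + 1) * Real.pi * u))) (theta2 u τ) := by
  have h := ((hasSum_jacobiTheta₂_term (u + τ / 2) hτ).mul_left
    (Complex.exp (Real.pi * Complex.I * τ / 4 + Real.pi * Complex.I * u))).nat_add_neg_add_one
  refine h.congr_fun ?_
  intro m
  simp only [jacobiTheta₂_term, Complex.cos]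
  rw [mul_div_assoc', mul_div_assoc', mul_div_cancel_left₀ _ (two_ne_zero), mul_add,
    ← Complex.exp_add, ← Complex.exp_add, ← Complex.exp_add, ← Complex.exp_add]
  push_cast
  congr 2 <;> ring

/-- `A₊`, a half-period of `dt/χ₊`. -/
def Aplus (a b c : ℝ) : ℝ :=
  ∫ t in (a ^ 2)..(b ^ 2), 1 / √((t - a ^ 2) * (b ^ 2 - t) * (c ^ 2 - t))

/-- `A₋`, a half-period of `dt/χ₋`. -/
def Aminus (a b c : ℝ) : ℝ :=
  ∫ t in (0 : ℝ)..(a ^ 2), 1 / √(t * (a ^ 2 - t) * (b ^ 2 - t) * (c ^ 2 - t))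

/-- `B₊`. -/
def Bplus (a b c : ℝ) : ℝ :=
  ∫ t in (b ^ 2)..(c ^ 2), 1 / √((t - a ^ 2) * (t - b ^ 2) * (c ^ 2 - t))

/-- `B₋`. -/
def Bminus (a b c : ℝ) : ℝ :=
  ∫ t in (a ^ 2)..(b ^ 2), 1 / √(t * (t - a ^ 2) * (b ^ 2 - t) * (c ^ 2 - t))

/-- `B₋¹`. -/
def BminusOne (a b c : ℝ) : ℝ :=
  ∫ t in Set.Ioi (c ^ 2), 1 / √(t * (t - a ^ 2) * (t - b ^ 2) * (t - c ^ 2))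

/-- `D₋`. -/
def Dminus (a b c : ℝ) : ℝ :=
  (1 / 2) * ∫ t in (0 : ℝ)..(a ^ 2), t / √(t * (a ^ 2 - t) * (b ^ 2 - t) * (c ^ 2 - t))

/-- `F₋`. -/
def Fminus (a b c : ℝ) : ℝ :=
  (1 / 2) * ∫ t in Set.Ioi (c ^ 2),
    (t / √(t * (t - a ^ 2) * (t - b ^ 2) * (t - c ^ 2)) - 1 / t)

/-- `𝔟₊ = B₊ / A₊`. -/
def bplus (a b c : ℝ) : ℝ := Bplus a b c / Aplus a b c

/-- `𝔟₋ = B₋ / A₋`. -/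
def bminus (a b c : ℝ) : ℝ := Bminus a b c / Aminus a b c

/-- `δ = B₋¹ / A₋`. -/
def delta (a b c : ℝ) : ℝ := BminusOne a b c / Aminus a b c

/-- `K₀ = i c exp (D₋ δ - F₋)`. -/
def K0 (a b c : ℝ) : ℂ :=
  Complex.I * c * (Real.exp (Dminus a b c * delta a b c - Fminus a b c) : ℝ)

/-- The differential `P(λ) dλ / w` on `Γ` has zero `a`-periods. The basic cycle `a₁` encircles the
segment `[λ₀ - i a, λ₀ + i a]`; the basic cycle `a₂` goes around `[λ₀ + i a, λ₀ + i b]` and around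
its image under `(w, λ) ↦ (w, 2 λ₀ - λ)`, taken with the opposite orientation. The periods are
written, up to nonzero constant factors, through the parametrization `λ = λ₀ ± i y`. -/
def HasZeroAPeriods (l0 a b c : ℝ) (P : ℂ[X]) : Prop :=
  (∫ y in (-a)..a, P.eval ((l0 : ℂ) + Complex.I * y) /
      (√((a ^ 2 - y ^ 2) * (b ^ 2 - y ^ 2) * (c ^ 2 - y ^ 2)) : ℝ)) = 0 ∧
  (∫ y in a..b, (P.eval ((l0 : ℂ) + Complex.I * y) - P.eval ((l0 : ℂ) - Complex.I * y)) /
      (√((y ^ 2 - a ^ 2) * (b ^ 2 - y ^ 2) * (c ^ 2 - y ^ 2)) : ℝ)) = 0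

/-- The value of `w` at `λ = λ₀ + i y`, `y ≥ c`, on the sheet of `Γ` that contains `P_∞^+`, that is,
on which `w ~ λ³`. -/
def wRay (a b c y : ℝ) : ℂ :=
  -Complex.I * (√((y ^ 2 - a ^ 2) * (y ^ 2 - b ^ 2) * (y ^ 2 - c ^ 2)) : ℝ)

/-- The Abelian integral `Ω = ∫ P(λ) dλ / w` from the branch point `λ₀ + i c` to `λ₀ + i Y`, along
the vertical ray towards `P_∞^+`. -/
def abelianIntegral (l0 a b c : ℝ) (P : ℂ[X]) (Y : ℝ) : ℂ :=
  ∫ y in c..Y, P.eval ((l0 : ℂ) + Complex.I * y) / wRay a b c y * Complex.I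

/-- `K` is the constant term at infinity of the normalized Abelian integral `Ω` of the second kind
with `Ω = ∓ i (m λⁿ + K + O(λ⁻¹))` at `P_∞^±`: the differential `dΩ = P(λ) dλ / w` has poles of
order at most `n + 1` at `P_∞^±` (and no others), its `a`-periods are zero, and `Ω` has the stated
asymptotics at `P_∞^+`. Since `Ω` starts at a branch point, it changes sign under
`(w, λ) ↦ (-w, λ)`, so that the asymptotics at `P_∞^-` is the same statement. -/
def IsAbelianConstant (l0 a b c : ℝ) (n : ℕ) (m K : ℂ) : Prop :=
  ∃ P : ℂ[X], P.natDegree ≤ n + 2 ∧ HasZeroAPeriods l0 a b c P ∧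
    (fun Y : ℝ => abelianIntegral l0 a b c P Y -
      -Complex.I * (m * ((l0 : ℂ) + Complex.I * Y) ^ n + K)) =O[atTop] (fun Y : ℝ => Y⁻¹)

/-- `K₁`, from `Ω₁ = ∓ i (λ + K₁ + O(λ⁻¹))`. -/
def K1 (l0 a b c : ℝ) : ℂ := Classical.epsilon (IsAbelianConstant l0 a b c 1 1)

/-- `K₂`, from `Ω₂ = ∓ i (2 λ² + K₂ + O(λ⁻¹))`. -/
def K2 (l0 a b c : ℝ) : ℂ := Classical.epsilon (IsAbelianConstant l0 a b c 2 2)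

/-- `H(u₁, u₂)`. -/
def H (a b c : ℝ) (u₁ u₂ : ℂ) : ℂ :=
  theta3 u₁ (2 * Complex.I * bminus a b c) * theta3 u₂ (2 * Complex.I * bplus a b c) +
  theta2 u₁ (2 * Complex.I * bminus a b c) * theta3 u₂ (2 * Complex.I * bplus a b c) +
  theta3 u₁ (2 * Complex.I * bminus a b c) * theta2 u₂ (2 * Complex.I * bplus a b c) -
  theta2 u₁ (2 * Complex.I * bminus a b c) * theta2 u₂ (2 * Complex.I * bplus a b c)

/-- `u₁ = κ₁ t + 2 Z₁` with `κ₁ = 4 / A₋`. -/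
def phase1 (a b c Z₁ t : ℝ) : ℝ := 4 / Aminus a b c * t + 2 * Z₁

/-- `u₂ = k x + κ₂ t + 2 Z₂` with `k = 2 / A₊` and `κ₂ = 8 λ₀ / A₊`. -/
def phase2 (l0 a b c Z₂ x t : ℝ) : ℝ :=
  2 / Aplus a b c * x + 8 * l0 / Aplus a b c * t + 2 * Z₂

/-- The two-phase solution `p` with initial phase `Z = (Z₁, Z₂)`. -/
def twoPhase (l0 a b c Z₁ Z₂ x t : ℝ) : ℂ :=
  -2 * Complex.I * K0 a b c *
    (H a b c (phase1 a b c Z₁ t + Complex.I * delta a b c) (phase2 l0 a b c Z₂ x t + 1) /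
      H a b c (phase1 a b c Z₁ t) (phase2 l0 a b c Z₂ x t)) *
    Complex.exp (2 * Complex.I * K1 l0 a b c * x + 2 * Complex.I * K2 l0 a b c * t)

end

end FocusingNLS

namespace FocusingNLS

/-! ### The arcsine weight -/

/-- The density `1 / √((s - p) (q - s))` of the arcsine law on `[p, q]`, of total mass `π`. -/
noncomputable def arcsineWeight (p q s : ℝ) : ℝ := 1 / √((s - p) * (q - s))

theorem arcsineWeight_nonneg (p q s : ℝ) : 0 ≤ arcsineWeight p q s := by
  unfold arcsineWeight; positivity

theorem hasDerivAt_arcsin_affine {p q s : ℝ} (hs : s ∈ Set.Ioo p q) :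
    HasDerivAt (fun x => Real.arcsin ((2 * x - p - q) / (q - p))) (arcsineWeight p q s) s := by
  obtain ⟨h1, h2⟩ := hs
  have hpq : 0 < q - p := by linarith
  have hm : HasDerivAt (fun x : ℝ => (2 * x - p - q) / (q - p)) (2 / (q - p)) s := by
    have := ((((hasDerivAt_id s).const_mul 2).sub_const p).sub_const q).div_const (q - p)
    simpa using this
  have ha : (2 * s - p - q) / (q - p) ≠ -1 := by
    intro h; rw [div_eq_iff hpq.ne'] at h; linarith
  have hb : (2 * s - p - q) / (q - p) ≠ 1 := by
    intro h; rw [div_eq_iff hpq.ne'] at h; linarith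
  have := (Real.hasDerivAt_arcsin ha hb).comp s hm
  refine this.congr_deriv ?_
  have e : 1 - ((2 * s - p - q) / (q - p)) ^ 2 = (2 / (q - p)) ^ 2 * ((s - p) * (q - s)) := by
    field_simp; ring
  have hpos : 0 < (s - p) * (q - s) := mul_pos (by linarith) (by linarith)
  rw [e, Real.sqrt_mul (by positivity), Real.sqrt_sq (by positivity), arcsineWeight]
  have := Real.sqrt_pos.2 hpos
  field_simp

theorem intervalIntegrable_arcsineWeight {p q : ℝ} (hpq : p < q) :
    IntervalIntegrable (arcsineWeight p q) volume p q := by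
  rw [intervalIntegrable_iff_integrableOn_Ioc_of_le hpq.le]
  refine intervalIntegral.integrableOn_deriv_of_nonneg (g := fun x =>
    Real.arcsin ((2 * x - p - q) / (q - p))) ?_ (fun x hx => hasDerivAt_arcsin_affine hx)
    (fun x _ => arcsineWeight_nonneg p q x)
  exact (Real.continuous_arcsin.comp (by fun_prop)).continuousOn

theorem integral_arcsineWeight {p q : ℝ} (hpq : p < q) :
    ∫ s in p..q, arcsineWeight p q s = Real.pi := by
  rw [intervalIntegral.integral_eq_sub_of_hasDerivAt_of_le hpq.le (f := fun x =>
    Real.arcsin ((2 * x - p - q) / (q - p))) ?_ (fun x hx => hasDerivAt_arcsin_affine hx)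
    (intervalIntegrable_arcsineWeight hpq)]
  · have h : q - p ≠ 0 := by linarith
    have e1 : (2 * q - p - q) / (q - p) = 1 := by rw [div_eq_one_iff_eq h]; ring
    have e2 : (2 * p - p - q) / (q - p) = -1 := by rw [div_eq_iff h]; ring
    simp only [e1, e2, Real.arcsin_one, Real.arcsin_neg_one]; ring
  · exact (Real.continuous_arcsin.comp (by fun_prop)).continuousOn

theorem intervalIntegrable_arcsineWeight_mul {p q : ℝ} (hpq : p < q) {g : ℝ → ℝ}
    (hg : ContinuousOn g (Set.Icc p q)) :
    IntervalIntegrable (fun s => arcsineWeight p q s * g s) volume p q :=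
  (intervalIntegrable_arcsineWeight hpq).mul_continuousOn (by rwa [Set.uIcc_of_le hpq.le])

theorem integral_arcsineWeight_mul_le {p q M : ℝ} (hpq : p < q) {g : ℝ → ℝ}
    (hg : ContinuousOn g (Set.Icc p q)) (hM : ∀ s ∈ Set.Icc p q, g s ≤ M) :
    ∫ s in p..q, arcsineWeight p q s * g s ≤ Real.pi * M := by
  rw [← integral_arcsineWeight hpq, ← intervalIntegral.integral_mul_const]
  exact intervalIntegral.integral_mono_on hpq.le (intervalIntegrable_arcsineWeight_mul hpq hg)
    ((intervalIntegrable_arcsineWeight hpq).mul_const M)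
    fun s hs => mul_le_mul_of_nonneg_left (hM s hs) (arcsineWeight_nonneg p q s)

theorem le_integral_arcsineWeight_mul {p q m : ℝ} (hpq : p < q) {g : ℝ → ℝ}
    (hg : ContinuousOn g (Set.Icc p q)) (hm : ∀ s ∈ Set.Icc p q, m ≤ g s) :
    Real.pi * m ≤ ∫ s in p..q, arcsineWeight p q s * g s := by
  rw [← integral_arcsineWeight hpq, ← intervalIntegral.integral_mul_const]
  exact intervalIntegral.integral_mono_on hpq.le
    ((intervalIntegrable_arcsineWeight hpq).mul_const m)
    (intervalIntegrable_arcsineWeight_mul hpq hg)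
    fun s hs => mul_le_mul_of_nonneg_left (hm s hs) (arcsineWeight_nonneg p q s)

theorem abs_integral_arcsineWeight_mul_le {p q M : ℝ} (hpq : p < q) {g : ℝ → ℝ}
    (hg : ContinuousOn g (Set.Icc p q)) (hM : ∀ s ∈ Set.Icc p q, |g s| ≤ M) :
    |∫ s in p..q, arcsineWeight p q s * g s| ≤ Real.pi * M := by
  rw [abs_le]
  constructor
  · have := le_integral_arcsineWeight_mul hpq hg (m := -M) fun s hs => (abs_le.1 (hM s hs)).1
    linarith
  · exact integral_arcsineWeight_mul_le hpq hg fun s hs => (abs_le.1 (hM s hs)).2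

theorem hasDerivAt_arcsin_mobius {al be s : ℝ} (h1 : al < be) (hs : s ∈ Set.Ioo 0 al) :
    HasDerivAt (fun x => Real.arcsin (2 * (be - al) * x / (al * (be - x)) - 1))
      (√(be * (be - al)) * (arcsineWeight 0 al s * (1 / (be - s)))) s := by
  obtain ⟨hs0, hs1⟩ := hs
  have h0 : 0 < al := hs0.trans hs1
  have hbs : 0 < be - s := by linarith
  have hba : 0 < be - al := by linarith
  have hb : 0 < be := by linarith
  have hsa : 0 < al - s := by linarith
  have hm : HasDerivAt (fun x : ℝ => 2 * (be - al) * x / (al * (be - x)) - 1)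
      (2 * (be - al) * be / (al * (be - s) ^ 2)) s := by
    have n1 := (hasDerivAt_id s).const_mul (2 * (be - al))
    have n2 := ((hasDerivAt_id s).const_sub be).const_mul al
    have := (n1.div n2 (by simp; exact ⟨h0.ne', hbs.ne'⟩)).sub_const 1
    refine this.congr_deriv ?_
    simp only [id]
    field_simp; ring
  have e1 : 1 + (2 * (be - al) * s / (al * (be - s)) - 1) = 2 * (be - al) * s / (al * (be - s)) := by
    ring
  have e2 : 1 - (2 * (be - al) * s / (al * (be - s)) - 1) = 2 * be * (al - s) / (al * (be - s)) := by
    field_simp; ring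
  have p1 : 0 < 2 * (be - al) * s / (al * (be - s)) := by positivity
  have p2 : 0 < 2 * be * (al - s) / (al * (be - s)) := by positivity
  have := (Real.hasDerivAt_arcsin (x := 2 * (be - al) * s / (al * (be - s)) - 1)
    (by linarith) (by linarith)).comp s hm
  refine this.congr_deriv ?_
  have e : 1 - (2 * (be - al) * s / (al * (be - s)) - 1) ^ 2 =
      (2 / (al * (be - s))) ^ 2 * ((be * (be - al)) * ((s - 0) * (al - s))) := by
    field_simp; ring
  have hpos : 0 < (s - 0) * (al - s) := mul_pos (by linarith) (by linarith)
  rw [e, Real.sqrt_mul (by positivity), Real.sqrt_sq (by positivity),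
    Real.sqrt_mul (by positivity), arcsineWeight]
  have q1 := Real.sqrt_pos.2 hpos
  have q2 : 0 < √(be * (be - al)) := Real.sqrt_pos.2 (by positivity)
  have q3 : √(be * (be - al)) ^ 2 = be * (be - al) := Real.sq_sqrt (by positivity)
  field_simp
  rw [q3]

theorem integral_arcsineWeight_mul_inv_sub {al be : ℝ} (h0 : 0 < al) (h1 : al < be) :
    ∫ s in (0 : ℝ)..al, arcsineWeight 0 al s * (1 / (be - s)) = Real.pi / √(be * (be - al)) := by
  have hq : 0 < √(be * (be - al)) := Real.sqrt_pos.2 (mul_pos (by linarith) (by linarith))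
  rw [eq_div_iff hq.ne', mul_comm, ← intervalIntegral.integral_const_mul]
  have hc : ContinuousOn (fun s : ℝ => 1 / (be - s)) (Set.Icc 0 al) := by
    refine ContinuousOn.div continuousOn_const (by fun_prop) fun s hs => ?_
    have := hs.2; intro h; linarith
  rw [intervalIntegral.integral_eq_sub_of_hasDerivAt_of_le h0.le (f := fun x =>
    Real.arcsin (2 * (be - al) * x / (al * (be - x)) - 1)) ?_
    (fun x hx => hasDerivAt_arcsin_mobius h1 hx)
    ((intervalIntegrable_arcsineWeight_mul h0 hc).const_mul _)]
  · have h : be - al ≠ 0 := by linarith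
    have e1 : 2 * (be - al) * al / (al * (be - al)) - 1 = 1 := by field_simp; norm_num
    have e2 : 2 * (be - al) * 0 / (al * (be - 0)) - 1 = -1 := by simp
    simp only [e1, e2, Real.arcsin_one, Real.arcsin_neg_one]; ring
  · refine Real.continuous_arcsin.comp_continuousOn (ContinuousOn.sub (ContinuousOn.div
      (by fun_prop) (by fun_prop) fun s hs => ?_) continuousOn_const)
    have := hs.2
    exact mul_ne_zero h0.ne' (by intro h; linarith)

end FocusingNLS

namespace FocusingNLS

/-! ### Explicit improper integrals -/

theorem sqrt_eq_sqrt_mul_of_eq {x y t : ℝ} (ht : 0 ≤ t) (h : y = x * t ^ 2) : √y = √x * t := by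
  rw [h, Real.sqrt_mul' _ (sq_nonneg t), Real.sqrt_sq ht]

theorem tendsto_div_add_const_atTop (m : ℝ) :
    Tendsto (fun v : ℝ => v / (v + m)) atTop (𝓝 1) := by
  have h : Tendsto (fun v : ℝ => 1 - m / (v + m)) atTop (𝓝 (1 - 0)) :=
    tendsto_const_nhds.sub (tendsto_const_nhds.div_atTop (tendsto_atTop_add_const_right _ _ tendsto_id))
  rw [sub_zero] at h
  refine h.congr' ?_
  filter_upwards [eventually_gt_atTop (-m)] with v hv
  have : v + m ≠ 0 := by linarith
  field_simp; ring

theorem integrableOn_inv_add_sq {m : ℝ} (hm : 0 < m) :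
    IntegrableOn (fun v : ℝ => 1 / (v + m) ^ 2) (Set.Ioi 0) := by
  have := integrableOn_add_rpow_Ioi_of_lt (a := -2) (c := 0) (m := m) (by norm_num) (by linarith)
  refine this.congr_fun (fun v hv => ?_) measurableSet_Ioi
  have hv : 0 < v := hv
  have h2 : 0 < v + m := by linarith
  simp only
  rw [Real.rpow_neg h2.le, one_div]; norm_num

theorem inv_sqrt_mul_add_integral {p : ℝ} (hp : 0 < p) :
    IntegrableOn (fun v : ℝ => 1 / (√v * (v + p))) (Set.Ioi 0) ∧
    ∫ v in Set.Ioi (0 : ℝ), 1 / (√v * (v + p)) = Real.pi / √p := by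
  have hc : ContinuousWithinAt (fun v : ℝ => 2 / √p * Real.arctan (√v / √p)) (Set.Ici 0) 0 := by
    have : Continuous (fun v : ℝ => 2 / √p * Real.arctan (√v / √p)) :=
      continuous_const.mul (Real.continuous_arctan.comp (by fun_prop))
    exact this.continuousWithinAt
  have hp' := Real.sqrt_pos.2 hp
  have hd : ∀ v ∈ Set.Ioi (0 : ℝ), HasDerivAt (fun v : ℝ => 2 / √p * Real.arctan (√v / √p))
      (1 / (√v * (v + p))) v := by
    intro v hv
    have hv : 0 < v := hv
    have := (((Real.hasDerivAt_sqrt hv.ne').div_const (√p)).arctan).const_mul (2 / √p)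
    refine this.congr_deriv ?_
    have hv' := Real.sqrt_pos.2 hv
    have e1 : √v ^ 2 = v := Real.sq_sqrt hv.le
    have e2 : √p ^ 2 = p := Real.sq_sqrt hp.le
    have e3 : 1 + (√v / √p) ^ 2 = (v + p) / p := by rw [div_pow, e1, e2]; field_simp; ring
    rw [e3]
    field_simp
    exact e2.symm
  have hn : ∀ v ∈ Set.Ioi (0 : ℝ), 0 ≤ 1 / (√v * (v + p)) := by
    intro v hv
    have hv : 0 < v := hv
    positivity
  have ht : Tendsto (fun v : ℝ => 2 / √p * Real.arctan (√v / √p)) atTop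
      (𝓝 (2 / √p * (Real.pi / 2))) := by
    refine Tendsto.const_mul _ ((Real.tendsto_arctan_atTop.mono_right nhdsWithin_le_nhds).comp ?_)
    exact Real.tendsto_sqrt_atTop.atTop_div_const hp'
  refine ⟨integrableOn_Ioi_deriv_of_nonneg hc hd hn ht, ?_⟩
  rw [integral_Ioi_of_hasDerivAt_of_nonneg hc hd hn ht]
  simp

theorem hasDerivAt_sqrt_div_add {ga v : ℝ} (hg : 0 < ga) (hv : 0 < v) :
    HasDerivAt (fun v : ℝ => √(v / (v + ga)))
      (ga / (2 * √(v * (v + ga)) * (v + ga))) v := by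
  have h2 : 0 < v + ga := by linarith
  have h1 : HasDerivAt (fun v : ℝ => v / (v + ga)) (ga / (v + ga) ^ 2) v := by
    refine ((hasDerivAt_id v).div ((hasDerivAt_id v).add_const ga) h2.ne').congr_deriv ?_
    simp
  have hq : 0 < v / (v + ga) := by positivity
  refine (h1.sqrt hq.ne').congr_deriv ?_
  have e : √(v * (v + ga)) = √(v / (v + ga)) * (v + ga) := by
    exact sqrt_eq_sqrt_mul_of_eq h2.le (by field_simp)
  have := Real.sqrt_pos.2 hq
  rw [e]; field_simp

theorem tendsto_sqrt_div_add {ga : ℝ} :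
    Tendsto (fun v : ℝ => √(v / (v + ga))) atTop (𝓝 1) := by
  have := (Real.continuous_sqrt.tendsto 1).comp (tendsto_div_add_const_atTop ga)
  simpa [Function.comp_def] using this

theorem continuousWithinAt_sqrt_div_add {ga : ℝ} (hg : 0 < ga) :
    ContinuousWithinAt (fun v : ℝ => √(v / (v + ga))) (Set.Ici 0) 0 := by
  refine ContinuousAt.continuousWithinAt ?_
  refine ContinuousAt.sqrt (ContinuousAt.div continuousAt_id (by fun_prop) (by simp; exact hg.ne'))

theorem integral_inv_sqrt_mul_add_of_lt {ga r : ℝ} (hr : 0 < r) (hrg : r < ga) :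
    ∫ v in Set.Ioi (0 : ℝ), 1 / (√(v * (v + ga)) * (v + r)) =
      2 / (√(ga - r) * √r) * Real.arctan (√(ga - r) / √r) := by
  have hg : 0 < ga := hr.trans hrg
  have hd0 : 0 < ga - r := by linarith
  have pd := Real.sqrt_pos.2 hd0
  have pr := Real.sqrt_pos.2 hr
  have ed : √(ga - r) ^ 2 = ga - r := Real.sq_sqrt hd0.le
  have er : √r ^ 2 = r := Real.sq_sqrt hr.le
  have hn : ∀ v ∈ Set.Ioi (0 : ℝ), 0 ≤ 1 / (√(v * (v + ga)) * (v + r)) := by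
    intro v hv
    have hv : 0 < v := hv
    positivity
  have hc : ContinuousWithinAt (fun v : ℝ => 2 / (√(ga - r) * √r) *
      Real.arctan (√(ga - r) / √r * √(v / (v + ga)))) (Set.Ici 0) 0 :=
    continuousWithinAt_const.mul (Real.continuous_arctan.continuousAt.comp_continuousWithinAt
      (continuousWithinAt_const.mul (continuousWithinAt_sqrt_div_add hg)))
  have ht : Tendsto (fun v : ℝ => 2 / (√(ga - r) * √r) *
      Real.arctan (√(ga - r) / √r * √(v / (v + ga)))) atTop
      (𝓝 (2 / (√(ga - r) * √r) * Real.arctan (√(ga - r) / √r * 1))) :=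
    ((Real.continuous_arctan.tendsto _).comp (tendsto_sqrt_div_add.const_mul _)).const_mul _
  rw [integral_Ioi_of_hasDerivAt_of_nonneg hc ?_ hn ht]
  · simp
  intro v hv
  have hv : 0 < v := hv
  have := (((hasDerivAt_sqrt_div_add hg hv).const_mul (√(ga - r) / √r)).arctan).const_mul
    (2 / (√(ga - r) * √r))
  refine this.congr_deriv ?_
  have e3 : 1 + (√(ga - r) / √r * √(v / (v + ga))) ^ 2 = ga * (v + r) / (r * (v + ga)) := by
    rw [mul_pow, div_pow, ed, er, Real.sq_sqrt (by positivity)]; field_simp; ring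
  have hq := Real.sqrt_pos.2 (by positivity : 0 < v * (v + ga))
  rw [e3]
  field_simp
  rw [er]

theorem integral_inv_sqrt_mul_add_of_gt {ga r : ℝ} (hg : 0 < ga) (hrg : ga < r) :
    ∫ v in Set.Ioi (0 : ℝ), 1 / (√(v * (v + ga)) * (v + r)) =
      1 / (√(r - ga) * √r) * Real.log ((√r + √(r - ga)) / (√r - √(r - ga))) := by
  have hr : 0 < r := hg.trans hrg
  have hd0 : 0 < r - ga := by linarith
  have pd := Real.sqrt_pos.2 hd0
  have pr := Real.sqrt_pos.2 hr
  have ed : √(r - ga) ^ 2 = r - ga := Real.sq_sqrt hd0.le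
  have er : √r ^ 2 = r := Real.sq_sqrt hr.le
  have hlt : √(r - ga) < √r := Real.sqrt_lt_sqrt hd0.le (by linarith)
  have hx1 : ∀ v : ℝ, 0 ≤ v → √(v / (v + ga)) ≤ 1 := by
    intro v hv
    rw [Real.sqrt_le_one, div_le_one (by linarith)]
    linarith
  have hden : ∀ x : ℝ, 0 ≤ x → x ≤ 1 → 0 < √r - √(r - ga) * x := by
    intro x hx hx1
    nlinarith
  have hn : ∀ v ∈ Set.Ioi (0 : ℝ), 0 ≤ 1 / (√(v * (v + ga)) * (v + r)) := by
    intro v hv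
    have hv : 0 < v := hv
    positivity
  have hF : ∀ x : ℝ, 0 ≤ x → x ≤ 1 → HasDerivAt (fun x : ℝ => 1 / (√(r - ga) * √r) *
      (Real.log (√r + √(r - ga) * x) - Real.log (√r - √(r - ga) * x)))
      (2 / (r - (r - ga) * x ^ 2)) x := by
    intro x h0 h1
    have a1 : 0 < √r + √(r - ga) * x := by positivity
    have a2 := hden x h0 h1
    have h1 : HasDerivAt (fun x : ℝ => √r + √(r - ga) * x) (√(r - ga)) x := by
      simpa using ((hasDerivAt_id x).const_mul (√(r - ga))).const_add (√r)
    have h2 : HasDerivAt (fun x : ℝ => √r - √(r - ga) * x) (-√(r - ga)) x := by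
      simpa using ((hasDerivAt_id x).const_mul (√(r - ga))).const_sub (√r)
    refine (((h1.log a1.ne').sub (h2.log a2.ne')).const_mul _).congr_deriv ?_
    have e : r - (r - ga) * x ^ 2 = (√r + √(r - ga) * x) * (√r - √(r - ga) * x) := by
      ring_nf; rw [ed, er]; ring
    rw [e]
    field_simp
    ring
  have hc : ContinuousWithinAt (fun v : ℝ => 1 / (√(r - ga) * √r) *
      (Real.log (√r + √(r - ga) * √(v / (v + ga))) - Real.log (√r - √(r - ga) * √(v / (v + ga)))))
      (Set.Ici 0) 0 := by
    refine ContinuousAt.comp_continuousWithinAt (g := fun x : ℝ => 1 / (√(r - ga) * √r) *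
      (Real.log (√r + √(r - ga) * x) - Real.log (√r - √(r - ga) * x)))
      (f := fun v : ℝ => √(v / (v + ga))) ?_ (continuousWithinAt_sqrt_div_add hg)
    simp only [zero_div, Real.sqrt_zero]
    exact (hF 0 le_rfl zero_le_one).continuousAt
  have ht : Tendsto (fun v : ℝ => 1 / (√(r - ga) * √r) *
      (Real.log (√r + √(r - ga) * √(v / (v + ga))) - Real.log (√r - √(r - ga) * √(v / (v + ga)))))
      atTop (𝓝 (1 / (√(r - ga) * √r) *
        (Real.log (√r + √(r - ga) * 1) - Real.log (√r - √(r - ga) * 1)))) :=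
    ((hF 1 zero_le_one le_rfl).continuousAt.tendsto).comp tendsto_sqrt_div_add
  rw [integral_Ioi_of_hasDerivAt_of_nonneg hc ?_ hn ht]
  · rw [Real.log_div (by positivity) (by linarith)]
    simp
  intro v hv
  have hv : 0 < v := hv
  have := (hF _ (Real.sqrt_nonneg _) (hx1 v hv.le)).comp v (hasDerivAt_sqrt_div_add hg hv)
  refine this.congr_deriv ?_
  have hq := Real.sqrt_pos.2 (by positivity : 0 < v * (v + ga))
  rw [Real.sq_sqrt (by positivity)]
  have : r - (r - ga) * (v / (v + ga)) = ga * (v + r) / (v + ga) := by field_simp; ring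
  rw [this]
  field_simp

theorem integral_inv_sqrt_sub_inv {al x0 : ℝ} (ha : 0 < al) (hx : al ≤ x0) :
    ∫ v in Set.Ioi (0 : ℝ), (1 / √((v + x0) * (v + x0 - al)) - 1 / (v + x0)) =
      2 * Real.log 2 - 2 * Real.log (1 + √(1 - al / x0)) := by
  have h0 : 0 < x0 := ha.trans_le hx
  have hn : ∀ v ∈ Set.Ioi (0 : ℝ), 0 ≤ 1 / √((v + x0) * (v + x0 - al)) - 1 / (v + x0) := by
    intro v hv
    have hv : 0 < v := hv
    rw [sub_nonneg]
    refine one_div_le_one_div_of_le (Real.sqrt_pos.2 (mul_pos (by linarith) (by linarith))) ?_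
    rw [Real.sqrt_le_left (by linarith)]
    nlinarith
  have hF : ContinuousWithinAt (fun v : ℝ => 2 * Real.log (1 + √(1 - al / (v + x0))))
      (Set.Ici 0) 0 := by
    refine ContinuousAt.continuousWithinAt (ContinuousAt.mul continuousAt_const
      (ContinuousAt.log ?_ (by positivity)))
    refine continuousAt_const.add (ContinuousAt.sqrt (continuousAt_const.sub
      (ContinuousAt.div continuousAt_const (by fun_prop) (by simp; exact h0.ne'))))
  have ht : Tendsto (fun v : ℝ => 2 * Real.log (1 + √(1 - al / (v + x0)))) atTop
      (𝓝 (2 * Real.log 2)) := by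
    have t1 : Tendsto (fun v : ℝ => 1 - al / (v + x0)) atTop (𝓝 (1 - 0)) :=
      tendsto_const_nhds.sub (tendsto_const_nhds.div_atTop (tendsto_atTop_add_const_right _ _ tendsto_id))
    have t2 := (((Real.continuous_sqrt.tendsto _).comp t1).const_add 1)
    have t3 := ((Real.continuousAt_log (by simp)).tendsto.comp t2).const_mul 2
    simpa [one_add_one_eq_two, Function.comp_def] using t3
  rw [integral_Ioi_of_hasDerivAt_of_nonneg hF ?_ hn ht]
  · simp
  intro v hv
  have hv : 0 < v := hv
  have hs : 0 < v + x0 := by linarith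
  have hsa : 0 < v + x0 - al := by linarith
  have hq : 0 < 1 - al / (v + x0) := by rw [sub_pos, div_lt_one hs]; linarith
  have d1 : HasDerivAt (fun v : ℝ => 1 - al / (v + x0)) (al / (v + x0) ^ 2) v := by
    refine (((hasDerivAt_const v al).div ((hasDerivAt_id v).add_const x0) hs.ne').const_sub
      1).congr_deriv ?_
    simp; ring
  have pq := Real.sqrt_pos.2 hq
  have d2 := (((d1.sqrt hq.ne').const_add 1).log (by positivity)).const_mul 2
  refine d2.congr_deriv ?_
  have e : √((v + x0) * (v + x0 - al)) = √(1 - al / (v + x0)) * (v + x0) := by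
    exact sqrt_eq_sqrt_mul_of_eq hs.le (by field_simp)
  have e2 : √(1 - al / (v + x0)) ^ 2 = 1 - al / (v + x0) := Real.sq_sqrt hq.le
  have e3 : al = (1 - √(1 - al / (v + x0)) ^ 2) * (v + x0) := by rw [e2]; field_simp; ring
  rw [e]
  set x := √(1 - al / (v + x0))
  rw [e3]
  field_simp
  ring

theorem integral_sub_half_div_sqrt_sub_one {al x0 : ℝ} (ha : 0 < al) (hx : al ≤ x0) :
    ∫ v in Set.Ioi (0 : ℝ), ((v + x0 - al / 2) / √((v + x0) * (v + x0 - al)) - 1) =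
      x0 - al / 2 - √(x0 * (x0 - al)) := by
  have h0 : 0 < x0 := ha.trans_le hx
  have hn : ∀ v ∈ Set.Ioi (0 : ℝ),
      0 ≤ (v + x0 - al / 2) / √((v + x0) * (v + x0 - al)) - 1 := by
    intro v hv
    have hv : 0 < v := hv
    rw [sub_nonneg, le_div_iff₀ (Real.sqrt_pos.2 (mul_pos (by linarith) (by linarith))), one_mul,
      Real.sqrt_le_left (by linarith)]
    nlinarith
  have hF : ContinuousWithinAt (fun v : ℝ => √((v + x0) * (v + x0 - al)) - (v + x0))
      (Set.Ici 0) 0 := by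
    refine Continuous.continuousWithinAt (by fun_prop)
  have ht : Tendsto (fun v : ℝ => √((v + x0) * (v + x0 - al)) - (v + x0)) atTop
      (𝓝 (-al / 2)) := by
    have t1 : Tendsto (fun v : ℝ => 1 - al / (v + x0)) atTop (𝓝 (1 - 0)) :=
      tendsto_const_nhds.sub (tendsto_const_nhds.div_atTop (tendsto_atTop_add_const_right _ _ tendsto_id))
    have t2 := (((Real.continuous_sqrt.tendsto _).comp t1).const_add 1)
    have t3 := (tendsto_const_nhds (x := -al)).div t2 (by simp)
    simp only [sub_zero, Real.sqrt_one, one_add_one_eq_two] at t3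
    refine t3.congr' ?_
    filter_upwards [eventually_gt_atTop 0] with v hv
    have hs : 0 < v + x0 := by linarith
    have hq : 0 < 1 - al / (v + x0) := by rw [sub_pos, div_lt_one hs]; linarith
    have e : √((v + x0) * (v + x0 - al)) = √(1 - al / (v + x0)) * (v + x0) := by
      exact sqrt_eq_sqrt_mul_of_eq hs.le (by field_simp)
    have e2 : √(1 - al / (v + x0)) ^ 2 = 1 - al / (v + x0) := Real.sq_sqrt hq.le
    have e3 : al = (1 - √(1 - al / (v + x0)) ^ 2) * (v + x0) := by rw [e2]; field_simp; ring
    have pq := Real.sqrt_pos.2 hq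
    simp only [Pi.div_apply, Function.comp_def]
    rw [e]
    set x := √(1 - al / (v + x0))
    rw [div_eq_iff (by positivity)]
    rw [e3]
    ring
  rw [integral_Ioi_of_hasDerivAt_of_nonneg hF ?_ hn ht]
  · simp; ring
  intro v hv
  have hv : 0 < v := hv
  have hs : 0 < v + x0 := by linarith
  have hsa : 0 < v + x0 - al := by linarith
  have d1 := ((hasDerivAt_id v).add_const x0)
  have d2 := ((d1.mul (d1.sub_const al)).sqrt (by simp; exact ⟨hs.ne', hsa.ne'⟩)).sub d1
  refine d2.congr_deriv ?_
  simp
  field_simp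
  ring

end FocusingNLS

namespace FocusingNLS

/-! ### Integrals from the branch point `γ` to infinity, in the variable `v = s - γ` -/

/-- The density of `ds / χ` in the variable `v = s - γ`, where `p = γ - α`, `r = γ - β`. -/
noncomputable def firstKindDensity (ga p r v : ℝ) : ℝ := 1 / √(v * ((v + ga) * (v + p) * (v + r)))

/-- The density of `(s - γ) ds / χ - ds / s` in the variable `v = s - γ`. -/
noncomputable def thirdKindDensity (ga p r v : ℝ) : ℝ :=
  √v / √((v + ga) * (v + p) * (v + r)) - 1 / (v + ga)

/-- The density of `(s - γ) (s - ε) ds / χ - ds`, `ε = (α + β - γ) / 2`, in the variable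
`v = s - γ`. -/
noncomputable def secondKindDensity (ga p r v : ℝ) : ℝ :=
  √v * (v + (ga + p + r) / 2) / √((v + ga) * (v + p) * (v + r)) - 1

theorem integral_Ioi_eq_integral_Ioi_zero {E : Type*} [NormedAddCommGroup E] [NormedSpace ℝ E]
    (f : ℝ → E) (c : ℝ) :
    ∫ s in Set.Ioi c, f s = ∫ v in Set.Ioi (0 : ℝ), f (v + c) := by
  have := (measurePreserving_add_right volume c).setIntegral_preimage_emb
    (measurableEmbedding_addRight c) f (Set.Ioi c)
  rw [← this]
  simp

theorem mul_firstKindDensity {ga p r v : ℝ} (hv : 0 < v) :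
    v * firstKindDensity ga p r v = √v / √((v + ga) * (v + p) * (v + r)) := by
  have h := Real.sqrt_pos.2 hv
  rw [firstKindDensity, Real.sqrt_mul hv.le, ← div_div, mul_div_assoc', mul_one_div,
    Real.div_sqrt]

theorem measurable_firstKindDensity (ga p r : ℝ) : Measurable (firstKindDensity ga p r) := by
  unfold firstKindDensity; fun_prop

theorem measurable_secondKindDensity (ga p r : ℝ) : Measurable (secondKindDensity ga p r) := by
  unfold secondKindDensity; fun_prop

theorem measurable_thirdKindDensity (ga p r : ℝ) : Measurable (thirdKindDensity ga p r) := by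
  unfold thirdKindDensity; fun_prop

theorem firstKindDensity_nonneg (ga p r v : ℝ) : 0 ≤ firstKindDensity ga p r v := by
  unfold firstKindDensity; positivity

theorem firstKindDensity_le {ga p r m n v : ℝ} (hm : 0 < m) (hn : 0 < n) (h1 : m ≤ p) (h2 : m ≤ ga)
    (h3 : n ≤ r) (hv : 0 < v) :
    firstKindDensity ga p r v ≤ 1 / √n * (1 / (√v * (v + m))) := by
  have hs := Real.sqrt_pos.2 hv
  have hq := Real.sqrt_pos.2 hn
  have e : 1 / √n * (1 / (√v * (v + m))) = 1 / (√v * (√n * (v + m))) := by field_simp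
  rw [firstKindDensity, Real.sqrt_mul hv.le, e]
  refine one_div_le_one_div_of_le (by positivity) (mul_le_mul_of_nonneg_left ?_ hs.le)
  refine Real.le_sqrt_of_sq_le ?_
  rw [mul_pow, Real.sq_sqrt hn.le, pow_two, mul_comm]
  have : n ≤ v + r := by linarith
  have : 0 < v + ga := by linarith
  have : 0 < v + p := by linarith
  gcongr

theorem integrableOn_firstKindDensity {ga p r : ℝ} (hp : 0 < p) (hg : p ≤ ga) (hr : 0 < r) :
    IntegrableOn (firstKindDensity ga p r) (Set.Ioi 0) := by
  refine Integrable.mono' (((inv_sqrt_mul_add_integral hp).1).const_mul (1 / √r))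
    (measurable_firstKindDensity ga p r).aestronglyMeasurable ?_
  refine (ae_restrict_iff' measurableSet_Ioi).2 (Eventually.of_forall fun v hv => ?_)
  rw [Real.norm_of_nonneg (firstKindDensity_nonneg ..)]
  exact firstKindDensity_le hp hr le_rfl hg le_rfl hv

theorem integral_firstKindDensity_le {ga p r : ℝ} (hp : 0 < p) (hg : p ≤ ga) (hr : 0 < r) :
    ∫ v in Set.Ioi (0 : ℝ), firstKindDensity ga p r v ≤ 1 / √r * (Real.pi / √p) := by
  rw [← (inv_sqrt_mul_add_integral hp).2, ← integral_const_mul]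
  refine setIntegral_mono_on (integrableOn_firstKindDensity hp hg hr)
    (((inv_sqrt_mul_add_integral hp).1).const_mul (1 / √r)) measurableSet_Ioi fun v hv => ?_
  exact firstKindDensity_le hp hr le_rfl hg le_rfl hv

theorem abs_div_sub_one_le {N D : ℝ} (hN : 0 ≤ N) (hD : 0 < D) :
    |N / D - 1| ≤ |N ^ 2 - D ^ 2| / D ^ 2 := by
  have e : N / D - 1 = (N ^ 2 - D ^ 2) / (D * (N + D)) := by
    field_simp; ring
  rw [e, abs_div, abs_of_pos (by positivity : 0 < D * (N + D))]
  refine div_le_div_of_nonneg_left (abs_nonneg _) (by positivity) ?_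
  nlinarith

theorem abs_secondKindDensity_le {ga p r m G v : ℝ} (hm : 0 < m) (h1 : m ≤ p) (h2 : p ≤ ga)
    (h3 : 0 ≤ r) (h4 : r ≤ p) (h5 : ga ≤ G) (hv : 0 < v) :
    |secondKindDensity ga p r v| ≤ 4 * G ^ 2 * (1 / (v + m) ^ 2) := by
  have hga : 0 < v + ga := by linarith
  have hp : 0 < v + p := by linarith
  have hr : 0 < v + r := by linarith
  have hD2 : 0 < (v + ga) * (v + p) * (v + r) := by positivity
  refine (abs_div_sub_one_le (N := √v * (v + (ga + p + r) / 2))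
    (mul_nonneg (Real.sqrt_nonneg _) (by linarith)) (Real.sqrt_pos.2 hD2)).trans ?_
  rw [Real.sq_sqrt hD2.le, mul_pow, Real.sq_sqrt hv.le, div_le_iff₀ hD2]
  have hG : 0 < G := by linarith
  have key : |v * (v + (ga + p + r) / 2) ^ 2 - (v + ga) * (v + p) * (v + r)| ≤
      4 * G ^ 2 * (v + r) := by
    have e : v * (v + (ga + p + r) / 2) ^ 2 - (v + ga) * (v + p) * (v + r) =
      (((ga + p + r) / 2) ^ 2 - (ga * p + ga * r + p * r)) * v - ga * p * r := by ring
    have a1 : ga * p ≤ G ^ 2 := by nlinarith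
    have a2 : ga * r ≤ G ^ 2 := by nlinarith
    have a3 : p * r ≤ G ^ 2 := by nlinarith
    have a4 : (ga + p + r) ^ 2 ≤ (3 * G) ^ 2 := by
      apply pow_le_pow_left₀ (by linarith); linarith
    have a5 : 0 ≤ ga * p := by nlinarith
    have a6 : 0 ≤ ga * r := by nlinarith
    have a7 : 0 ≤ p * r := by nlinarith
    rw [e, abs_le]
    have b1 := mul_le_mul_of_nonneg_right a1 h3
    have b2 : -(3 * G ^ 2) * v ≤ (((ga + p + r) / 2) ^ 2 - (ga * p + ga * r + p * r)) * v :=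
      mul_le_mul_of_nonneg_right (by nlinarith) hv.le
    have b3 : (((ga + p + r) / 2) ^ 2 - (ga * p + ga * r + p * r)) * v ≤ (3 * G ^ 2) * v :=
      mul_le_mul_of_nonneg_right (by nlinarith) hv.le
    have b4 : 0 ≤ ga * p * r := by positivity
    have b5 : 0 ≤ G ^ 2 * v := by positivity
    have b6 : 0 ≤ G ^ 2 * r := by positivity
    constructor <;> linarith
  refine key.trans ?_
  have : (v + m) ^ 2 ≤ (v + ga) * (v + p) := by
    rw [pow_two]; apply mul_le_mul <;> linarith
  have h6 : 1 ≤ 1 / (v + m) ^ 2 * ((v + ga) * (v + p)) := by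
    rw [one_div_mul_eq_div, le_div_iff₀ (by positivity)]; linarith
  calc 4 * G ^ 2 * (v + r) = 4 * G ^ 2 * (v + r) * 1 := by ring
    _ ≤ 4 * G ^ 2 * (v + r) * (1 / (v + m) ^ 2 * ((v + ga) * (v + p))) :=
      mul_le_mul_of_nonneg_left h6 (by positivity)
    _ = _ := by ring

theorem abs_thirdKindDensity_le {ga p r m G v : ℝ} (hm : 0 < m) (h1 : m ≤ p) (h2 : p ≤ ga)
    (h3 : 0 ≤ r) (h4 : r ≤ p) (h5 : ga ≤ G) (hv : 0 < v) :
    |thirdKindDensity ga p r v| ≤ G * (1 / (v + m) ^ 2) := by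
  have hga : 0 < v + ga := by linarith
  have hp : 0 < v + p := by linarith
  have hr : 0 < v + r := by linarith
  have hG : 0 < G := by linarith
  have hD2 : 0 < (v + ga) * (v + p) * (v + r) := by positivity
  have hD := Real.sqrt_pos.2 hD2
  have e : thirdKindDensity ga p r v =
      (√v * (v + ga) / √((v + ga) * (v + p) * (v + r)) - 1) * (1 / (v + ga)) := by
    rw [thirdKindDensity]; field_simp
  rw [e, abs_mul, abs_of_pos (by positivity : 0 < 1 / (v + ga))]
  refine (mul_le_mul_of_nonneg_right (abs_div_sub_one_le (N := √v * (v + ga))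
    (by positivity) hD) (by positivity)).trans ?_
  rw [Real.sq_sqrt hD2.le, mul_pow, Real.sq_sqrt hv.le]
  have e2 : v * (v + ga) ^ 2 - (v + ga) * (v + p) * (v + r) =
      (v + ga) * ((ga - p - r) * v - p * r) := by ring
  have key : |(ga - p - r) * v - p * r| ≤ G * (v + r) := by
    have b1 : (ga - p - r) * v ≤ G * v := mul_le_mul_of_nonneg_right (by linarith) hv.le
    have b2 : (-G) * v ≤ (ga - p - r) * v := mul_le_mul_of_nonneg_right (by linarith) hv.le
    have b3 : p * r ≤ G * r := mul_le_mul_of_nonneg_right (by linarith) h3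
    have b4 : 0 ≤ p * r := by nlinarith
    have b5 : 0 ≤ G * r := by positivity
    rw [abs_le]; constructor <;> linarith
  rw [e2, abs_mul, abs_of_pos hga]
  have : (v + m) ^ 2 ≤ (v + ga) * (v + p) := by
    rw [pow_two]; apply mul_le_mul <;> linarith
  calc (v + ga) * |(ga - p - r) * v - p * r| / ((v + ga) * (v + p) * (v + r)) * (1 / (v + ga))
      = |(ga - p - r) * v - p * r| / ((v + ga) * (v + p) * (v + r)) := by field_simp
    _ ≤ G * (v + r) / ((v + ga) * (v + p) * (v + r)) := by gcongr
    _ = G * (1 / ((v + ga) * (v + p))) := by field_simp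
    _ ≤ _ := by gcongr

theorem integrableOn_secondKindDensity {ga p r : ℝ} (hp : 0 < p) (h2 : p ≤ ga)
    (h3 : 0 ≤ r) (h4 : r ≤ p) : IntegrableOn (secondKindDensity ga p r) (Set.Ioi 0) := by
  refine Integrable.mono' ((integrableOn_inv_add_sq hp).const_mul (4 * ga ^ 2))
    (measurable_secondKindDensity ga p r).aestronglyMeasurable ?_
  exact (ae_restrict_iff' measurableSet_Ioi).2 (Eventually.of_forall fun v hv =>
    abs_secondKindDensity_le hp le_rfl h2 h3 h4 le_rfl hv)

theorem integrableOn_thirdKindDensity {ga p r : ℝ} (hp : 0 < p) (h2 : p ≤ ga)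
    (h3 : 0 ≤ r) (h4 : r ≤ p) : IntegrableOn (thirdKindDensity ga p r) (Set.Ioi 0) := by
  refine Integrable.mono' ((integrableOn_inv_add_sq hp).const_mul ga)
    (measurable_thirdKindDensity ga p r).aestronglyMeasurable ?_
  exact (ae_restrict_iff' measurableSet_Ioi).2 (Eventually.of_forall fun v hv =>
    abs_thirdKindDensity_le hp le_rfl h2 h3 h4 le_rfl hv)

section Limits

variable {ι : Type*} {l : Filter ι} [l.IsCountablyGenerated] {ga p r : ι → ℝ} {ga0 p0 r0 m G : ℝ}

theorem tendsto_integral_secondKindDensity (hm : 0 < m) (hG : ∀ᶠ i in l, ga i ≤ G)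
    (h1 : ∀ᶠ i in l, m ≤ p i) (h2 : ∀ᶠ i in l, p i ≤ ga i) (h3 : ∀ᶠ i in l, 0 ≤ r i)
    (h4 : ∀ᶠ i in l, r i ≤ p i) (hga : Tendsto ga l (𝓝 ga0)) (hp : Tendsto p l (𝓝 p0))
    (hr : Tendsto r l (𝓝 r0)) (hga0 : 0 < ga0) (hp0 : 0 < p0) (hr0 : 0 ≤ r0) :
    Tendsto (fun i => ∫ v in Set.Ioi (0 : ℝ), secondKindDensity (ga i) (p i) (r i) v) l
      (𝓝 (∫ v in Set.Ioi (0 : ℝ), secondKindDensity ga0 p0 r0 v)) := by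
  refine tendsto_integral_filter_of_dominated_convergence
    (fun v => 4 * G ^ 2 * (1 / (v + m) ^ 2))
    (Eventually.of_forall fun i => (measurable_secondKindDensity _ _ _).aestronglyMeasurable) ?_
    ((integrableOn_inv_add_sq hm).const_mul _) ?_
  · filter_upwards [hG, h1, h2, h3, h4] with i a0 a1 a2 a3 a4
    exact (ae_restrict_iff' measurableSet_Ioi).2 (Eventually.of_forall fun v hv =>
      abs_secondKindDensity_le hm a1 a2 a3 a4 a0 hv)
  · refine (ae_restrict_iff' measurableSet_Ioi).2 (Eventually.of_forall fun v hv => ?_)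
    have hv : 0 < v := hv
    have t : Tendsto (fun i => (v + ga i) * (v + p i) * (v + r i)) l
        (𝓝 ((v + ga0) * (v + p0) * (v + r0))) :=
      ((hga.const_add v).mul (hp.const_add v)).mul (hr.const_add v)
    refine (Tendsto.div (tendsto_const_nhds.mul (((hga.add hp).add hr).div_const 2 |>.const_add v))
      ((Real.continuous_sqrt.tendsto _).comp t) ?_).sub_const 1
    exact (Real.sqrt_pos.2 (by positivity)).ne'

theorem tendsto_integral_thirdKindDensity (hm : 0 < m) (hG : ∀ᶠ i in l, ga i ≤ G)
    (h1 : ∀ᶠ i in l, m ≤ p i) (h2 : ∀ᶠ i in l, p i ≤ ga i) (h3 : ∀ᶠ i in l, 0 ≤ r i)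
    (h4 : ∀ᶠ i in l, r i ≤ p i) (hga : Tendsto ga l (𝓝 ga0)) (hp : Tendsto p l (𝓝 p0))
    (hr : Tendsto r l (𝓝 r0)) (hga0 : 0 < ga0) (hp0 : 0 < p0) (hr0 : 0 ≤ r0) :
    Tendsto (fun i => ∫ v in Set.Ioi (0 : ℝ), thirdKindDensity (ga i) (p i) (r i) v) l
      (𝓝 (∫ v in Set.Ioi (0 : ℝ), thirdKindDensity ga0 p0 r0 v)) := by
  refine tendsto_integral_filter_of_dominated_convergence
    (fun v => G * (1 / (v + m) ^ 2))
    (Eventually.of_forall fun i => (measurable_thirdKindDensity _ _ _).aestronglyMeasurable) ?_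
    ((integrableOn_inv_add_sq hm).const_mul _) ?_
  · filter_upwards [hG, h1, h2, h3, h4] with i a0 a1 a2 a3 a4
    exact (ae_restrict_iff' measurableSet_Ioi).2 (Eventually.of_forall fun v hv =>
      abs_thirdKindDensity_le hm a1 a2 a3 a4 a0 hv)
  · refine (ae_restrict_iff' measurableSet_Ioi).2 (Eventually.of_forall fun v hv => ?_)
    have hv : 0 < v := hv
    have t : Tendsto (fun i => (v + ga i) * (v + p i) * (v + r i)) l
        (𝓝 ((v + ga0) * (v + p0) * (v + r0))) :=
      ((hga.const_add v).mul (hp.const_add v)).mul (hr.const_add v)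
    refine (Tendsto.div tendsto_const_nhds ((Real.continuous_sqrt.tendsto _).comp t) ?_).sub
      (Tendsto.div tendsto_const_nhds (hga.const_add v) (by positivity))
    exact (Real.sqrt_pos.2 (by positivity)).ne'

theorem tendsto_integral_firstKindDensity (hm : 0 < m)
    (h1 : ∀ᶠ i in l, m ≤ p i) (h2 : ∀ᶠ i in l, m ≤ ga i) (h3 : ∀ᶠ i in l, m ≤ r i)
    (hga : Tendsto ga l (𝓝 ga0)) (hp : Tendsto p l (𝓝 p0))
    (hr : Tendsto r l (𝓝 r0)) (hga0 : 0 < ga0) (hp0 : 0 < p0) (hr0 : 0 < r0) :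
    Tendsto (fun i => ∫ v in Set.Ioi (0 : ℝ), firstKindDensity (ga i) (p i) (r i) v) l
      (𝓝 (∫ v in Set.Ioi (0 : ℝ), firstKindDensity ga0 p0 r0 v)) := by
  refine tendsto_integral_filter_of_dominated_convergence
    (fun v => 1 / √m * (1 / (√v * (v + m))))
    (Eventually.of_forall fun i => (measurable_firstKindDensity _ _ _).aestronglyMeasurable) ?_
    ((inv_sqrt_mul_add_integral hm).1.const_mul _) ?_
  · filter_upwards [h1, h2, h3] with i a1 a2 a3
    refine (ae_restrict_iff' measurableSet_Ioi).2 (Eventually.of_forall fun v hv => ?_)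
    rw [Real.norm_of_nonneg (firstKindDensity_nonneg ..)]
    exact firstKindDensity_le hm hm a1 a2 a3 hv
  · refine (ae_restrict_iff' measurableSet_Ioi).2 (Eventually.of_forall fun v hv => ?_)
    have hv : 0 < v := hv
    have t : Tendsto (fun i => v * ((v + ga i) * (v + p i) * (v + r i))) l
        (𝓝 (v * ((v + ga0) * (v + p0) * (v + r0)))) :=
      (((hga.const_add v).mul (hp.const_add v)).mul (hr.const_add v)).const_mul v
    refine Tendsto.div tendsto_const_nhds ((Real.continuous_sqrt.tendsto _).comp t) ?_
    exact (Real.sqrt_pos.2 (by positivity)).ne'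

end Limits

theorem BminusOne_eq (a b c : ℝ) : BminusOne a b c =
    ∫ v in Set.Ioi (0 : ℝ), firstKindDensity (c ^ 2) (c ^ 2 - a ^ 2) (c ^ 2 - b ^ 2) v := by
  rw [BminusOne, integral_Ioi_eq_integral_Ioi_zero]
  congr 1
  ext v
  simp only [firstKindDensity]
  congr 2; ring

theorem Fminus_eq {a b c : ℝ} (ha : 0 < a) (hab : a < b) (hbc : b < c) : Fminus a b c =
    (1 / 2) * (c ^ 2 * BminusOne a b c +
      ∫ v in Set.Ioi (0 : ℝ), thirdKindDensity (c ^ 2) (c ^ 2 - a ^ 2) (c ^ 2 - b ^ 2) v) := by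
  have h1 : a ^ 2 < b ^ 2 := by nlinarith
  have h2 : b ^ 2 < c ^ 2 := by nlinarith
  rw [Fminus, integral_Ioi_eq_integral_Ioi_zero, BminusOne_eq, ← integral_const_mul (c ^ 2),
    ← integral_add]
  · congr 1
    refine setIntegral_congr_fun measurableSet_Ioi fun v hv => ?_
    simp only [thirdKindDensity, ← mul_firstKindDensity hv]
    have e : (v + c ^ 2) * (v + c ^ 2 - a ^ 2) * (v + c ^ 2 - b ^ 2) * (v + c ^ 2 - c ^ 2) =
      v * ((v + c ^ 2) * (v + (c ^ 2 - a ^ 2)) * (v + (c ^ 2 - b ^ 2))) := by ring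
    rw [e, firstKindDensity]
    ring
  · exact (integrableOn_firstKindDensity (by linarith) (by nlinarith) (by linarith)).const_mul _
  · exact integrableOn_thirdKindDensity (by linarith) (by nlinarith) (by linarith) (by linarith)

end FocusingNLS

namespace FocusingNLS

/-! ### Möbius substitutions -/

theorem hasDerivAt_mobius (e k : ℝ) {x : ℝ} (hx : x ≠ e) :
    HasDerivAt (fun x : ℝ => e + k / (x - e)) (-k / (x - e) ^ 2) x := by
  have h : x - e ≠ 0 := sub_ne_zero.2 hx
  refine (((hasDerivAt_const x k).div ((hasDerivAt_id x).sub_const e) h).const_add e).congr_deriv ?_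
  simp

theorem mobius_injOn (e : ℝ) {k : ℝ} (hk : k ≠ 0) {S : Set ℝ} (hS : ∀ x ∈ S, x ≠ e) :
    Set.InjOn (fun x : ℝ => e + k / (x - e)) S := by
  intro x hx y hy h
  have h1 : x - e ≠ 0 := sub_ne_zero.2 (hS x hx)
  have h2 : y - e ≠ 0 := sub_ne_zero.2 (hS y hy)
  simp only [add_right_inj] at h
  rw [div_eq_div_iff h1 h2] at h
  have := mul_left_cancel₀ hk h
  linarith

theorem mobius_mobius (e : ℝ) {k x : ℝ} (hk : k ≠ 0) :
    e + k / (e + k / (x - e) - e) = x := by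
  rw [add_sub_cancel_left, div_div_cancel₀ hk]; ring

/-- The Möbius involution that exchanges `β` with `γ` and `0` with `α` maps `(α, β)` to the
complement of `[0, γ]` and preserves `ds / χ`. -/
theorem integral_Ioo_eq_integral_Ioi_add {al be ga : ℝ} (ha : 0 < al) (hab : al < be)
    (hbg : be < ga)
    (hint : IntegrableOn (fun s => 1 / √(s * (s - al) * (be - s) * (ga - s))) (Set.Ioo al be)) :
    ∫ s in Set.Ioo al be, 1 / √(s * (s - al) * (be - s) * (ga - s)) =
      (∫ v in Set.Ioi (0 : ℝ), firstKindDensity ga (ga - al) (ga - be) v) +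
      ∫ v in Set.Ioi (0 : ℝ), firstKindDensity ga be al v := by
  have hd : 0 < be + ga - al := by linarith
  obtain ⟨e, he⟩ : ∃ e, e = be * ga / (be + ga - al) := ⟨_, rfl⟩
  have he' : e * (be + ga - al) = be * ga := by rw [he]; field_simp
  have e1 : al < e := by
    rw [he, lt_div_iff₀ hd]; nlinarith
  have e2 : e < be := by
    rw [he, div_lt_iff₀ hd]; nlinarith
  obtain ⟨k, hk⟩ : ∃ k, k = e * (e - al) := ⟨_, rfl⟩
  have hk' : k = (be - e) * (ga - e) := by rw [hk]; linarith
  have hkpos : 0 < k := by rw [hk]; exact mul_pos (by linarith) (by linarith)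
  have hkey : ∀ x : ℝ, x ≠ e → |(-k / (x - e) ^ 2)| •
      (1 / √((e + k / (x - e)) * (e + k / (x - e) - al) * (be - (e + k / (x - e))) *
        (ga - (e + k / (x - e))))) = 1 / √(x * (x - al) * (x - be) * (x - ga)) := by
    intro x hx
    have h1 : x - e ≠ 0 := sub_ne_zero.2 hx
    have s1 : e + k / (x - e) = e * (x - al) / (x - e) := by rw [hk]; field_simp; ring
    have s2 : e + k / (x - e) - al = (e - al) * x / (x - e) := by rw [hk]; field_simp; ring
    have s3 : be - (e + k / (x - e)) = (be - e) * (x - ga) / (x - e) := by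
      rw [hk']; field_simp; ring
    have s4 : ga - (e + k / (x - e)) = (ga - e) * (x - be) / (x - e) := by
      rw [hk']; field_simp; ring
    have s5 : (e + k / (x - e)) * (e + k / (x - e) - al) * (be - (e + k / (x - e))) *
        (ga - (e + k / (x - e))) = (x * (x - al) * (x - be) * (x - ga)) * (k / (x - e) ^ 2) ^ 2 := by
      rw [s2, s3, s4, s1]
      have : (k / (x - e) ^ 2) ^ 2 = (e * (e - al)) * ((be - e) * (ga - e)) / (x - e) ^ 4 := by
        rw [← hk, ← hk']; field_simp
      rw [this]; field_simp
    have hp : 0 < k / (x - e) ^ 2 := by positivity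
    rw [s5, Real.sqrt_mul' _ (sq_nonneg _), Real.sqrt_sq hp.le, neg_div, abs_neg, abs_of_pos hp,
      smul_eq_mul]
    field_simp
  have i1 : (fun x : ℝ => e + k / (x - e)) '' Set.Ioi ga = Set.Ioo e be := by
    ext y
    constructor
    · rintro ⟨x, hx, rfl⟩
      have hx : ga < x := hx
      have h1 : 0 < x - e := by linarith
      refine ⟨by simp; positivity, ?_⟩
      simp only
      rw [← sub_pos, show be - (e + k / (x - e)) = (be - e) * (x - ga) / (x - e) by
        rw [hk']; field_simp; ring]
      exact div_pos (mul_pos (by linarith) (by linarith)) h1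
    · rintro ⟨h1, h2⟩
      refine ⟨e + k / (y - e), ?_, mobius_mobius e hkpos.ne'⟩
      have h3 : 0 < y - e := by linarith
      rw [Set.mem_Ioi, ← sub_pos, show e + k / (y - e) - ga = (ga - e) * (be - y) / (y - e) by
        rw [hk']; field_simp; ring]
      exact div_pos (mul_pos (by linarith) (by linarith)) h3
  have i2 : (fun x : ℝ => e + k / (x - e)) '' Set.Iio 0 = Set.Ioo al e := by
    ext y
    constructor
    · rintro ⟨x, hx, rfl⟩
      have hx : x < 0 := hx
      have h1 : x - e < 0 := by linarith
      refine ⟨?_, by simp; exact div_neg_of_pos_of_neg hkpos h1⟩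
      simp only
      rw [← sub_pos, show e + k / (x - e) - al = (e - al) * x / (x - e) by
        rw [hk]; field_simp [h1.ne]; ring]
      exact div_pos_of_neg_of_neg (mul_neg_of_pos_of_neg (by linarith) hx) h1
    · rintro ⟨h1, h2⟩
      refine ⟨e + k / (y - e), ?_, mobius_mobius e hkpos.ne'⟩
      have h3 : y - e < 0 := by linarith
      rw [Set.mem_Iio, show e + k / (y - e) = e * (y - al) / (y - e) by
        rw [hk]; field_simp [h3.ne]; ring]
      exact div_neg_of_pos_of_neg (mul_pos (by linarith) (by linarith)) h3
  have hsplit : Set.Ioo al be =ᵐ[volume] (Set.Ioo al e ∪ Set.Ioo e be : Set ℝ) := by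
    have : Set.Ioo al be = Set.Ioo al e ∪ Set.Ico e be := (Set.Ioo_union_Ico_eq_Ioo e1 e2.le).symm
    rw [this]
    exact (ae_eq_refl _).union Ioo_ae_eq_Ico.symm
  have hI1 : ∫ s in Set.Ioo e be, 1 / √(s * (s - al) * (be - s) * (ga - s)) =
      ∫ v in Set.Ioi (0 : ℝ), firstKindDensity ga (ga - al) (ga - be) v := by
    rw [← i1, integral_image_eq_integral_abs_deriv_smul measurableSet_Ioi
      (fun x hx => (hasDerivAt_mobius e k (e2.trans (hbg.trans hx)).ne').hasDerivWithinAt)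
      (mobius_injOn e hkpos.ne' fun x hx => (e2.trans (hbg.trans hx)).ne')]
    rw [setIntegral_congr_fun measurableSet_Ioi
      (fun x hx => hkey x (e2.trans (hbg.trans hx)).ne'), integral_Ioi_eq_integral_Ioi_zero]
    congr 1
    ext v
    simp only [firstKindDensity]
    congr 2; ring
  have hI2 : ∫ s in Set.Ioo al e, 1 / √(s * (s - al) * (be - s) * (ga - s)) =
      ∫ v in Set.Ioi (0 : ℝ), firstKindDensity ga be al v := by
    have hlt : ∀ x ∈ Set.Iio (0 : ℝ), x ≠ e := fun x hx => (lt_trans hx (ha.trans e1)).ne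
    rw [← i2, integral_image_eq_integral_abs_deriv_smul measurableSet_Iio
      (fun x hx => (hasDerivAt_mobius e k (hlt x hx)).hasDerivWithinAt)
      (mobius_injOn e hkpos.ne' hlt)]
    rw [setIntegral_congr_fun measurableSet_Iio (fun x hx => hkey x (hlt x hx)),
      ← integral_Iic_eq_integral_Iio]
    have := integral_comp_neg_Ioi 0 (fun x : ℝ => 1 / √(x * (x - al) * (x - be) * (x - ga)))
    rw [neg_zero] at this
    rw [← this]
    congr 1
    ext v
    simp only [firstKindDensity]
    congr 2; ring
  rw [setIntegral_congr_set hsplit, setIntegral_union _ measurableSet_Ioo, hI1, hI2, add_comm]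
  · exact hint.mono_set (Set.Ioo_subset_Ioo_right e2.le)
  · exact hint.mono_set (Set.Ioo_subset_Ioo_left e1.le)
  · rw [Set.disjoint_left]
    rintro x ⟨_, h1⟩ ⟨h2, _⟩
    linarith

/-- The Möbius involution that exchanges `α` with `γ` and `β` with `∞`, in the variable `y`,
`y ^ 2 = s`. -/
theorem image_mobius_sq {b c al : ℝ} (hb : 0 < b) (hbc : b < c) (hal : al < b ^ 2) :
    (fun y : ℝ => b ^ 2 - (b ^ 2 - al) * (c ^ 2 - b ^ 2) / (y ^ 2 - b ^ 2)) '' Set.Ioi c =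
      Set.Ioo al (b ^ 2) := by
  have hk : 0 < (b ^ 2 - al) * (c ^ 2 - b ^ 2) := mul_pos (by linarith) (by nlinarith)
  have h2 : b ^ 2 < c ^ 2 := by nlinarith
  ext s
  constructor
  · rintro ⟨y, hy, rfl⟩
    have hy : c < y := hy
    have h1 : 0 < y ^ 2 - b ^ 2 := by nlinarith
    have h3 : 0 < y ^ 2 - c ^ 2 := by nlinarith
    refine ⟨?_, ?_⟩
    · simp only
      rw [lt_sub_iff_add_lt, ← lt_sub_iff_add_lt', div_lt_iff₀ h1]
      exact mul_lt_mul_of_pos_left (by linarith) (by linarith)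
    · simp only
      have := div_pos hk h1
      linarith
  · rintro ⟨h1, h3⟩
    have hz : 0 < b ^ 2 - s := by linarith
    have hq : c ^ 2 < b ^ 2 + (b ^ 2 - al) * (c ^ 2 - b ^ 2) / (b ^ 2 - s) := by
      rw [← sub_lt_iff_lt_add', lt_div_iff₀ hz, mul_comm]
      exact mul_lt_mul_of_pos_right (by linarith) (by linarith)
    refine ⟨√(b ^ 2 + (b ^ 2 - al) * (c ^ 2 - b ^ 2) / (b ^ 2 - s)), ?_, ?_⟩
    · exact Real.lt_sqrt_of_sq_lt hq
    · simp only
      rw [Real.sq_sqrt (by nlinarith), add_sub_cancel_left, div_div_cancel₀ hk.ne']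
      ring

theorem mobius_sq_substitution {a b c : ℝ} (ha : 0 < a) (hab : a < b) (hbc : b < c) (g : ℝ → ℝ) :
    (IntegrableOn (fun s => g s / √((s - a ^ 2) * (b ^ 2 - s) * (c ^ 2 - s)))
      (Set.Ioo (a ^ 2) (b ^ 2)) ↔
      IntegrableOn (fun y => 2 * y *
      g (b ^ 2 - (b ^ 2 - a ^ 2) * (c ^ 2 - b ^ 2) / (y ^ 2 - b ^ 2)) /
        √((y ^ 2 - a ^ 2) * (y ^ 2 - b ^ 2) * (y ^ 2 - c ^ 2))) (Set.Ioi c)) ∧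
    ∫ s in Set.Ioo (a ^ 2) (b ^ 2), g s / √((s - a ^ 2) * (b ^ 2 - s) * (c ^ 2 - s)) =
    ∫ y in Set.Ioi c, 2 * y *
      g (b ^ 2 - (b ^ 2 - a ^ 2) * (c ^ 2 - b ^ 2) / (y ^ 2 - b ^ 2)) /
        √((y ^ 2 - a ^ 2) * (y ^ 2 - b ^ 2) * (y ^ 2 - c ^ 2)) := by
  have h1 : a ^ 2 < b ^ 2 := by nlinarith
  have h2 : b ^ 2 < c ^ 2 := by nlinarith
  have hb : 0 < b := ha.trans hab
  obtain ⟨k, hk⟩ : ∃ k, k = (b ^ 2 - a ^ 2) * (c ^ 2 - b ^ 2) := ⟨_, rfl⟩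
  have hk0 : 0 < k := by rw [hk]; exact mul_pos (by linarith) (by linarith)
  have hd : ∀ y ∈ Set.Ioi c, HasDerivWithinAt
      (fun y : ℝ => b ^ 2 - (b ^ 2 - a ^ 2) * (c ^ 2 - b ^ 2) / (y ^ 2 - b ^ 2))
      (2 * y * k / (y ^ 2 - b ^ 2) ^ 2) (Set.Ioi c) y := by
    intro y hy
    have hy : c < y := hy
    have h3 : 0 < y ^ 2 - b ^ 2 := by nlinarith
    rw [← hk]
    refine ((((hasDerivAt_const y k).div ((hasDerivAt_pow 2 y).sub_const _)
      h3.ne').const_sub _).congr_deriv ?_).hasDerivWithinAt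
    simp; ring
  have hinj : Set.InjOn
      (fun y : ℝ => b ^ 2 - (b ^ 2 - a ^ 2) * (c ^ 2 - b ^ 2) / (y ^ 2 - b ^ 2)) (Set.Ioi c) := by
    intro x hx y hy h
    have hx : c < x := hx
    have hy : c < y := hy
    have h3 : 0 < y ^ 2 - b ^ 2 := by nlinarith
    have h4 : 0 < x ^ 2 - b ^ 2 := by nlinarith
    simp only [sub_right_inj] at h
    rw [← hk, div_eq_div_iff h4.ne' h3.ne'] at h
    have := mul_left_cancel₀ hk0.ne' h
    nlinarith
  have hkey : ∀ y ∈ Set.Ioi c, |(2 * y * k / (y ^ 2 - b ^ 2) ^ 2)| •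
      (fun s => g s / √((s - a ^ 2) * (b ^ 2 - s) * (c ^ 2 - s)))
      (b ^ 2 - (b ^ 2 - a ^ 2) * (c ^ 2 - b ^ 2) / (y ^ 2 - b ^ 2)) =
      2 * y * g (b ^ 2 - (b ^ 2 - a ^ 2) * (c ^ 2 - b ^ 2) / (y ^ 2 - b ^ 2)) /
        √((y ^ 2 - a ^ 2) * (y ^ 2 - b ^ 2) * (y ^ 2 - c ^ 2)) := by
    intro y hy
    have hy : c < y := hy
    have hy0 : 0 < y := by linarith
    have h3 : 0 < y ^ 2 - b ^ 2 := by nlinarith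
    have h4 : 0 < y ^ 2 - c ^ 2 := by nlinarith
    have h5 : 0 < y ^ 2 - a ^ 2 := by nlinarith
    have hR : 0 < (y ^ 2 - a ^ 2) * (y ^ 2 - b ^ 2) * (y ^ 2 - c ^ 2) := by positivity
    have s5 : (b ^ 2 - k / (y ^ 2 - b ^ 2) - a ^ 2) * (b ^ 2 - (b ^ 2 - k / (y ^ 2 - b ^ 2))) *
        (c ^ 2 - (b ^ 2 - k / (y ^ 2 - b ^ 2))) =
        ((y ^ 2 - a ^ 2) * (y ^ 2 - b ^ 2) * (y ^ 2 - c ^ 2)) * (k / (y ^ 2 - b ^ 2) ^ 2) ^ 2 := by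
      rw [hk]; field_simp; ring
    have hp : 0 < k / (y ^ 2 - b ^ 2) ^ 2 := by positivity
    simp only [← hk]
    rw [s5, Real.sqrt_mul' _ (sq_nonneg _), Real.sqrt_sq hp.le, abs_of_pos (by positivity),
      smul_eq_mul]
    have := Real.sqrt_pos.2 hR
    field_simp
  rw [← image_mobius_sq hb hbc h1, integrableOn_image_iff_integrableOn_abs_deriv_smul
    measurableSet_Ioi hd hinj, integral_image_eq_integral_abs_deriv_smul measurableSet_Ioi hd hinj]
  exact ⟨integrableOn_congr_fun hkey measurableSet_Ioi,
    setIntegral_congr_fun measurableSet_Ioi hkey⟩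

theorem image_sq_sub_Ioo {a b : ℝ} (ha : 0 ≤ a) (hab : a < b) (k : ℝ) :
    (fun y : ℝ => y ^ 2 - k) '' Set.Ioo a b = Set.Ioo (a ^ 2 - k) (b ^ 2 - k) := by
  ext s
  constructor
  · rintro ⟨y, ⟨h1, h2⟩, rfl⟩
    constructor <;> simp only <;> nlinarith
  · rintro ⟨h1, h2⟩
    refine ⟨√(s + k), ⟨Real.lt_sqrt_of_sq_lt (by linarith), ?_⟩, ?_⟩
    · rw [Real.sqrt_lt' (by linarith)]; linarith
    · simp only
      rw [Real.sq_sqrt (by nlinarith)]; ring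

theorem image_sq_sub_Ioi {c : ℝ} (hc : 0 ≤ c) (k : ℝ) :
    (fun y : ℝ => y ^ 2 - k) '' Set.Ioi c = Set.Ioi (c ^ 2 - k) := by
  ext s
  constructor
  · rintro ⟨y, h1, rfl⟩
    have h1 : c < y := h1
    simp only [Set.mem_Ioi]; nlinarith
  · intro h1
    have h1 : c ^ 2 - k < s := h1
    refine ⟨√(s + k), Real.lt_sqrt_of_sq_lt (by linarith), ?_⟩
    simp only
    rw [Real.sq_sqrt (by nlinarith)]; ring

theorem sq_sub_substitution {S : Set ℝ} (hS : MeasurableSet S) (h0 : ∀ y ∈ S, 0 < y)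
    (f : ℝ → ℝ) (k : ℝ) :
    (IntegrableOn f ((fun y : ℝ => y ^ 2 - k) '' S) ↔
      IntegrableOn (fun y => 2 * y * f (y ^ 2 - k)) S) ∧
    ∫ s in (fun y : ℝ => y ^ 2 - k) '' S, f s = ∫ y in S, 2 * y * f (y ^ 2 - k) := by
  have hd : ∀ y ∈ S, HasDerivWithinAt (fun y : ℝ => y ^ 2 - k) (2 * y) S y := fun y _ => by
    simpa using ((hasDerivAt_pow 2 y).sub_const k).hasDerivWithinAt
  have hinj : Set.InjOn (fun y : ℝ => y ^ 2 - k) S := by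
    intro x hx y hy h
    have h1 := h0 x hx
    have h2 := h0 y hy
    simp only at h
    nlinarith
  have hkey : ∀ y ∈ S, |2 * y| • f (y ^ 2 - k) = 2 * y * f (y ^ 2 - k) := fun y hy => by
    have := h0 y hy
    rw [abs_of_pos (by positivity), smul_eq_mul]
  rw [integrableOn_image_iff_integrableOn_abs_deriv_smul hS hd hinj,
    integral_image_eq_integral_abs_deriv_smul hS hd hinj]
  exact ⟨integrableOn_congr_fun hkey hS, setIntegral_congr_fun hS hkey⟩

end FocusingNLS

namespace FocusingNLS

/-! ### The periods in terms of continuous densities -/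

section Weights

theorem intervalIntegrable_congr_uIcc {f g : ℝ → ℝ} {p q : ℝ}
    (hf : IntervalIntegrable f volume p q) (h : Set.EqOn f g (Set.uIcc p q)) :
    IntervalIntegrable g volume p q :=
  IntervalIntegrable.congr (h.mono Set.uIoc_subset_uIcc) hf

theorem intervalIntegrable_ofReal {f : ℝ → ℝ} {p q : ℝ}
    (hf : IntervalIntegrable f volume p q) :
    IntervalIntegrable (fun y => (f y : ℂ)) volume p q :=
  ⟨Integrable.ofReal hf.1, Integrable.ofReal hf.2⟩

variable {a b c : ℝ}

theorem one_div_sqrt_central (ha : 0 < a) (hab : a < b) (hbc : b < c) {y : ℝ}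
    (hy : y ∈ Set.Icc (-a) a) :
    1 / √((a ^ 2 - y ^ 2) * (b ^ 2 - y ^ 2) * (c ^ 2 - y ^ 2)) =
      arcsineWeight (-a) a y * (1 / √((b ^ 2 - y ^ 2) * (c ^ 2 - y ^ 2))) := by
  have h1 : 0 < b ^ 2 - y ^ 2 := by nlinarith [hy.1, hy.2]
  have h2 : 0 < c ^ 2 - y ^ 2 := by nlinarith [hy.1, hy.2]
  rw [arcsineWeight, one_div_mul_one_div, ← Real.sqrt_mul' _ (by positivity)]
  congr 2; ring

theorem continuousOn_central (ha : 0 < a) (hab : a < b) (hbc : b < c) :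
    ContinuousOn (fun y : ℝ => 1 / √((b ^ 2 - y ^ 2) * (c ^ 2 - y ^ 2))) (Set.Icc (-a) a) := by
  refine ContinuousOn.div continuousOn_const (by fun_prop) fun y hy => ?_
  have h1 : 0 < b ^ 2 - y ^ 2 := by nlinarith [hy.1, hy.2]
  have h2 : 0 < c ^ 2 - y ^ 2 := by nlinarith [hy.1, hy.2]
  exact (Real.sqrt_pos.2 (by positivity)).ne'

theorem intervalIntegrable_central (ha : 0 < a) (hab : a < b) (hbc : b < c) :
    IntervalIntegrable (fun y : ℝ => 1 / √((a ^ 2 - y ^ 2) * (b ^ 2 - y ^ 2) * (c ^ 2 - y ^ 2)))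
      volume (-a) a := by
  refine intervalIntegrable_congr_uIcc (intervalIntegrable_arcsineWeight_mul (by linarith)
    (continuousOn_central ha hab hbc)) ?_
  rw [Set.uIcc_of_le (by linarith)]
  exact fun y hy => (one_div_sqrt_central ha hab hbc hy).symm

theorem intervalIntegrable_gap (ha : 0 < a) (hab : a < b) (hbc : b < c) :
    IntervalIntegrable (fun y : ℝ => 1 / √((y ^ 2 - a ^ 2) * (b ^ 2 - y ^ 2) * (c ^ 2 - y ^ 2)))
      volume a b := by
  have hpos : ∀ y ∈ Set.Icc a b, 0 < (y + a) * (b + y) * (c ^ 2 - y ^ 2) := fun y hy => by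
    have h1 : 0 < y + a := by linarith [hy.1]
    have h2 : 0 < b + y := by linarith [hy.1]
    have h3 : 0 < c ^ 2 - y ^ 2 := by nlinarith [hy.1, hy.2]
    positivity
  have hc : ContinuousOn (fun y : ℝ => 1 / √((y + a) * (b + y) * (c ^ 2 - y ^ 2)))
      (Set.Icc a b) :=
    ContinuousOn.div continuousOn_const (by fun_prop) fun y hy =>
      (Real.sqrt_pos.2 (hpos y hy)).ne'
  refine intervalIntegrable_congr_uIcc (intervalIntegrable_arcsineWeight_mul hab hc) ?_
  rw [Set.uIcc_of_le hab.le]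
  intro y hy
  simp only
  rw [arcsineWeight, one_div_mul_one_div, ← Real.sqrt_mul' _ (hpos y hy).le]
  congr 2; ring

theorem intervalIntegrable_ray (ha : 0 < a) (hab : a < b) (hbc : b < c) {Y Y' : ℝ} (hY : c ≤ Y)
    (hY' : c ≤ Y') :
    IntervalIntegrable (fun y : ℝ => 1 / √((y ^ 2 - a ^ 2) * (y ^ 2 - b ^ 2) * (y ^ 2 - c ^ 2)))
      volume Y Y' := by
  wlog hle : Y ≤ Y' generalizing Y Y'
  · exact (this hY' hY (le_of_not_ge hle)).symm
  have hpos : ∀ y ∈ Set.Icc c (Y' + 1), 0 < (y + c) * (y ^ 2 - a ^ 2) * (y ^ 2 - b ^ 2) :=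
    fun y hy => by
    have h1 : 0 < y + c := by linarith [hy.1]
    have h2 : 0 < y ^ 2 - a ^ 2 := by nlinarith [hy.1]
    have h3 : 0 < y ^ 2 - b ^ 2 := by nlinarith [hy.1]
    positivity
  have hc : ContinuousOn (fun y : ℝ => √(Y' + 1 - y) *
      (1 / √((y + c) * (y ^ 2 - a ^ 2) * (y ^ 2 - b ^ 2)))) (Set.Icc c (Y' + 1)) :=
    ContinuousOn.mul (by fun_prop) (ContinuousOn.div continuousOn_const (by fun_prop) fun y hy =>
      (Real.sqrt_pos.2 (hpos y hy)).ne')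
  refine intervalIntegrable_congr_uIcc
    ((intervalIntegrable_arcsineWeight_mul (by linarith) hc).mono_set ?_) ?_
  · rw [Set.uIcc_of_le hle, Set.uIcc_of_le (by linarith)]
    exact Set.Icc_subset_Icc hY (by linarith)
  rw [Set.uIcc_of_le hle]
  intro y hy
  have hq : 0 < Y' + 1 - y := by linarith [hy.2]
  have hq' := Real.sqrt_pos.2 hq
  have hp := hpos y ⟨hY.trans hy.1, by linarith [hy.2]⟩
  have hp' := Real.sqrt_pos.2 hp
  simp only
  have e : (y ^ 2 - a ^ 2) * (y ^ 2 - b ^ 2) * (y ^ 2 - c ^ 2) =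
    (y - c) * ((y + c) * (y ^ 2 - a ^ 2) * (y ^ 2 - b ^ 2)) := by ring
  rw [arcsineWeight, Real.sqrt_mul' _ hq.le, e, Real.sqrt_mul' _ hp.le]
  rw [← one_div_mul_one_div, ← one_div_mul_one_div]
  field_simp

theorem intervalIntegrable_mul_ofReal {f : ℝ → ℝ} {g : ℝ → ℂ} {p q : ℝ}
    (hf : IntervalIntegrable (fun y => 1 / f y) volume p q) (hg : Continuous g) :
    IntervalIntegrable (fun y => g y / (f y : ℂ)) volume p q := by
  have := (intervalIntegrable_ofReal hf).continuousOn_mul hg.continuousOn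
  refine IntervalIntegrable.congr (fun y _ => ?_) this
  simp [div_eq_mul_inv]

theorem intervalIntegrable_mul_real {f : ℝ → ℝ} {g : ℝ → ℝ} {p q : ℝ}
    (hf : IntervalIntegrable (fun y => 1 / f y) volume p q) (hg : Continuous g) :
    IntervalIntegrable (fun y => g y / f y) volume p q := by
  refine intervalIntegrable_congr_uIcc (hf.continuousOn_mul hg.continuousOn) fun y _ => ?_
  simp [div_eq_mul_inv]

theorem integral_combination {f e o : ℝ → ℝ} {p q : ℝ} (z₁ z₂ : ℂ)
    (hf : IntervalIntegrable (fun y => 1 / f y) volume p q) (he : Continuous e)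
    (ho : Continuous o) :
    ∫ y in p..q, (z₁ * e y + z₂ * o y) / (f y : ℂ) =
      z₁ * ((∫ y in p..q, e y / f y : ℝ) : ℂ) + z₂ * ((∫ y in p..q, o y / f y : ℝ) : ℂ) := by
  rw [← intervalIntegral.integral_ofReal, ← intervalIntegral.integral_ofReal,
    ← intervalIntegral.integral_const_mul, ← intervalIntegral.integral_const_mul,
    ← intervalIntegral.integral_add]
  · refine intervalIntegral.integral_congr fun y _ => ?_
    push_cast; ring
  · exact (intervalIntegrable_ofReal (intervalIntegrable_mul_real hf he)).const_mul _
  · exact (intervalIntegrable_ofReal (intervalIntegrable_mul_real hf ho)).const_mul _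

theorem integral_odd_div {f o : ℝ → ℝ} {a : ℝ} (hf : ∀ y, f (-y) = f y) (ho : ∀ y, o (-y) = -o y) :
    ∫ y in (-a)..a, o y / f y = 0 := by
  have h := intervalIntegral.integral_comp_neg (a := -a) (b := a) (fun y => o y / f y)
  simp only [hf, ho, neg_neg, neg_div, intervalIntegral.integral_neg] at h
  linarith

theorem hasZeroAPeriods_iff (ha : 0 < a) (hab : a < b) (hbc : b < c) {l0 : ℝ} {P : ℂ[X]}
    {e o : ℝ → ℝ} {z₁ z₂ : ℂ} (he : Continuous e) (ho : Continuous o)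
    (he' : ∀ y, e (-y) = e y) (ho' : ∀ y, o (-y) = -o y)
    (hP : ∀ y : ℝ, P.eval ((l0 : ℂ) + Complex.I * y) = z₁ * e y + z₂ * o y) :
    HasZeroAPeriods l0 a b c P ↔
      z₁ * ((∫ y in (-a)..a,
        e y / √((a ^ 2 - y ^ 2) * (b ^ 2 - y ^ 2) * (c ^ 2 - y ^ 2)) : ℝ) : ℂ) = 0 ∧
      z₂ * ((∫ y in a..b,
        o y / √((y ^ 2 - a ^ 2) * (b ^ 2 - y ^ 2) * (c ^ 2 - y ^ 2)) : ℝ) : ℂ) = 0 := by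
  have hP' : ∀ y : ℝ, P.eval ((l0 : ℂ) - Complex.I * y) = z₁ * e y - z₂ * o y := fun y => by
    have := hP (-y)
    rw [he', ho'] at this
    push_cast at this
    rw [mul_neg, ← sub_eq_add_neg] at this
    rw [this]; ring
  unfold HasZeroAPeriods
  have h1 : ∫ y in (-a)..a, P.eval ((l0 : ℂ) + Complex.I * y) /
      (√((a ^ 2 - y ^ 2) * (b ^ 2 - y ^ 2) * (c ^ 2 - y ^ 2)) : ℝ) =
      z₁ * ((∫ y in (-a)..a,
        e y / √((a ^ 2 - y ^ 2) * (b ^ 2 - y ^ 2) * (c ^ 2 - y ^ 2)) : ℝ) : ℂ) := by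
    simp only [hP]
    rw [integral_combination (f := fun y => √((a ^ 2 - y ^ 2) * (b ^ 2 - y ^ 2) * (c ^ 2 - y ^ 2)))
      z₁ z₂ (intervalIntegrable_central ha hab hbc) he ho,
      integral_odd_div (by intro y; simp) ho']
    simp
  have h2 : ∫ y in a..b, (P.eval ((l0 : ℂ) + Complex.I * y) - P.eval ((l0 : ℂ) - Complex.I * y)) /
      (√((y ^ 2 - a ^ 2) * (b ^ 2 - y ^ 2) * (c ^ 2 - y ^ 2)) : ℝ) =
      2 * (z₂ * ((∫ y in a..b,
        o y / √((y ^ 2 - a ^ 2) * (b ^ 2 - y ^ 2) * (c ^ 2 - y ^ 2)) : ℝ) : ℂ)) := by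
    have := integral_combination (f := fun y =>
      √((y ^ 2 - a ^ 2) * (b ^ 2 - y ^ 2) * (c ^ 2 - y ^ 2)))
      (2 * z₂) 0 (intervalIntegrable_gap ha hab hbc) ho ho
    rw [zero_mul, add_zero, mul_assoc] at this
    rw [← this]
    refine intervalIntegral.integral_congr fun y _ => ?_
    simp only [hP, hP']
    ring
  rw [h1, h2]
  simp

theorem abelianIntegral_eq (l0 : ℝ) (P : ℂ[X]) (Y : ℝ) :
    abelianIntegral l0 a b c P Y = -∫ y in c..Y, P.eval ((l0 : ℂ) + Complex.I * y) /
      (√((y ^ 2 - a ^ 2) * (y ^ 2 - b ^ 2) * (y ^ 2 - c ^ 2)) : ℝ) := by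
  rw [abelianIntegral, ← intervalIntegral.integral_neg]
  refine intervalIntegral.integral_congr fun y _ => ?_
  simp only [wRay]
  rw [div_mul_eq_mul_div, neg_mul, div_neg, mul_comm (eval _ P),
    mul_div_mul_left _ _ Complex.I_ne_zero]

theorem abelianIntegral_combination (ha : 0 < a) (hab : a < b) (hbc : b < c) {l0 : ℝ} {P : ℂ[X]}
    {e o : ℝ → ℝ} {z₁ z₂ : ℂ} (he : Continuous e) (ho : Continuous o)
    (hP : ∀ y : ℝ, P.eval ((l0 : ℂ) + Complex.I * y) = z₁ * e y + z₂ * o y) {Y : ℝ} (hY : c ≤ Y) :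
    abelianIntegral l0 a b c P Y =
      -(z₁ * ((∫ y in c..Y,
        e y / √((y ^ 2 - a ^ 2) * (y ^ 2 - b ^ 2) * (y ^ 2 - c ^ 2)) : ℝ) : ℂ) +
      z₂ * ((∫ y in c..Y,
        o y / √((y ^ 2 - a ^ 2) * (y ^ 2 - b ^ 2) * (y ^ 2 - c ^ 2)) : ℝ) : ℂ)) := by
  rw [abelianIntegral_eq]
  simp only [hP]
  rw [integral_combination (f := fun y => √((y ^ 2 - a ^ 2) * (y ^ 2 - b ^ 2) * (y ^ 2 - c ^ 2)))
      z₁ z₂ (intervalIntegrable_ray ha hab hbc le_rfl hY) he ho]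

theorem HasZeroAPeriods.sub (ha : 0 < a) (hab : a < b) (hbc : b < c) {l0 : ℝ} {P Q : ℂ[X]}
    (hP : HasZeroAPeriods l0 a b c P) (hQ : HasZeroAPeriods l0 a b c Q) :
    HasZeroAPeriods l0 a b c (P - Q) := by
  have c1 : ∀ P : ℂ[X], Continuous fun y : ℝ => P.eval ((l0 : ℂ) + Complex.I * y) := fun P =>
    P.continuous.comp (by fun_prop)
  have c2 : ∀ P : ℂ[X], Continuous fun y : ℝ => P.eval ((l0 : ℂ) - Complex.I * y) := fun P =>
    P.continuous.comp (by fun_prop)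
  constructor
  · have := intervalIntegral.integral_sub
      (intervalIntegrable_mul_ofReal (intervalIntegrable_central ha hab hbc) (c1 P))
      (intervalIntegrable_mul_ofReal (intervalIntegrable_central ha hab hbc) (c1 Q))
    rw [hP.1, hQ.1, sub_zero] at this
    rw [← this]
    refine intervalIntegral.integral_congr fun y _ => ?_
    simp only [eval_sub]
    ring
  · have := intervalIntegral.integral_sub
      (intervalIntegrable_mul_ofReal (intervalIntegrable_gap ha hab hbc) ((c1 P).sub (c2 P)))
      (intervalIntegrable_mul_ofReal (intervalIntegrable_gap ha hab hbc) ((c1 Q).sub (c2 Q)))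
    simp only [Pi.sub_apply] at this
    rw [hP.2, hQ.2, sub_zero] at this
    rw [← this]
    refine intervalIntegral.integral_congr fun y _ => ?_
    simp only [eval_sub]
    ring

theorem abelianIntegral_sub (ha : 0 < a) (hab : a < b) (hbc : b < c) {l0 : ℝ} (P Q : ℂ[X])
    {Y : ℝ} (hY : c ≤ Y) :
    abelianIntegral l0 a b c (P - Q) Y =
      abelianIntegral l0 a b c P Y - abelianIntegral l0 a b c Q Y := by
  have c1 : ∀ P : ℂ[X], Continuous fun y : ℝ => P.eval ((l0 : ℂ) + Complex.I * y) := fun P =>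
    P.continuous.comp (by fun_prop)
  have := intervalIntegral.integral_sub
      (intervalIntegrable_mul_ofReal (intervalIntegrable_ray ha hab hbc le_rfl hY) (c1 P))
      (intervalIntegrable_mul_ofReal (intervalIntegrable_ray ha hab hbc le_rfl hY) (c1 Q))
  simp only [abelianIntegral_eq]
  simp only [eval_sub, sub_div]
  rw [this]; ring

end Weights

/-! ### Uniqueness of the constants -/

theorem exists_re_im_polynomial (Q : ℂ[X]) :
    ∃ A B : ℝ[X], ∀ y : ℝ, Q.eval (y : ℂ) = A.eval y + Complex.I * B.eval y := by
  induction Q using Polynomial.induction_on' with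
  | add p q hp hq =>
    obtain ⟨A, B, h⟩ := hp
    obtain ⟨A', B', h'⟩ := hq
    refine ⟨A + A', B + B', fun y => ?_⟩
    simp only [eval_add, h, h']
    push_cast; ring
  | monomial n z =>
    refine ⟨monomial n z.re, monomial n z.im, fun y => ?_⟩
    simp only [eval_monomial]
    push_cast
    conv_lhs => rw [← Complex.re_add_im z]
    ring

theorem natDegree_le_one_of_isBigO {a b c : ℝ} (ha : 0 < a) (hab : a < b) (hbc : b < c) {p : ℝ[X]}
    (hp : (fun Y => ∫ y in c..Y, p.eval y /
      √((y ^ 2 - a ^ 2) * (y ^ 2 - b ^ 2) * (y ^ 2 - c ^ 2))) =O[atTop] (fun _ => (1 : ℝ))) :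
    p.natDegree ≤ 1 := by
  by_contra! hd
  wlog hlc : 0 < p.leadingCoeff generalizing p
  · refine this (p := -p) ?_ (by simpa using hd) ?_
    · simpa only [eval_neg, neg_div, intervalIntegral.integral_neg] using hp.neg_left
    · have : p.leadingCoeff ≠ 0 := by
        rw [Ne, leadingCoeff_eq_zero]; rintro rfl; simp at hd
      rw [leadingCoeff_neg]
      have := lt_of_le_of_ne (not_lt.1 hlc) this
      linarith
  obtain ⟨η, hη⟩ : ∃ η, η = p.leadingCoeff / 2 := ⟨_, rfl⟩
  have hη0 : 0 < η := by rw [hη]; linarith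
  have hc : 0 < c := by linarith
  have hev : ∀ᶠ y in atTop, η * y ^ 2 ≤ p.eval y := by
    have hdeg : (p - C η * X ^ 2).natDegree = p.natDegree := by
      rcases eq_or_lt_of_le (show 2 ≤ p.natDegree from hd) with h2 | h2
      · refine natDegree_eq_of_le_of_coeff_ne_zero ?_ ?_
        · refine (natDegree_sub_le _ _).trans (max_le le_rfl ?_)
          rw [← h2]; exact natDegree_C_mul_X_pow_le _ _
        · rw [coeff_sub, coeff_natDegree, ← h2]
          simp; linarith
      · exact natDegree_sub_eq_left_of_natDegree_lt
          ((natDegree_C_mul_X_pow_le _ _).trans_lt h2)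
    have hlc' : 0 ≤ (p - C η * X ^ 2).leadingCoeff := by
      rw [leadingCoeff, hdeg, coeff_sub, coeff_natDegree, coeff_C_mul, coeff_X_pow]
      split_ifs <;> linarith
    have ht := tendsto_atTop_of_leadingCoeff_nonneg (p - C η * X ^ 2)
      (natDegree_pos_iff_degree_pos.1 (by omega)) hlc'
    filter_upwards [ht.eventually_ge_atTop 0] with y hy
    simp at hy
    linarith
  obtain ⟨Y1, hY1⟩ := eventually_atTop.1 (hev.and (eventually_gt_atTop c))
  have hcY : c < Y1 := (hY1 Y1 le_rfl).2
  have hlow : ∀ Y, Y1 ≤ Y → η * (Real.log (Y / Y1)) ≤ ∫ y in Y1..Y, p.eval y /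
      √((y ^ 2 - a ^ 2) * (y ^ 2 - b ^ 2) * (y ^ 2 - c ^ 2)) := by
    intro Y hY
    rw [← integral_one_div_of_pos (by linarith) (by linarith),
      ← intervalIntegral.integral_const_mul]
    refine intervalIntegral.integral_mono_on hY ?_ (intervalIntegrable_mul_real
      (intervalIntegrable_ray ha hab hbc hcY.le (by linarith)) p.continuous) ?_
    · refine ContinuousOn.intervalIntegrable ?_
      rw [Set.uIcc_of_le hY]
      refine ContinuousOn.mul continuousOn_const (ContinuousOn.div continuousOn_const
        continuousOn_id fun y hy => ?_)
      have := hy.1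
      linarith
    · intro y hy
      obtain ⟨h1, h2⟩ := hY1 y hy.1
      have hy0 : 0 < y := by linarith
      have k1 : 0 < y ^ 2 - a ^ 2 := by nlinarith
      have k2 : 0 < y ^ 2 - b ^ 2 := by nlinarith
      have k3 : 0 < y ^ 2 - c ^ 2 := by nlinarith
      have hR : √((y ^ 2 - a ^ 2) * (y ^ 2 - b ^ 2) * (y ^ 2 - c ^ 2)) ≤ y ^ 3 := by
        rw [Real.sqrt_le_left (by positivity)]
        calc (y ^ 2 - a ^ 2) * (y ^ 2 - b ^ 2) * (y ^ 2 - c ^ 2) ≤ y ^ 2 * y ^ 2 * y ^ 2 := by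
              gcongr <;> nlinarith
          _ = _ := by ring
      have hR0 := Real.sqrt_pos.2 (by positivity :
        0 < (y ^ 2 - a ^ 2) * (y ^ 2 - b ^ 2) * (y ^ 2 - c ^ 2))
      rw [le_div_iff₀ hR0]
      calc η * (1 / y) * √((y ^ 2 - a ^ 2) * (y ^ 2 - b ^ 2) * (y ^ 2 - c ^ 2)) ≤
          η * (1 / y) * y ^ 3 := by gcongr
        _ = η * y ^ 2 := by field_simp
        _ ≤ _ := h1
  obtain ⟨K, hK⟩ := hp.bound
  have hlog : Tendsto (fun Y => η * (Real.log (Y / Y1))) atTop atTop :=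
    (Real.tendsto_log_atTop.comp (tendsto_id.atTop_div_const (by linarith))).const_mul_atTop hη0
  obtain ⟨Y, h1, h2, h3⟩ := (hK.and ((eventually_ge_atTop Y1).and (hlog.eventually_gt_atTop
    (K - ∫ y in c..Y1, p.eval y /
      √((y ^ 2 - a ^ 2) * (y ^ 2 - b ^ 2) * (y ^ 2 - c ^ 2)))))).exists
  have h4 := hlow Y h2
  have h5 := intervalIntegral.integral_add_adjacent_intervals (intervalIntegrable_mul_real
      (intervalIntegrable_ray ha hab hbc le_rfl hcY.le) p.continuous) (intervalIntegrable_mul_real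
      (intervalIntegrable_ray ha hab hbc hcY.le (hcY.le.trans h2)) p.continuous)
  rw [norm_one, mul_one, ← h5] at h1
  have h6 := le_trans (le_abs_self _) h1
  linarith

theorem isAbelianConstant_unique {a b c l0 : ℝ} (ha : 0 < a) (hab : a < b) (hbc : b < c) {n : ℕ}
    {m K K' : ℂ} (hK : IsAbelianConstant l0 a b c n m K) (hK' : IsAbelianConstant l0 a b c n m K') :
    K = K' := by
  obtain ⟨P, -, hz, hO⟩ := hK
  obtain ⟨P', -, hz', hO'⟩ := hK'
  have hzd := hz.sub ha hab hbc hz'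
  have hd : (fun Y : ℝ => abelianIntegral l0 a b c (P - P') Y + Complex.I * (K - K'))
      =O[atTop] (fun Y : ℝ => Y⁻¹) := by
    refine (hO.sub hO').congr' ?_ EventuallyEq.rfl
    filter_upwards [eventually_ge_atTop c] with Y hY
    rw [abelianIntegral_sub ha hab hbc P P' hY]
    ring
  have hinv : (fun Y : ℝ => Y⁻¹) =O[atTop] (fun _ => (1 : ℝ)) :=
    tendsto_inv_atTop_zero.isBigO_one ℝ
  have hb : (fun Y : ℝ => abelianIntegral l0 a b c (P - P') Y) =O[atTop] (fun _ => (1 : ℝ)) := by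
    have h1 : (fun _ : ℝ => Complex.I * (K - K')) =O[atTop] (fun _ => (1 : ℝ)) :=
      isBigO_const_const _ one_ne_zero _
    refine ((hd.trans hinv).sub h1).congr_left fun Y => ?_
    ring
  obtain ⟨A, B, hAB⟩ := exists_re_im_polynomial ((P - P').comp (C (l0 : ℂ) + C Complex.I * X))
  have hev : ∀ y : ℝ, (P - P').eval ((l0 : ℂ) + Complex.I * y) =
      1 * ((A.eval y : ℝ) : ℂ) + Complex.I * ((B.eval y : ℝ) : ℂ) := fun y => by
    rw [one_mul, ← hAB]
    simp [eval_comp]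
  have hI : ∀ᶠ Y in atTop, abelianIntegral l0 a b c (P - P') Y =
      -(((∫ y in c..Y,
        A.eval y / √((y ^ 2 - a ^ 2) * (y ^ 2 - b ^ 2) * (y ^ 2 - c ^ 2)) : ℝ) : ℂ) +
      Complex.I * ((∫ y in c..Y,
        B.eval y / √((y ^ 2 - a ^ 2) * (y ^ 2 - b ^ 2) * (y ^ 2 - c ^ 2)) : ℝ) : ℂ)) := by
    filter_upwards [eventually_ge_atTop c] with Y hY
    rw [abelianIntegral_combination ha hab hbc A.continuous B.continuous hev hY, one_mul]
  have hA : A.natDegree ≤ 1 := by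
    refine natDegree_le_one_of_isBigO ha hab hbc (IsBigO.trans (IsBigO.of_bound 1 ?_) hb)
    filter_upwards [hI] with Y hY
    have := Complex.abs_re_le_norm (abelianIntegral l0 a b c (P - P') Y)
    rw [hY] at this ⊢
    simpa using this
  have hB : B.natDegree ≤ 1 := by
    refine natDegree_le_one_of_isBigO ha hab hbc (IsBigO.trans (IsBigO.of_bound 1 ?_) hb)
    filter_upwards [hI] with Y hY
    have := Complex.abs_im_le_norm (abelianIntegral l0 a b c (P - P') Y)
    rw [hY] at this ⊢
    simpa using this
  have hev2 : ∀ y : ℝ, (P - P').eval ((l0 : ℂ) + Complex.I * y) =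
      (A.coeff 0 + Complex.I * B.coeff 0) * ((1 : ℝ) : ℂ) +
      (A.coeff 1 + Complex.I * B.coeff 1) * (y : ℂ) := fun y => by
    rw [hev, eq_X_add_C_of_natDegree_le_one hA, eq_X_add_C_of_natDegree_le_one hB]
    simp
    ring
  obtain ⟨p1, p2⟩ := (hasZeroAPeriods_iff ha hab hbc (e := fun _ => 1) (o := fun y => y)
    continuous_const continuous_id (fun _ => rfl) (fun _ => rfl) hev2).1 hzd
  have n1 : 0 < ∫ y in (-a)..a,
      1 / √((a ^ 2 - y ^ 2) * (b ^ 2 - y ^ 2) * (c ^ 2 - y ^ 2)) := by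
    refine intervalIntegral.intervalIntegral_pos_of_pos_on
      (intervalIntegrable_central ha hab hbc) (fun y hy => ?_) (by linarith)
    have k1 : 0 < a ^ 2 - y ^ 2 := by nlinarith [hy.1, hy.2]
    have k2 : 0 < b ^ 2 - y ^ 2 := by nlinarith [hy.1, hy.2]
    have k3 : 0 < c ^ 2 - y ^ 2 := by nlinarith [hy.1, hy.2]
    positivity
  have n2 : 0 < ∫ y in a..b,
      y / √((y ^ 2 - a ^ 2) * (b ^ 2 - y ^ 2) * (c ^ 2 - y ^ 2)) := by
    refine intervalIntegral.intervalIntegral_pos_of_pos_on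
      (intervalIntegrable_mul_real (intervalIntegrable_gap ha hab hbc) continuous_id)
      (fun y hy => ?_) hab
    have k0 : 0 < y := by linarith [hy.1]
    have k1 : 0 < y ^ 2 - a ^ 2 := by nlinarith [hy.1, hy.2]
    have k2 : 0 < b ^ 2 - y ^ 2 := by nlinarith [hy.1, hy.2]
    have k3 : 0 < c ^ 2 - y ^ 2 := by nlinarith [hy.1, hy.2]
    positivity
  have z1 := (mul_eq_zero.1 p1).resolve_right (by exact_mod_cast n1.ne')
  have z2 := (mul_eq_zero.1 p2).resolve_right (by exact_mod_cast n2.ne')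
  have hzero : ∀ Y, abelianIntegral l0 a b c (P - P') Y = 0 := fun Y => by
    simp [abelianIntegral, hev2, z1, z2]
  simp only [hzero, zero_add] at hd
  have := tendsto_nhds_unique (hd.trans_tendsto tendsto_inv_atTop_zero) tendsto_const_nhds
  have h2 := (mul_eq_zero.1 this.symm).resolve_left Complex.I_ne_zero
  exact sub_eq_zero.1 h2

end FocusingNLS

namespace FocusingNLS

/-! ### Existence of the constants -/

theorem integral_div_sqrt_eq {p q : ℝ} (hpq : p ≤ q) {f h D : ℝ → ℝ}
    (hh : ∀ s ∈ Set.Icc p q, 0 ≤ h s) (hD : ∀ s, D s = (s - p) * (q - s) * h s) :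
    ∫ s in p..q, f s / √(D s) = ∫ s in p..q, arcsineWeight p q s * (f s / √(h s)) := by
  refine intervalIntegral.integral_congr fun s hs => ?_
  rw [Set.uIcc_of_le hpq] at hs
  rw [hD, Real.sqrt_mul' _ (hh s hs), arcsineWeight]
  ring

section Periods

variable {a b c : ℝ}

theorem integral_central_eq (ha : 0 < a) (hab : a < b) (hbc : b < c) (f : ℝ → ℝ) :
    ∫ s in (0 : ℝ)..(a ^ 2), f s / √(s * (a ^ 2 - s) * (b ^ 2 - s) * (c ^ 2 - s)) =
      ∫ s in (0 : ℝ)..(a ^ 2),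
        arcsineWeight 0 (a ^ 2) s * (f s / √((b ^ 2 - s) * (c ^ 2 - s))) := by
  refine integral_div_sqrt_eq (by positivity) (fun s hs => ?_) (fun s => by ring)
  have := hs.2
  exact mul_nonneg (by nlinarith) (by nlinarith)

theorem integral_gap_eq (ha : 0 < a) (hab : a < b) (hbc : b < c) (f : ℝ → ℝ) :
    ∫ s in (a ^ 2)..(b ^ 2), f s / √((s - a ^ 2) * (b ^ 2 - s) * (c ^ 2 - s)) =
      ∫ s in (a ^ 2)..(b ^ 2), arcsineWeight (a ^ 2) (b ^ 2) s * (f s / √(c ^ 2 - s)) := by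
  refine integral_div_sqrt_eq (by nlinarith) (fun s hs => ?_) (fun s => by ring)
  have := hs.2
  nlinarith

theorem continuousOn_div_sqrt {f h : ℝ → ℝ} {S : Set ℝ} (hf : ContinuousOn f S)
    (hh : ContinuousOn h S) (h0 : ∀ s ∈ S, 0 < h s) : ContinuousOn (fun s => f s / √(h s)) S :=
  hf.div hh.sqrt fun s hs => (Real.sqrt_pos.2 (h0 s hs)).ne'

theorem central_pos (ha : 0 < a) (hab : a < b) (hbc : b < c) :
    ∀ s ∈ Set.Icc 0 (a ^ 2), 0 < (b ^ 2 - s) * (c ^ 2 - s) := fun s hs => by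
  have := hs.2
  exact mul_pos (by nlinarith) (by nlinarith)

theorem intervalIntegrable_central_mul (ha : 0 < a) (hab : a < b) (hbc : b < c) {f : ℝ → ℝ}
    (hf : Continuous f) : IntervalIntegrable (fun s => arcsineWeight 0 (a ^ 2) s *
      (f s / √((b ^ 2 - s) * (c ^ 2 - s)))) volume 0 (a ^ 2) :=
  intervalIntegrable_arcsineWeight_mul (by positivity) (continuousOn_div_sqrt hf.continuousOn
    (by fun_prop) (central_pos ha hab hbc))

theorem intervalIntegrable_gap_mul (ha : 0 < a) (hab : a < b) (hbc : b < c) {f : ℝ → ℝ}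
    (hf : Continuous f) : IntervalIntegrable (fun s => arcsineWeight (a ^ 2) (b ^ 2) s *
      (f s / √(c ^ 2 - s))) volume (a ^ 2) (b ^ 2) :=
  intervalIntegrable_arcsineWeight_mul (by nlinarith) (continuousOn_div_sqrt hf.continuousOn
    (by fun_prop) fun s hs => by have := hs.2; nlinarith)

theorem Aminus_eq (ha : 0 < a) (hab : a < b) (hbc : b < c) : Aminus a b c =
    ∫ s in (0 : ℝ)..(a ^ 2), arcsineWeight 0 (a ^ 2) s * (1 / √((b ^ 2 - s) * (c ^ 2 - s))) :=
  integral_central_eq ha hab hbc fun _ => 1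

theorem Aplus_eq (ha : 0 < a) (hab : a < b) (hbc : b < c) : Aplus a b c =
    ∫ s in (a ^ 2)..(b ^ 2), arcsineWeight (a ^ 2) (b ^ 2) s * (1 / √(c ^ 2 - s)) :=
  integral_gap_eq ha hab hbc fun _ => 1

theorem Dminus_eq (ha : 0 < a) (hab : a < b) (hbc : b < c) : Dminus a b c =
    1 / 2 * ∫ s in (0 : ℝ)..(a ^ 2),
      arcsineWeight 0 (a ^ 2) s * (s / √((b ^ 2 - s) * (c ^ 2 - s))) := by
  rw [Dminus, integral_central_eq ha hab hbc fun s => s]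

theorem Bminus_eq (ha : 0 < a) (hab : a < b) (hbc : b < c) : Bminus a b c =
    ∫ s in (a ^ 2)..(b ^ 2), arcsineWeight (a ^ 2) (b ^ 2) s * (1 / √(s * (c ^ 2 - s))) := by
  refine integral_div_sqrt_eq (f := fun _ => 1) (by nlinarith) (fun s hs => ?_) (fun s => by ring)
  have h1 := hs.1
  have h2 := hs.2
  exact mul_nonneg (by nlinarith) (by nlinarith)

theorem Bplus_eq (ha : 0 < a) (hab : a < b) (hbc : b < c) : Bplus a b c =
    ∫ s in (b ^ 2)..(c ^ 2), arcsineWeight (b ^ 2) (c ^ 2) s * (1 / √(s - a ^ 2)) := by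
  refine integral_div_sqrt_eq (f := fun _ => 1) (by nlinarith) (fun s hs => ?_) (fun s => by ring)
  have h1 := hs.1
  nlinarith

theorem Aminus_pos (ha : 0 < a) (hab : a < b) (hbc : b < c) : 0 < Aminus a b c := by
  rw [Aminus_eq ha hab hbc]
  refine lt_of_lt_of_le ?_ (le_integral_arcsineWeight_mul (m := 1 / c ^ 2) (by positivity)
    (continuousOn_div_sqrt continuousOn_const (by fun_prop) (central_pos ha hab hbc))
    fun s hs => ?_)
  · have := Real.pi_pos
    have : 0 < c := by linarith
    positivity
  · refine one_div_le_one_div_of_le (Real.sqrt_pos.2 (central_pos ha hab hbc s hs)) ?_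
    rw [Real.sqrt_le_left (by positivity), pow_two (c ^ 2)]
    have := hs.1
    have := hs.2
    apply mul_le_mul <;> nlinarith

theorem Aplus_pos (ha : 0 < a) (hab : a < b) (hbc : b < c) : 0 < Aplus a b c := by
  rw [Aplus_eq ha hab hbc]
  refine lt_of_lt_of_le ?_ (le_integral_arcsineWeight_mul (m := 1 / c) (by nlinarith)
    (continuousOn_div_sqrt continuousOn_const (by fun_prop) fun s hs => by
      have := hs.2; nlinarith)
    fun s hs => ?_)
  · have := Real.pi_pos
    have : 0 < c := by linarith
    positivity
  · have := hs.1
    have := hs.2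
    refine one_div_le_one_div_of_le (Real.sqrt_pos.2 (by nlinarith)) ?_
    rw [Real.sqrt_le_left (by linarith)]
    nlinarith

/-- The constant `κ` for which `(s - κ) ds / χ₊` has zero `a`-period. -/
noncomputable def kappa (a b c : ℝ) : ℝ :=
  (∫ s in (a ^ 2)..(b ^ 2), s / √((s - a ^ 2) * (b ^ 2 - s) * (c ^ 2 - s))) / Aplus a b c

/-- The constant `q` for which `(s² - (α + β + γ) s / 2 + q) ds / χ₋` has zero `a`-period. -/
noncomputable def qConst (a b c : ℝ) : ℝ :=
  -(∫ s in (0 : ℝ)..(a ^ 2), (s ^ 2 - (a ^ 2 + b ^ 2 + c ^ 2) / 2 * s) /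
    √(s * (a ^ 2 - s) * (b ^ 2 - s) * (c ^ 2 - s))) / Aminus a b c

theorem integral_kappa_sub (ha : 0 < a) (hab : a < b) (hbc : b < c) :
    ∫ s in (a ^ 2)..(b ^ 2), (s - kappa a b c) / √((s - a ^ 2) * (b ^ 2 - s) * (c ^ 2 - s)) = 0 := by
  have hA := Aplus_pos ha hab hbc
  have hk : kappa a b c * Aplus a b c =
      ∫ s in (a ^ 2)..(b ^ 2), s / √((s - a ^ 2) * (b ^ 2 - s) * (c ^ 2 - s)) := by
    rw [kappa]; field_simp
  rw [Aplus_eq ha hab hbc, integral_gap_eq ha hab hbc (fun s => s),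
    ← intervalIntegral.integral_const_mul] at hk
  rw [integral_gap_eq ha hab hbc (fun s => s - kappa a b c), ← sub_eq_zero.2 hk.symm,
    ← intervalIntegral.integral_sub
    (intervalIntegrable_gap_mul ha hab hbc (f := fun s => s) (by fun_prop))
    ((intervalIntegrable_gap_mul ha hab hbc (f := fun _ => 1) (by fun_prop)).const_mul _)]
  refine intervalIntegral.integral_congr fun s _ => ?_
  ring

theorem integral_qConst (ha : 0 < a) (hab : a < b) (hbc : b < c) :
    ∫ s in (0 : ℝ)..(a ^ 2), (s ^ 2 - (a ^ 2 + b ^ 2 + c ^ 2) / 2 * s + qConst a b c) /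
      √(s * (a ^ 2 - s) * (b ^ 2 - s) * (c ^ 2 - s)) = 0 := by
  have hA := Aminus_pos ha hab hbc
  have hk : (∫ s in (0 : ℝ)..(a ^ 2), (s ^ 2 - (a ^ 2 + b ^ 2 + c ^ 2) / 2 * s) /
      √(s * (a ^ 2 - s) * (b ^ 2 - s) * (c ^ 2 - s))) + qConst a b c * Aminus a b c = 0 := by
    rw [qConst, neg_div, neg_mul, div_mul_cancel₀ _ hA.ne', add_neg_cancel]
  rw [Aminus_eq ha hab hbc, integral_central_eq ha hab hbc (fun s => s ^ 2 -
    (a ^ 2 + b ^ 2 + c ^ 2) / 2 * s), ← intervalIntegral.integral_const_mul,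
    ← intervalIntegral.integral_add (intervalIntegrable_central_mul ha hab hbc (by fun_prop))
    ((intervalIntegrable_central_mul ha hab hbc continuous_const).const_mul _)] at hk
  rw [integral_central_eq ha hab hbc (fun s => s ^ 2 - (a ^ 2 + b ^ 2 + c ^ 2) / 2 * s +
    qConst a b c)]
  refine Eq.trans ?_ hk
  refine intervalIntegral.integral_congr fun s _ => ?_
  ring

theorem integral_comp_sq_central (ha : 0 < a) (hab : a < b) (hbc : b < c) {g : ℝ → ℝ}
    (hg : Continuous g) :
    ∫ y in (-a)..a, g (y ^ 2) / √((a ^ 2 - y ^ 2) * (b ^ 2 - y ^ 2) * (c ^ 2 - y ^ 2)) =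
      ∫ s in (0 : ℝ)..(a ^ 2), g s / √(s * (a ^ 2 - s) * (b ^ 2 - s) * (c ^ 2 - s)) := by
  have hi := intervalIntegrable_mul_real (intervalIntegrable_central ha hab hbc)
    (hg.comp (continuous_pow 2))
  have hi1 : IntervalIntegrable (fun y => g (y ^ 2) /
      √((a ^ 2 - y ^ 2) * (b ^ 2 - y ^ 2) * (c ^ 2 - y ^ 2))) volume (-a) 0 := by
    refine hi.mono_set ?_
    rw [Set.uIcc_of_le (by linarith), Set.uIcc_of_le (by linarith)]
    exact Set.Icc_subset_Icc le_rfl ha.le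
  have hi2 : IntervalIntegrable (fun y => g (y ^ 2) /
      √((a ^ 2 - y ^ 2) * (b ^ 2 - y ^ 2) * (c ^ 2 - y ^ 2))) volume 0 a := by
    refine hi.mono_set ?_
    rw [Set.uIcc_of_le (by linarith), Set.uIcc_of_le (by linarith)]
    exact Set.Icc_subset_Icc (by linarith) le_rfl
  rw [← intervalIntegral.integral_add_adjacent_intervals hi1 hi2]
  have hneg := intervalIntegral.integral_comp_neg (a := -a) (b := 0) (fun y => g (y ^ 2) /
      √((a ^ 2 - y ^ 2) * (b ^ 2 - y ^ 2) * (c ^ 2 - y ^ 2)))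
  simp only [neg_sq, neg_neg, neg_zero] at hneg
  rw [hneg, ← two_mul, intervalIntegral.integral_of_le ha.le,
    intervalIntegral.integral_of_le (by positivity), integral_Ioc_eq_integral_Ioo,
    integral_Ioc_eq_integral_Ioo]
  have himg := image_sq_sub_Ioo le_rfl ha 0
  rw [zero_pow two_ne_zero, sub_zero, sub_zero] at himg
  rw [← himg, (sq_sub_substitution measurableSet_Ioo (fun y hy => hy.1) _ 0).2,
    ← integral_const_mul]
  refine setIntegral_congr_fun measurableSet_Ioo fun y hy => ?_
  have hy : 0 < y := hy.1
  have e : y ^ 2 * (a ^ 2 - y ^ 2) * (b ^ 2 - y ^ 2) * (c ^ 2 - y ^ 2) =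
    y ^ 2 * ((a ^ 2 - y ^ 2) * (b ^ 2 - y ^ 2) * (c ^ 2 - y ^ 2)) := by ring
  simp only [sub_zero]
  rw [e, Real.sqrt_mul (sq_nonneg y), Real.sqrt_sq hy.le]
  field_simp

theorem integral_comp_sq_gap (ha : 0 < a) (hab : a < b) (g : ℝ → ℝ) :
    ∫ y in a..b, y * g (y ^ 2) / √((y ^ 2 - a ^ 2) * (b ^ 2 - y ^ 2) * (c ^ 2 - y ^ 2)) =
      1 / 2 * ∫ s in (a ^ 2)..(b ^ 2), g s / √((s - a ^ 2) * (b ^ 2 - s) * (c ^ 2 - s)) := by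
  have himg := image_sq_sub_Ioo ha.le hab 0
  rw [sub_zero, sub_zero] at himg
  rw [intervalIntegral.integral_of_le hab.le,
    intervalIntegral.integral_of_le (by nlinarith), integral_Ioc_eq_integral_Ioo,
    integral_Ioc_eq_integral_Ioo, ← himg,
    (sq_sub_substitution measurableSet_Ioo (fun y hy => ha.trans hy.1) _ 0).2,
    ← integral_const_mul]
  refine setIntegral_congr_fun measurableSet_Ioo fun y hy => ?_
  simp only [sub_zero]
  ring

theorem isBigO_integral_sub_integral_Ioi {f : ℝ → ℝ} {c C : ℝ} (hf : IntegrableOn f (Set.Ioi c))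
    (hC : ∀ᶠ y in atTop, |f y| ≤ C / y ^ 2) :
    (fun Y => (∫ y in c..Y, f y) - ∫ y in Set.Ioi c, f y) =O[atTop] (fun Y : ℝ => Y⁻¹) := by
  obtain ⟨Y0, hY0⟩ := eventually_atTop.1 hC
  refine IsBigO.of_bound C ?_
  filter_upwards [eventually_ge_atTop Y0, eventually_ge_atTop c, eventually_gt_atTop 0]
    with Y h1 h2 h3
  have hsplit := intervalIntegral.integral_interval_add_Ioi hf
    (hf.mono_set (Set.Ioi_subset_Ioi h2))
  rw [← hsplit, sub_add_cancel_left, norm_neg]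
  have hint := (integrableOn_Ioi_rpow_of_lt (a := -2) (by norm_num) h3).const_mul C
  refine (norm_integral_le_of_norm_le hint ?_).trans (le_of_eq ?_)
  · refine (ae_restrict_iff' measurableSet_Ioi).2 (Eventually.of_forall fun y hy => ?_)
    have hy : Y < y := hy
    refine (hY0 y (h1.trans hy.le)).trans (le_of_eq ?_)
    rw [Real.rpow_neg (by linarith), div_eq_mul_inv]; norm_num
  · rw [integral_const_mul, integral_Ioi_rpow_of_lt (by norm_num) h3,
      Real.norm_of_nonneg (by positivity)]
    have : (-2 : ℝ) + 1 = -1 := by norm_num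
    rw [this, Real.rpow_neg_one]
    ring

theorem ray_radicand_pos (ha : 0 < a) (hab : a < b) (hbc : b < c) {y : ℝ} (hy : c < y) :
    0 < (y ^ 2 - a ^ 2) * (y ^ 2 - b ^ 2) * (y ^ 2 - c ^ 2) := by
  have k1 : 0 < y ^ 2 - a ^ 2 := by nlinarith
  have k2 : 0 < y ^ 2 - b ^ 2 := by nlinarith
  have k3 : 0 < y ^ 2 - c ^ 2 := by nlinarith
  positivity

theorem cube_le_sqrt_ray (ha : 0 < a) (hab : a < b) (hbc : b < c) {y : ℝ} (hy : 2 * c ≤ y) :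
    y ^ 3 / 4 ≤ √((y ^ 2 - a ^ 2) * (y ^ 2 - b ^ 2) * (y ^ 2 - c ^ 2)) := by
  have hc : 0 < c := by linarith
  refine Real.le_sqrt_of_sq_le ?_
  have k1 : y ^ 2 / 2 ≤ y ^ 2 - a ^ 2 := by nlinarith
  have k2 : y ^ 2 / 2 ≤ y ^ 2 - b ^ 2 := by nlinarith
  have k3 : y ^ 2 / 2 ≤ y ^ 2 - c ^ 2 := by nlinarith
  have k0 : 0 ≤ y ^ 2 / 2 := by positivity
  have k4 := k0.trans k1
  have k5 := k0.trans k2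
  calc (y ^ 3 / 4) ^ 2 ≤ y ^ 2 / 2 * (y ^ 2 / 2) * (y ^ 2 / 2) := by
        have : 0 ≤ y ^ 6 := by positivity
        nlinarith
    _ ≤ _ := by gcongr

/-- The second kind integral on `Γ₊` has no constant term at infinity. -/
theorem isBigO_odd_ray (ha : 0 < a) (hab : a < b) (hbc : b < c) :
    (fun Y : ℝ => (∫ y in c..Y, (y ^ 3 - kappa a b c * y) /
      √((y ^ 2 - a ^ 2) * (y ^ 2 - b ^ 2) * (y ^ 2 - c ^ 2))) - Y) =O[atTop]
      (fun Y : ℝ => Y⁻¹) := by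
  have h1 : a ^ 2 < b ^ 2 := by nlinarith
  have h2 : b ^ 2 < c ^ 2 := by nlinarith
  have hc : 0 < c := by linarith
  have hb : 0 < b := by linarith
  obtain ⟨u, hu⟩ : ∃ u : ℝ → ℝ, u = fun y => 2 * y *
    (b ^ 2 - (b ^ 2 - a ^ 2) * (c ^ 2 - b ^ 2) / (y ^ 2 - b ^ 2) - kappa a b c) /
        √((y ^ 2 - a ^ 2) * (y ^ 2 - b ^ 2) * (y ^ 2 - c ^ 2)) := ⟨_, rfl⟩
  have hsub := mobius_sq_substitution ha hab hbc (fun s => s - kappa a b c)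
  rw [← hu] at hsub
  have hzero := integral_kappa_sub ha hab hbc
  rw [intervalIntegral.integral_of_le h1.le, integral_Ioc_eq_integral_Ioo, hsub.2] at hzero
  have hint : IntegrableOn u (Set.Ioi c) := by
    rw [← hsub.1]
    have := intervalIntegrable_gap_mul ha hab hbc (f := fun s => s - kappa a b c) (by fun_prop)
    rw [intervalIntegrable_iff_integrableOn_Ioo_of_le h1.le] at this
    refine this.congr_fun (fun s hs => ?_) measurableSet_Ioo
    simp only
    rw [Real.sqrt_mul' _ (by nlinarith [hs.2] : 0 ≤ c ^ 2 - s), arcsineWeight]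
    ring
  have hubound : ∀ᶠ y in atTop, |u y| ≤ (8 * (b ^ 2 + |kappa a b c|)) / y ^ 2 := by
    filter_upwards [eventually_ge_atTop (2 * c)] with y hy
    have hy0 : 0 < y := by linarith
    have hmem : b ^ 2 - (b ^ 2 - a ^ 2) * (c ^ 2 - b ^ 2) / (y ^ 2 - b ^ 2) ∈
        Set.Ioo (a ^ 2) (b ^ 2) := by
      rw [← image_mobius_sq hb hbc h1]
      exact Set.mem_image_of_mem _ (by simp only [Set.mem_Ioi]; linarith)
    have hR := cube_le_sqrt_ray ha hab hbc hy
    have hR0 := Real.sqrt_pos.2 (ray_radicand_pos ha hab hbc (by linarith : c < y))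
    rw [hu]
    simp only
    rw [abs_div, abs_of_pos hR0, abs_mul, abs_of_pos (by positivity : 0 < 2 * y),
      div_le_div_iff₀ hR0 (by positivity)]
    have hM : |b ^ 2 - (b ^ 2 - a ^ 2) * (c ^ 2 - b ^ 2) / (y ^ 2 - b ^ 2) - kappa a b c| ≤
        b ^ 2 + |kappa a b c| := by
      refine (abs_sub _ _).trans (add_le_add ?_ le_rfl)
      rw [abs_of_pos (by nlinarith [hmem.1])]
      exact hmem.2.le
    calc _ ≤ 2 * y * (b ^ 2 + |kappa a b c|) * y ^ 2 := by gcongr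
      _ = 8 * (b ^ 2 + |kappa a b c|) * (y ^ 3 / 4) := by ring
      _ ≤ _ := by gcongr
  have htail := isBigO_integral_sub_integral_Ioi hint hubound
  rw [hzero] at htail
  have hT : ∀ Y, c ≤ Y → (∫ y in c..Y, (y ^ 3 - kappa a b c * y) /
      √((y ^ 2 - a ^ 2) * (y ^ 2 - b ^ 2) * (y ^ 2 - c ^ 2))) =
      √((Y ^ 2 - a ^ 2) * (Y ^ 2 - c ^ 2) / (Y ^ 2 - b ^ 2)) + 1 / 2 * ∫ y in c..Y, u y := by
    intro Y hY
    have hi1 : IntervalIntegrable (fun y => (y ^ 3 - kappa a b c * y) /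
        √((y ^ 2 - a ^ 2) * (y ^ 2 - b ^ 2) * (y ^ 2 - c ^ 2))) volume c Y :=
      intervalIntegrable_mul_real (intervalIntegrable_ray ha hab hbc le_rfl hY) (by fun_prop)
    have hi2 : IntervalIntegrable u volume c Y := by
      rw [intervalIntegrable_iff_integrableOn_Ioc_of_le hY]
      exact hint.mono_set Set.Ioc_subset_Ioi_self
    have hden : ∀ y ∈ Set.Icc c Y, y ^ 2 - b ^ 2 ≠ 0 := fun y hy => by
      have := hy.1
      have : 0 < y ^ 2 - b ^ 2 := by nlinarith
      exact this.ne'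
    have hft := intervalIntegral.integral_eq_sub_of_hasDerivAt_of_le hY
      (f := fun Y => √((Y ^ 2 - a ^ 2) * (Y ^ 2 - c ^ 2) / (Y ^ 2 - b ^ 2)))
      (f' := fun y => (y ^ 3 - kappa a b c * y) /
      √((y ^ 2 - a ^ 2) * (y ^ 2 - b ^ 2) * (y ^ 2 - c ^ 2)) - 1 / 2 * u y) ?_ ?_
      (hi1.sub (hi2.const_mul _))
    · rw [intervalIntegral.integral_sub hi1 (hi2.const_mul _),
        intervalIntegral.integral_const_mul] at hft
      simp only [sub_self, mul_zero, zero_div, Real.sqrt_zero, sub_zero] at hft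
      linarith
    · exact (ContinuousOn.div (by fun_prop) (by fun_prop) hden).sqrt
    · intro y hy
      have hy1 : c < y := hy.1
      have hy0 : 0 < y := by linarith
      have k1 : 0 < y ^ 2 - a ^ 2 := by nlinarith
      have k2 : 0 < y ^ 2 - b ^ 2 := by nlinarith
      have k3 : 0 < y ^ 2 - c ^ 2 := by nlinarith
      have hp := hasDerivAt_pow 2 y
      have hq : 0 < (y ^ 2 - a ^ 2) * (y ^ 2 - c ^ 2) / (y ^ 2 - b ^ 2) := by positivity
      have := (((hp.sub_const (a ^ 2)).mul (hp.sub_const (c ^ 2))).div (hp.sub_const (b ^ 2))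
        k2.ne').sqrt hq.ne'
      refine this.congr_deriv ?_
      have e : √((y ^ 2 - a ^ 2) * (y ^ 2 - b ^ 2) * (y ^ 2 - c ^ 2)) =
          √((y ^ 2 - a ^ 2) * (y ^ 2 - c ^ 2) / (y ^ 2 - b ^ 2)) * (y ^ 2 - b ^ 2) :=
        sqrt_eq_sqrt_mul_of_eq k2.le (by field_simp)
      have hs := Real.sqrt_pos.2 hq
      simp only [hu, Pi.mul_apply, Pi.div_apply]
      rw [e]
      field_simp
      simp only [Nat.cast_ofNat, Nat.add_one_sub_one, pow_one]
      ring
  have hTY : (fun Y : ℝ => √((Y ^ 2 - a ^ 2) * (Y ^ 2 - c ^ 2) / (Y ^ 2 - b ^ 2)) - Y) =O[atTop]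
      (fun Y : ℝ => Y⁻¹) := by
    refine IsBigO.of_bound (2 * c ^ 2) ?_
    filter_upwards [eventually_ge_atTop (2 * c)] with Y hY
    have hY0 : 0 < Y := by linarith
    have k1 : 0 < Y ^ 2 - a ^ 2 := by nlinarith
    have k2 : 0 < Y ^ 2 - b ^ 2 := by nlinarith
    have k3 : 0 < Y ^ 2 - c ^ 2 := by nlinarith
    have hq : 0 < (Y ^ 2 - a ^ 2) * (Y ^ 2 - c ^ 2) / (Y ^ 2 - b ^ 2) := by positivity
    obtain ⟨T, hT'⟩ : ∃ T, T = √((Y ^ 2 - a ^ 2) * (Y ^ 2 - c ^ 2) / (Y ^ 2 - b ^ 2)) := ⟨_, rfl⟩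
    have hT0 : 0 < T := by rw [hT']; exact Real.sqrt_pos.2 hq
    have hT2 : T ^ 2 = (Y ^ 2 - a ^ 2) * (Y ^ 2 - c ^ 2) / (Y ^ 2 - b ^ 2) := by
      rw [hT', Real.sq_sqrt hq.le]
    rw [← hT', Real.norm_eq_abs, Real.norm_of_nonneg (by positivity)]
    have e : T - Y = (T ^ 2 - Y ^ 2) / (T + Y) := by field_simp; ring
    have hb1 : |T ^ 2 - Y ^ 2| ≤ 2 * c ^ 2 := by
      have e2 : T ^ 2 - Y ^ 2 =
          (a ^ 2 * c ^ 2 - (a ^ 2 + c ^ 2 - b ^ 2) * Y ^ 2) / (Y ^ 2 - b ^ 2) := by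
        rw [hT2]; field_simp; ring
      rw [e2, abs_div, abs_of_pos k2, div_le_iff₀ k2, abs_le]
      have hY2 : 4 * c ^ 2 ≤ Y ^ 2 := by nlinarith
      constructor
      · have e3 : 0 ≤ (b ^ 2 - a ^ 2) * Y ^ 2 := mul_nonneg (by linarith) (by positivity)
        have e4 : c ^ 2 * (4 * c ^ 2) ≤ c ^ 2 * Y ^ 2 := by gcongr
        have e5 : c ^ 2 * b ^ 2 ≤ c ^ 2 * c ^ 2 := by gcongr
        have e6 : 0 ≤ a ^ 2 * c ^ 2 := by positivity
        linarith [mul_self_nonneg (c ^ 2)]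
      · have e3 : 0 ≤ (a ^ 2 + c ^ 2 - b ^ 2) * Y ^ 2 :=
          mul_nonneg (by nlinarith) (by positivity)
        have e4 : c ^ 2 * (4 * c ^ 2) ≤ c ^ 2 * Y ^ 2 := by gcongr
        have e5 : c ^ 2 * b ^ 2 ≤ c ^ 2 * c ^ 2 := by gcongr
        have e6 : a ^ 2 * c ^ 2 ≤ c ^ 2 * c ^ 2 := by gcongr; linarith
        linarith [mul_self_nonneg (c ^ 2)]
    rw [e, abs_div, abs_of_pos (by positivity : 0 < T + Y), div_eq_mul_inv]
    gcongr
    linarith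
  refine (hTY.add ((htail.const_mul_left (1 / 2)))).congr' ?_ EventuallyEq.rfl
  filter_upwards [eventually_ge_atTop c] with Y hY
  rw [hT Y hY]
  ring

/-- The constant term at infinity of `∫ (s² - (α + β + γ) s / 2 + q) ds / (2 χ₋)`. -/
noncomputable def evenConst (a b c : ℝ) : ℝ :=
  1 / 2 * ((∫ v in Set.Ioi (0 : ℝ), secondKindDensity (c ^ 2) (c ^ 2 - a ^ 2) (c ^ 2 - b ^ 2) v) +
    (qConst a b c - c ^ 2 * ((a ^ 2 + b ^ 2 - c ^ 2) / 2)) * BminusOne a b c) - c ^ 2 / 2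

theorem isBigO_even_ray (ha : 0 < a) (hab : a < b) (hbc : b < c) :
    (fun Y : ℝ => (∫ y in c..Y, (y ^ 4 - (a ^ 2 + b ^ 2 + c ^ 2) / 2 * y ^ 2 + qConst a b c) /
      √((y ^ 2 - a ^ 2) * (y ^ 2 - b ^ 2) * (y ^ 2 - c ^ 2))) - (Y ^ 2 / 2 + evenConst a b c))
      =O[atTop] (fun Y : ℝ => Y⁻¹) := by
  have h1 : a ^ 2 < b ^ 2 := by nlinarith
  have h2 : b ^ 2 < c ^ 2 := by nlinarith
  have hc : 0 < c := by linarith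
  obtain ⟨k, hk⟩ : ∃ k, k = qConst a b c - c ^ 2 * ((a ^ 2 + b ^ 2 - c ^ 2) / 2) := ⟨_, rfl⟩
  obtain ⟨g, hg⟩ : ∃ g : ℝ → ℝ, g = fun v =>
    secondKindDensity (c ^ 2) (c ^ 2 - a ^ 2) (c ^ 2 - b ^ 2) v +
    k * firstKindDensity (c ^ 2) (c ^ 2 - a ^ 2) (c ^ 2 - b ^ 2) v := ⟨_, rfl⟩
  have i1 := integrableOn_secondKindDensity (ga := c ^ 2) (p := c ^ 2 - a ^ 2) (r := c ^ 2 - b ^ 2)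
    (by linarith) (by nlinarith) (by linarith) (by linarith)
  have i2 := integrableOn_firstKindDensity (ga := c ^ 2) (p := c ^ 2 - a ^ 2) (r := c ^ 2 - b ^ 2)
    (by linarith) (by nlinarith) (by linarith)
  have hgi : IntegrableOn g (Set.Ioi 0) := by
    rw [hg]; exact i1.add (i2.const_mul k)
  have hgv : ∫ v in Set.Ioi (0 : ℝ), g v = 2 * (evenConst a b c + c ^ 2 / 2) := by
    rw [hg, evenConst, ← hk, BminusOne_eq, ← integral_const_mul k,
      ← integral_add i1 (i2.const_mul k)]
    ring
  have hsub := sq_sub_substitution (measurableSet_Ioi (a := c))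
    (fun y hy => hc.trans hy) g (c ^ 2)
  rw [image_sq_sub_Ioi hc.le, sub_self, hgv] at hsub
  have hui := hsub.1.1 hgi
  have hkey : ∀ y, c < y → (y ^ 4 - (a ^ 2 + b ^ 2 + c ^ 2) / 2 * y ^ 2 + qConst a b c) /
      √((y ^ 2 - a ^ 2) * (y ^ 2 - b ^ 2) * (y ^ 2 - c ^ 2)) =
      y + 1 / 2 * (2 * y * g (y ^ 2 - c ^ 2)) := by
    intro y hy
    have hy0 : 0 < y := by linarith
    have hv : 0 < y ^ 2 - c ^ 2 := by nlinarith
    have hR := Real.sqrt_pos.2 (ray_radicand_pos ha hab hbc hy)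
    have hf : firstKindDensity (c ^ 2) (c ^ 2 - a ^ 2) (c ^ 2 - b ^ 2) (y ^ 2 - c ^ 2) =
        1 / (y * √((y ^ 2 - a ^ 2) * (y ^ 2 - b ^ 2) * (y ^ 2 - c ^ 2))) := by
      rw [firstKindDensity]
      congr 1
      rw [mul_comm y]
      refine sqrt_eq_sqrt_mul_of_eq hy0.le ?_
      ring
    rw [hg]
    simp only [secondKindDensity]
    rw [mul_div_right_comm, ← mul_firstKindDensity hv, hf, hk]
    field_simp
    ring
  have hbound : ∀ᶠ y in atTop, |2 * y * g (y ^ 2 - c ^ 2)| ≤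
      (8 * (4 * (c ^ 2) ^ 2 + |k|)) / y ^ 2 := by
    filter_upwards [eventually_ge_atTop (2 * c), eventually_ge_atTop 1] with y hy hy1
    have hy0 : 0 < y := by linarith
    have hv : 0 < y ^ 2 - c ^ 2 := by nlinarith
    have hv2 : y ^ 2 / 2 ≤ y ^ 2 - c ^ 2 := by nlinarith
    obtain ⟨v, hvv⟩ : ∃ v, v = y ^ 2 - c ^ 2 := ⟨_, rfl⟩
    rw [← hvv] at hv hv2 ⊢
    have b1 := abs_secondKindDensity_le (ga := c ^ 2) (p := c ^ 2 - a ^ 2) (r := c ^ 2 - b ^ 2)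
      (m := c ^ 2 - a ^ 2) (G := c ^ 2)
      (by linarith) le_rfl (by nlinarith) (by linarith) (by linarith) le_rfl hv
    have b2 : firstKindDensity (c ^ 2) (c ^ 2 - a ^ 2) (c ^ 2 - b ^ 2) v ≤ 1 / v ^ 2 := by
      refine one_div_le_one_div_of_le (by positivity) (Real.le_sqrt_of_sq_le ?_)
      calc (v ^ 2) ^ 2 = v * (v * v * v) := by ring
        _ ≤ _ := by gcongr <;> nlinarith
    have b3 : 1 / (v + (c ^ 2 - a ^ 2)) ^ 2 ≤ 1 / v ^ 2 := by
      refine one_div_le_one_div_of_le (by positivity) ?_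
      gcongr; linarith
    have b4 : |g v| ≤ (4 * (c ^ 2) ^ 2 + |k|) * (1 / v ^ 2) := by
      rw [hg]
      refine (abs_add_le _ _).trans ?_
      rw [abs_mul, abs_of_nonneg (firstKindDensity_nonneg ..), add_mul]
      refine add_le_add (b1.trans ?_) ?_ <;> gcongr
    have b5 : 1 / v ^ 2 ≤ 4 / y ^ 4 := by
      rw [div_le_div_iff₀ (by positivity) (by positivity)]
      have : (y ^ 2 / 2) ^ 2 ≤ v ^ 2 := by gcongr
      nlinarith
    rw [abs_mul, abs_of_pos (by positivity : 0 < 2 * y)]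
    calc 2 * y * |g v| ≤ 2 * y * ((4 * (c ^ 2) ^ 2 + |k|) * (4 / y ^ 4)) := by
          gcongr; exact b4.trans (by gcongr)
      _ = 8 * (4 * (c ^ 2) ^ 2 + |k|) / y ^ 2 * (1 / y) := by field_simp; ring
      _ ≤ 8 * (4 * (c ^ 2) ^ 2 + |k|) / y ^ 2 * 1 := by
          gcongr
          rw [div_le_one hy0]; exact hy1
      _ = _ := by ring
  have htail := isBigO_integral_sub_integral_Ioi hui hbound
  rw [← hsub.2] at htail
  refine (htail.const_mul_left (1 / 2)).congr' ?_ EventuallyEq.rfl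
  filter_upwards [eventually_ge_atTop c] with Y hY
  have : ∫ y in c..Y, (y ^ 4 - (a ^ 2 + b ^ 2 + c ^ 2) / 2 * y ^ 2 + qConst a b c) /
      √((y ^ 2 - a ^ 2) * (y ^ 2 - b ^ 2) * (y ^ 2 - c ^ 2)) =
      ∫ y in c..Y, (y + 1 / 2 * (2 * y * g (y ^ 2 - c ^ 2))) := by
    rw [intervalIntegral.integral_of_le hY, intervalIntegral.integral_of_le hY]
    exact setIntegral_congr_fun measurableSet_Ioc fun y hy => hkey y hy.1
  rw [this, intervalIntegral.integral_add, intervalIntegral.integral_const_mul, integral_id]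
  · ring
  · exact continuous_id.intervalIntegrable _ _
  · refine IntervalIntegrable.const_mul ?_ _
    rw [intervalIntegrable_iff_integrableOn_Ioc_of_le hY]
    exact hui.mono_set Set.Ioc_subset_Ioi_self

theorem isAbelianConstant_one (ha : 0 < a) (hab : a < b) (hbc : b < c) (l0 : ℝ) :
    IsAbelianConstant l0 a b c 1 1 (-l0 : ℂ) := by
  obtain ⟨Z, hZ⟩ : ∃ Z : ℂ[X], Z = C (-Complex.I) * (X - C (l0 : ℂ)) := ⟨_, rfl⟩
  have hZe : ∀ y : ℝ, Z.eval ((l0 : ℂ) + Complex.I * y) = y := fun y => by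
    rw [hZ]; simp; rw [← mul_assoc, Complex.I_mul_I]; ring
  have hev : ∀ y : ℝ, (-(Z ^ 3 - C (kappa a b c : ℂ) * Z)).eval ((l0 : ℂ) + Complex.I * y) =
      0 * ((1 : ℝ) : ℂ) + (-1) * ((y ^ 3 - kappa a b c * y : ℝ) : ℂ) := fun y => by
    simp only [eval_neg, eval_sub, eval_pow, eval_mul, eval_C, hZe]
    push_cast; ring
  refine ⟨-(Z ^ 3 - C (kappa a b c : ℂ) * Z), ?_, ?_, ?_⟩
  · rw [hZ]; compute_degree
  · refine (hasZeroAPeriods_iff ha hab hbc (e := fun _ => 1)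
      (o := fun y => y ^ 3 - kappa a b c * y) continuous_const (by fun_prop) (fun _ => rfl)
      (fun y => by ring) hev).2 ⟨by simp, ?_⟩
    have := integral_comp_sq_gap (c := c) ha hab (fun s => s - kappa a b c)
    rw [integral_kappa_sub ha hab hbc, mul_zero] at this
    have e : ∀ y : ℝ, y * (y ^ 2 - kappa a b c) = y ^ 3 - kappa a b c * y := fun y => by ring
    simp only [e] at this
    rw [this]; simp
  · have h := Complex.isBigO_ofReal_left.2 (isBigO_odd_ray ha hab hbc)
    refine h.congr' ?_ EventuallyEq.rfl
    filter_upwards [eventually_ge_atTop c] with Y hY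
    rw [abelianIntegral_combination ha hab hbc continuous_const (by fun_prop) hev hY]
    push_cast
    have := Complex.I_mul_I
    linear_combination (-Y : ℂ) * this

theorem isAbelianConstant_two (ha : 0 < a) (hab : a < b) (hbc : b < c) (l0 : ℝ) :
    IsAbelianConstant l0 a b c 2 2 (-2 * (l0 : ℂ) ^ 2 - 4 * (evenConst a b c : ℂ)) := by
  obtain ⟨Z, hZ⟩ : ∃ Z : ℂ[X], Z = C (-Complex.I) * (X - C (l0 : ℂ)) := ⟨_, rfl⟩
  have hZe : ∀ y : ℝ, Z.eval ((l0 : ℂ) + Complex.I * y) = y := fun y => by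
    rw [hZ]; simp; rw [← mul_assoc, Complex.I_mul_I]; ring
  obtain ⟨σ, hσ⟩ : ∃ σ, σ = (a ^ 2 + b ^ 2 + c ^ 2) / 2 := ⟨_, rfl⟩
  have hev : ∀ y : ℝ, (C (-4 * Complex.I) * (Z ^ 4 - C (σ : ℂ) * Z ^ 2 + C (qConst a b c : ℂ)) +
      C (-4 * (l0 : ℂ)) * (Z ^ 3 - C (kappa a b c : ℂ) * Z)).eval ((l0 : ℂ) + Complex.I * y) =
      (-4 * Complex.I) * ((y ^ 4 - σ * y ^ 2 + qConst a b c : ℝ) : ℂ) +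
      (-4 * (l0 : ℂ)) * ((y ^ 3 - kappa a b c * y : ℝ) : ℂ) := fun y => by
    simp only [eval_add, eval_sub, eval_pow, eval_mul, eval_C, hZe]
    push_cast; ring
  refine ⟨C (-4 * Complex.I) * (Z ^ 4 - C (σ : ℂ) * Z ^ 2 + C (qConst a b c : ℂ)) +
      C (-4 * (l0 : ℂ)) * (Z ^ 3 - C (kappa a b c : ℂ) * Z), ?_, ?_, ?_⟩
  · rw [hZ]; compute_degree
  · refine (hasZeroAPeriods_iff ha hab hbc (e := fun y => y ^ 4 - σ * y ^ 2 + qConst a b c)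
      (o := fun y => y ^ 3 - kappa a b c * y) (by fun_prop) (by fun_prop) (fun y => by ring)
      (fun y => by ring) hev).2 ⟨?_, ?_⟩
    · have := integral_comp_sq_central ha hab hbc
        (g := fun s => s ^ 2 - (a ^ 2 + b ^ 2 + c ^ 2) / 2 * s + qConst a b c) (by fun_prop)
      rw [integral_qConst ha hab hbc, ← hσ] at this
      have e : ∀ y : ℝ, (y ^ 2) ^ 2 = y ^ 4 := fun y => by ring
      simp only [e] at this
      rw [this]; simp
    · have := integral_comp_sq_gap (c := c) ha hab (fun s => s - kappa a b c)
      rw [integral_kappa_sub ha hab hbc, mul_zero] at this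
      have e : ∀ y : ℝ, y * (y ^ 2 - kappa a b c) = y ^ 3 - kappa a b c * y := fun y => by ring
      simp only [e] at this
      rw [this]; simp
  · have h := (Complex.isBigO_ofReal_left.2 (isBigO_odd_ray ha hab hbc)).const_mul_left
      (4 * (l0 : ℂ))
    have h' := (Complex.isBigO_ofReal_left.2 (isBigO_even_ray ha hab hbc)).const_mul_left
      (4 * Complex.I)
    refine (h'.add h).congr' ?_ EventuallyEq.rfl
    filter_upwards [eventually_ge_atTop c] with Y hY
    rw [abelianIntegral_combination ha hab hbc (by fun_prop) (by fun_prop) hev hY, hσ]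
    push_cast
    have := Complex.I_mul_I
    linear_combination -(4 * (l0 : ℂ) * Y + 2 * Complex.I * Y ^ 2) * this

theorem existsUnique_K1 (ha : 0 < a) (hab : a < b) (hbc : b < c) (l0 : ℝ) :
    ∃! K : ℂ, IsAbelianConstant l0 a b c 1 1 K :=
  ⟨_, isAbelianConstant_one ha hab hbc l0, fun _ h =>
    isAbelianConstant_unique ha hab hbc h (isAbelianConstant_one ha hab hbc l0)⟩

theorem existsUnique_K2 (ha : 0 < a) (hab : a < b) (hbc : b < c) (l0 : ℝ) :
    ∃! K : ℂ, IsAbelianConstant l0 a b c 2 2 K :=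
  ⟨_, isAbelianConstant_two ha hab hbc l0, fun _ h =>
    isAbelianConstant_unique ha hab hbc h (isAbelianConstant_two ha hab hbc l0)⟩

theorem K1_eq (ha : 0 < a) (hab : a < b) (hbc : b < c) (l0 : ℝ) : K1 l0 a b c = -l0 :=
  isAbelianConstant_unique ha hab hbc
    (Classical.epsilon_spec ⟨_, isAbelianConstant_one ha hab hbc l0⟩)
    (isAbelianConstant_one ha hab hbc l0)

theorem K2_eq (ha : 0 < a) (hab : a < b) (hbc : b < c) (l0 : ℝ) :
    K2 l0 a b c = -2 * (l0 : ℂ) ^ 2 - 4 * (evenConst a b c : ℂ) :=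
  isAbelianConstant_unique ha hab hbc
    (Classical.epsilon_spec ⟨_, isAbelianConstant_two ha hab hbc l0⟩)
    (isAbelianConstant_two ha hab hbc l0)

end Periods

end FocusingNLS

namespace FocusingNLS

/-! ### Theta functions -/

theorem theta3_add_theta2 (u : ℂ) {τ : ℂ} (hτ : 0 < τ.im) :
    theta3 u τ + theta2 u τ = jacobiTheta₂ (u / 2) (τ / 4) := by
  have hτ4 : 0 < (τ / 4).im := by
    have : τ / 4 = τ / (4 : ℝ) := by norm_num
    rw [this, Complex.div_ofReal_im]; positivity
  have h := hasSum_theta3 (u / 2) hτ4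
  have h2 := hasSum_theta2 u hτ
  have h3 := hasSum_theta3 u hτ
  have h4 := HasSum.even_add_odd (f := fun m : ℕ =>
    2 * (Complex.exp (Real.pi * Complex.I * (τ / 4) * ((m : ℂ) + 1) ^ 2) *
      Complex.cos (2 * ((m : ℂ) + 1) * Real.pi * (u / 2))))
    (h2.congr_fun fun m => ?_) (h3.congr_fun fun m => ?_)
  · have := h.unique h4
    rw [theta3] at this
    linear_combination -this
  · push_cast
    congr 3
    · ring
    · ring
  · push_cast
    congr 3
    · ring
    · ring

theorem theta3_add_one (u τ : ℂ) : theta3 (u + 1) τ = theta3 u τ := jacobiTheta₂_add_left u τ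

theorem theta2_add_one (u τ : ℂ) : theta2 (u + 1) τ = -theta2 u τ := by
  have e : u + 1 + τ / 2 = u + τ / 2 + 1 := by ring
  rw [theta2, theta2, e, jacobiTheta₂_add_left, mul_add, mul_one, ← add_assoc, Complex.exp_add,
    Complex.exp_pi_mul_I]
  ring

theorem theta2_eq (u τ : ℂ) : theta2 u τ =
    Complex.exp (Real.pi * Complex.I * τ / 4 - Real.pi * Complex.I * u) *
      jacobiTheta₂ (u - τ / 2) τ := by
  have e : u + τ / 2 = u - τ / 2 + τ := by ring
  rw [theta2, e, jacobiTheta₂_add_left', ← mul_assoc, ← Complex.exp_add]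
  congr 2
  ring

/-- The sum `ϑ₃ + ϑ₂` at the modulus `τ = 2 i b`. -/
noncomputable def thetaSum (b : ℝ) (u : ℂ) : ℂ :=
  jacobiTheta₂ (u / 2) (Complex.I * b / 2)

theorem thetaSum_eq {b : ℝ} (hb : 0 < b) (u : ℂ) :
    thetaSum b u = theta3 u (2 * Complex.I * b) + theta2 u (2 * Complex.I * b) := by
  rw [theta3_add_theta2 u (by simpa using hb), thetaSum]
  congr 1; ring

theorem thetaSum_sub_one {b : ℝ} (hb : 0 < b) (u : ℂ) :
    thetaSum b (u - 1) = theta3 u (2 * Complex.I * b) - theta2 u (2 * Complex.I * b) := by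
  rw [thetaSum_eq hb]
  have h3 := theta3_add_one (u - 1) (2 * Complex.I * b)
  have h2 := theta2_add_one (u - 1) (2 * Complex.I * b)
  rw [sub_add_cancel] at h2 h3
  rw [h2, h3]; ring

/-- The theta series that is dual to `thetaSum` under `τ ↦ -1 / τ`. -/
noncomputable def dualTheta (b : ℝ) (u : ℂ) : ℂ :=
  jacobiTheta₂ (u / (Complex.I * b)) (2 * Complex.I / b)

theorem thetaSum_eq_dualTheta {b : ℝ} (hb : 0 < b) (u : ℂ) : thetaSum b u =
    1 / (b / 2 : ℂ) ^ (1 / 2 : ℂ) * Complex.exp (-Real.pi * u ^ 2 / (2 * b)) * dualTheta b u := by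
  have hb' : (b : ℂ) ≠ 0 := by exact_mod_cast hb.ne'
  have hI := Complex.I_ne_zero
  rw [thetaSum, jacobiTheta₂_functional_equation, dualTheta]
  have e1 : -Complex.I * (Complex.I * b / 2) = (b / 2 : ℂ) := by
    rw [mul_div_assoc', ← mul_assoc, neg_mul, Complex.I_mul_I]; ring
  have e2 : -(Real.pi : ℂ) * Complex.I * (u / 2) ^ 2 / (Complex.I * b / 2) =
      -Real.pi * u ^ 2 / (2 * b) := by field_simp
  have e3 : u / 2 / (Complex.I * b / 2) = u / (Complex.I * b) := by field_simp
  have e4 : -1 / (Complex.I * b / 2) = 2 * Complex.I / b := by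
    field_simp
    rw [Complex.I_sq]
  rw [e1, e2, e3, e4]

theorem thetaSum_factor_ne_zero {b : ℝ} (hb : 0 < b) : 1 / (b / 2 : ℂ) ^ (1 / 2 : ℂ) ≠ 0 := by
  have hb' : (b / 2 : ℂ) ≠ 0 := by
    have : (b : ℂ) ≠ 0 := by exact_mod_cast hb.ne'
    simpa using this
  simp [Complex.cpow_eq_zero_iff, hb']

section Limits

variable {ι : Type*} {l : Filter ι}

theorem tendsto_jacobiTheta₂_one {z τ : ι → ℂ} {S : ℝ}
    (hτ : Tendsto (fun i => (τ i).im) l atTop)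
    (hz : ∀ᶠ i in l, |(z i).im| ≤ 3 / 8 * (τ i).im + S) :
    Tendsto (fun i => jacobiTheta₂ (z i) (τ i)) l (𝓝 1) := by
  have hterm : ∀ᶠ i in l, ∀ n : ℤ, ‖jacobiTheta₂_term n (z i) (τ i)‖ ≤
      Real.exp (-Real.pi * ((τ i).im / 4 * n ^ 2 - 2 * S * |n|)) := by
    filter_upwards [hz, hτ.eventually_ge_atTop 1] with i h1 h2 n
    refine (norm_jacobiTheta₂_term_le (by linarith) h1 le_rfl n).trans ?_
    rw [Real.exp_le_exp]
    have hn : (|n| : ℝ) ≤ (n : ℝ) ^ 2 := by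
      rw [← sq_abs]
      have : (|n| : ℤ) ≤ |n| ^ 2 := Int.le_self_sq _
      exact_mod_cast this
    have h3 : (τ i).im * (|n| : ℝ) ≤ (τ i).im * (n : ℝ) ^ 2 := by gcongr
    push_cast
    have := Real.pi_pos
    nlinarith
  have hlim : ∀ n : ℤ, Tendsto (fun i => jacobiTheta₂_term n (z i) (τ i)) l
      (𝓝 (if n = 0 then 1 else 0)) := by
    intro n
    split_ifs with hn
    · subst hn
      simpa [jacobiTheta₂_term] using tendsto_const_nhds
    · refine squeeze_zero_norm' (hterm.mono fun i hi => hi n) ?_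
      refine Real.tendsto_exp_atBot.comp ?_
      refine Tendsto.const_mul_atTop_of_neg (by linarith [Real.pi_pos]) ?_
      refine tendsto_atTop_add_const_right _ _ ?_
      refine (hτ.atTop_div_const (by norm_num)).atTop_mul_const ?_
      positivity
  have h := tendsto_tsum_of_dominated_convergence
    (summable_pow_mul_jacobiTheta₂_term_bound S (by norm_num : (0 : ℝ) < 1) 0) hlim ?_
  · simpa [jacobiTheta₂] using h
  · filter_upwards [hterm, hτ.eventually_ge_atTop 4] with i h1 h2 n
    refine (h1 n).trans ?_
    rw [pow_zero, one_mul, Real.exp_le_exp]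
    have h3 : 1 * (n : ℝ) ^ 2 ≤ (τ i).im / 4 * (n : ℝ) ^ 2 := by
      gcongr; linarith
    push_cast
    have := Real.pi_pos
    nlinarith

theorem im_two_mul_I_mul (b : ℝ) : (2 * Complex.I * b : ℂ).im = 2 * b := by simp

theorem tendsto_theta3_one {b : ι → ℝ} {u : ι → ℝ} (hb : Tendsto b l atTop) :
    Tendsto (fun i => theta3 (u i) (2 * Complex.I * b i)) l (𝓝 1) := by
  refine tendsto_jacobiTheta₂_one (S := 0) ?_ ?_
  · simp only [im_two_mul_I_mul]
    exact hb.const_mul_atTop (by norm_num)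
  · filter_upwards [hb.eventually_ge_atTop 0] with i hi
    rw [im_two_mul_I_mul]
    simp
    linarith

theorem tendsto_theta2_zero {b : ι → ℝ} {u : ι → ℝ} (hb : Tendsto b l atTop) :
    Tendsto (fun i => theta2 (u i) (2 * Complex.I * b i)) l (𝓝 0) := by
  have h : Tendsto (fun i => thetaSum (b i) (u i)) l (𝓝 1) := by
    refine tendsto_jacobiTheta₂_one (S := 0) ?_ ?_
    · simpa using hb.atTop_div_const (by norm_num : (0 : ℝ) < 2)
    · filter_upwards [hb.eventually_ge_atTop 0] with i hi
      simp
      linarith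
  have h2 := h.sub (tendsto_theta3_one (u := u) hb)
  rw [sub_self] at h2
  refine h2.congr' ?_
  filter_upwards [hb.eventually_gt_atTop 0] with i hi
  rw [thetaSum_eq hi]; ring

theorem tendsto_theta2_shift {b δ u : ι → ℝ} {S : ℝ} (hb : Tendsto b l atTop)
    (hδ : ∀ᶠ i in l, |δ i - b i| ≤ S) :
    Tendsto (fun i => theta2 (u i + Complex.I * δ i) (2 * Complex.I * b i) *
      Complex.exp (Real.pi * b i / 2 - Real.pi * δ i + Real.pi * Complex.I * u i)) l (𝓝 1) := by
  have h : Tendsto (fun i => jacobiTheta₂ (u i + Complex.I * δ i - 2 * Complex.I * b i / 2)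
      (2 * Complex.I * b i)) l (𝓝 1) := by
    refine tendsto_jacobiTheta₂_one (S := S) ?_ ?_
    · simp only [im_two_mul_I_mul]
      exact hb.const_mul_atTop (by norm_num)
    · filter_upwards [hb.eventually_ge_atTop 0, hδ] with i hi h2
      rw [im_two_mul_I_mul]
      have e : (u i + Complex.I * δ i - 2 * Complex.I * b i / 2 : ℂ) =
        u i + Complex.I * ((δ i - b i : ℝ) : ℂ) := by push_cast; ring
      rw [e]
      simp
      linarith
  refine h.congr fun i => ?_
  rw [theta2_eq, mul_right_comm (Complex.exp _), ← Complex.exp_add]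
  have e : (Real.pi : ℂ) * Complex.I * (2 * Complex.I * b i) / 4 -
      Real.pi * Complex.I * (u i + Complex.I * δ i) +
      (Real.pi * b i / 2 - Real.pi * δ i + Real.pi * Complex.I * u i) = 0 := by
    linear_combination (Real.pi * b i / 2 - Real.pi * δ i : ℂ) * Complex.I_mul_I
  rw [e, Complex.exp_zero, one_mul]

theorem tendsto_theta3_shift {b δ u : ι → ℝ} {S : ℝ} (hb : Tendsto b l atTop)
    (hδ : ∀ᶠ i in l, |δ i - b i| ≤ S) :
    Tendsto (fun i => theta3 (u i + Complex.I * δ i) (2 * Complex.I * b i) *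
      Complex.exp (Real.pi * b i / 2 - Real.pi * δ i + Real.pi * Complex.I * u i)) l (𝓝 0) := by
  have h : Tendsto (fun i => jacobiTheta₂ ((u i + Complex.I * δ i) / 2 - Complex.I * b i / 2)
      (Complex.I * b i / 2)) l (𝓝 1) := by
    refine tendsto_jacobiTheta₂_one (S := S) ?_ ?_
    · simpa using hb.atTop_div_const (by norm_num : (0 : ℝ) < 2)
    · filter_upwards [hb.eventually_ge_atTop 0, hδ] with i hi h2
      have e : ((u i + Complex.I * δ i) / 2 - Complex.I * b i / 2 : ℂ) =
        ((u i / 2 : ℝ) : ℂ) + Complex.I * (((δ i - b i) / 2 : ℝ) : ℂ) := by push_cast; ring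
      have e2 : (Complex.I * b i / 2 : ℂ).im = b i / 2 := by simp
      have e3 : (((u i / 2 : ℝ) : ℂ) + Complex.I * (((δ i - b i) / 2 : ℝ) : ℂ)).im =
        (δ i - b i) / 2 := by
        rw [Complex.add_im, Complex.ofReal_im, Complex.I_mul_im, Complex.ofReal_re, zero_add]
      rw [e, e2, e3, abs_div, abs_two]
      linarith [abs_nonneg (δ i - b i)]
  have h2 := h.sub (tendsto_theta2_shift (u := u) hb hδ)
  rw [sub_self] at h2
  refine h2.congr' ?_
  filter_upwards [hb.eventually_gt_atTop 0] with i hi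
  have hs := thetaSum_eq hi (u i + Complex.I * δ i)
  have e0 : (u i + Complex.I * δ i : ℂ) / 2 =
    (u i + Complex.I * δ i) / 2 - Complex.I * b i / 2 + Complex.I * b i / 2 := by ring
  rw [thetaSum, e0, jacobiTheta₂_add_left'] at hs
  rw [eq_sub_of_add_eq hs.symm, sub_mul, mul_right_comm (Complex.exp _), ← Complex.exp_add]
  have e : -(Real.pi : ℂ) * Complex.I * (Complex.I * b i / 2 +
      2 * ((u i + Complex.I * δ i) / 2 - Complex.I * b i / 2)) +
      (Real.pi * b i / 2 - Real.pi * δ i + Real.pi * Complex.I * u i) = 0 := by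
    linear_combination (Real.pi * b i / 2 - Real.pi * δ i : ℂ) * Complex.I_mul_I
  rw [e, Complex.exp_zero, one_mul]

theorem tendsto_dualTheta_one {b : ι → ℝ} {u : ι → ℂ} (hb : Tendsto b l (𝓝[>] 0))
    (hu : ∀ᶠ i in l, |(u i).re| ≤ 3 / 4) :
    Tendsto (fun i => dualTheta (b i) (u i)) l (𝓝 1) := by
  have e1 : ∀ b : ℝ, (2 * Complex.I / b : ℂ).im = 2 * b⁻¹ := fun b => by
    rw [div_eq_mul_inv, ← Complex.ofReal_inv, Complex.im_mul_ofReal]; simp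
  refine tendsto_jacobiTheta₂_one (S := 0) ?_ ?_
  · simp only [e1]
    exact (tendsto_inv_nhdsGT_zero.comp hb).const_mul_atTop (by norm_num)
  · filter_upwards [hu, hb.eventually self_mem_nhdsWithin] with i h1 h2
    have h2 : 0 < b i := h2
    have e2 : (u i / (Complex.I * b i)).im = -((u i).re * (b i)⁻¹) := by
      have : u i / (Complex.I * b i) = u i * -Complex.I * ((b i)⁻¹ : ℝ) := by
        rw [div_eq_mul_inv, mul_inv, Complex.inv_I]; push_cast; ring
      rw [this, Complex.im_mul_ofReal]
      simp
    rw [e1, e2, abs_neg, abs_mul, abs_of_pos (inv_pos.2 h2)]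
    have := inv_pos.2 h2
    nlinarith

theorem thetaSum_ne_zero {b : ℝ} (hb : 0 < b) {u : ℂ} (h : dualTheta b u ≠ 0) :
    thetaSum b u ≠ 0 := by
  rw [thetaSum_eq_dualTheta hb]
  exact mul_ne_zero (mul_ne_zero (thetaSum_factor_ne_zero hb) (Complex.exp_ne_zero _)) h

theorem thetaSum_div {b : ℝ} (hb : 0 < b) (u v : ℂ) : thetaSum b v / thetaSum b u =
    Complex.exp (-Real.pi / 2 * ((v ^ 2 - u ^ 2) / b)) * (dualTheta b v / dualTheta b u) := by
  have hb' : (b : ℂ) ≠ 0 := by exact_mod_cast hb.ne'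
  rw [thetaSum_eq_dualTheta hb, thetaSum_eq_dualTheta hb, mul_assoc, mul_assoc,
    mul_div_mul_left _ _ (thetaSum_factor_ne_zero hb), mul_div_mul_comm, ← Complex.exp_sub]
  congr 2
  field_simp
  ring

theorem tendsto_thetaSum_div {b : ι → ℝ} {u v : ι → ℂ} {X : ℂ} (hb : Tendsto b l (𝓝[>] 0))
    (hu : ∀ᶠ i in l, |(u i).re| ≤ 3 / 4) (hv : ∀ᶠ i in l, |(v i).re| ≤ 3 / 4)
    (hX : Tendsto (fun i => (v i ^ 2 - u i ^ 2) / b i) l (𝓝 X)) :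
    Tendsto (fun i => thetaSum (b i) (v i) / thetaSum (b i) (u i)) l
      (𝓝 (Complex.exp (-Real.pi / 2 * X))) := by
  have h1 : Tendsto (fun i => dualTheta (b i) (v i) / dualTheta (b i) (u i)) l (𝓝 (1 / 1)) :=
    (tendsto_dualTheta_one hb hv).div (tendsto_dualTheta_one hb hu) one_ne_zero
  have h2 := ((Complex.continuous_exp.tendsto _).comp (hX.const_mul (-Real.pi / 2 : ℂ))).mul h1
  rw [div_one, mul_one] at h2
  refine h2.congr' ?_
  filter_upwards [hb.eventually self_mem_nhdsWithin] with i hi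
  rw [thetaSum_div hi]
  rfl

/-- The function `H` in terms of the two moduli. -/
noncomputable def thetaH (b₁ b₂ : ℝ) (u₁ u₂ : ℂ) : ℂ :=
  theta3 u₁ (2 * Complex.I * b₁) * theta3 u₂ (2 * Complex.I * b₂) +
  theta2 u₁ (2 * Complex.I * b₁) * theta3 u₂ (2 * Complex.I * b₂) +
  theta3 u₁ (2 * Complex.I * b₁) * theta2 u₂ (2 * Complex.I * b₂) -
  theta2 u₁ (2 * Complex.I * b₁) * theta2 u₂ (2 * Complex.I * b₂)

theorem thetaH_eq_left {b₁ b₂ : ℝ} (h : 0 < b₁) (u₁ u₂ : ℂ) : thetaH b₁ b₂ u₁ u₂ =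
    thetaSum b₁ u₁ * theta3 u₂ (2 * Complex.I * b₂) +
    thetaSum b₁ (u₁ - 1) * theta2 u₂ (2 * Complex.I * b₂) := by
  rw [thetaSum_eq h, thetaSum_sub_one h, thetaH]; ring

theorem thetaH_eq_right {b₁ b₂ : ℝ} (h : 0 < b₂) (u₁ u₂ : ℂ) : thetaH b₁ b₂ u₁ u₂ =
    theta3 u₁ (2 * Complex.I * b₁) * thetaSum b₂ u₂ +
    theta2 u₁ (2 * Complex.I * b₁) * thetaSum b₂ (u₂ - 1) := by
  rw [thetaSum_eq h, thetaSum_sub_one h, thetaH]; ring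

theorem eventually_abs_re_le {w : ι → ℂ} {w0 : ℂ} (h : Tendsto w l (𝓝 w0)) (h0 : |w0.re| < 3 / 4) :
    ∀ᶠ i in l, |(w i).re| ≤ 3 / 4 :=
  ((((Complex.continuous_re.tendsto _).comp h).abs).eventually (gt_mem_nhds h0)).mono
    fun _ hi => hi.le

theorem tendsto_thetaH_ratio_of_right {b₁ b₂ δ u₁ u₂ : ι → ℝ} {S X : ℝ}
    (hb₁ : Tendsto b₁ l atTop) (hb₂ : Tendsto b₂ l (𝓝[>] 0))
    (hδ : ∀ᶠ i in l, |δ i - b₁ i| ≤ S) (hu₂ : Tendsto u₂ l (𝓝 (1 / 2)))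
    (hX : Tendsto (fun i => (1 - 2 * u₂ i) / b₂ i) l (𝓝 X)) :
    Tendsto (fun i => thetaH (b₁ i) (b₂ i) (u₁ i + Complex.I * δ i) (u₂ i + 1) /
      thetaH (b₁ i) (b₂ i) (u₁ i) (u₂ i) *
      Complex.exp (Real.pi * b₁ i / 2 - Real.pi * δ i + Real.pi * Complex.I * u₁ i)) l (𝓝 1) := by
  have hu : Tendsto (fun i => (u₂ i : ℂ)) l (𝓝 ((1 / 2 : ℝ) : ℂ)) :=
    (Complex.continuous_ofReal.tendsto _).comp hu₂
  have hur : ∀ᶠ i in l, |((u₂ i : ℂ)).re| ≤ 3 / 4 :=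
    eventually_abs_re_le hu (by rw [Complex.ofReal_re]; norm_num)
  have hvr : ∀ᶠ i in l, |((u₂ i : ℂ) - 1).re| ≤ 3 / 4 :=
    eventually_abs_re_le (hu.sub_const 1) (by
      rw [Complex.sub_re, Complex.ofReal_re, Complex.one_re]; norm_num [abs_lt])
  have hρ := tendsto_thetaSum_div (X := (X : ℂ)) hb₂ hur hvr (by
    refine ((Complex.continuous_ofReal.tendsto _).comp hX).congr fun i => ?_
    simp only [Function.comp_apply]
    push_cast
    ring)
  have hnum := ((tendsto_theta3_shift (u := u₁) hb₁ hδ).mul hρ).add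
    (tendsto_theta2_shift (u := u₁) hb₁ hδ)
  have hden := (tendsto_theta3_one (u := u₁) hb₁).add
    ((tendsto_theta2_zero (u := u₁) hb₁).mul hρ)
  rw [zero_mul, zero_add] at hnum
  rw [zero_mul, add_zero] at hden
  have h := hnum.div hden one_ne_zero
  rw [div_one] at h
  refine h.congr' ?_
  filter_upwards [hb₂.eventually self_mem_nhdsWithin,
    (tendsto_dualTheta_one hb₂ hur).eventually_ne one_ne_zero] with i h2 h3
  have h2 : 0 < b₂ i := h2
  have h4 := thetaSum_ne_zero h2 h3
  rw [thetaH_eq_right h2, thetaH_eq_right h2, add_sub_cancel_right]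
  have e : thetaSum (b₂ i) (u₂ i + 1) = thetaSum (b₂ i) (u₂ i - 1) := by
    rw [thetaSum_sub_one h2, thetaSum_eq h2, theta3_add_one, theta2_add_one]; ring
  rw [e]
  simp only [Pi.div_apply]
  obtain ⟨s, hs⟩ : ∃ s, s = thetaSum (b₂ i) (u₂ i) := ⟨_, rfl⟩
  obtain ⟨r, hr⟩ : ∃ r, r = thetaSum (b₂ i) (u₂ i - 1) / thetaSum (b₂ i) (u₂ i) := ⟨_, rfl⟩
  have hr' : thetaSum (b₂ i) (u₂ i - 1) = r * s := by rw [hr, hs, div_mul_cancel₀ _ h4]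
  rw [← hr, hr', ← hs]
  rw [← hs] at h4
  obtain ⟨t3, ht3⟩ : ∃ t, t = theta3 (u₁ i + Complex.I * δ i) (2 * Complex.I * b₁ i) := ⟨_, rfl⟩
  obtain ⟨t2, ht2⟩ : ∃ t, t = theta2 (u₁ i + Complex.I * δ i) (2 * Complex.I * b₁ i) := ⟨_, rfl⟩
  rw [← ht2, ← ht3]
  have e2 : t3 * (r * s) + t2 * s = s * (t3 * r + t2) := by ring
  have e3 : theta3 (u₁ i) (2 * Complex.I * b₁ i) * s +
      theta2 (u₁ i) (2 * Complex.I * b₁ i) * (r * s) =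
      s * (theta3 (u₁ i) (2 * Complex.I * b₁ i) + theta2 (u₁ i) (2 * Complex.I * b₁ i) * r) := by
    ring
  rw [e2, e3, mul_div_mul_left _ _ h4]
  ring

theorem tendsto_thetaH_ratio_of_left {b₁ b₂ δ u₁ u₂ : ι → ℝ} {Δ X : ℝ}
    (hb₁ : Tendsto b₁ l (𝓝[>] 0)) (hb₂ : Tendsto b₂ l atTop)
    (hδ : Tendsto δ l (𝓝 0)) (hΔ : Tendsto (fun i => δ i / b₁ i) l (𝓝 Δ))
    (hu₁ : Tendsto u₁ l (𝓝 (1 / 2)))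
    (hX : Tendsto (fun i => (1 - 2 * u₁ i) / b₁ i) l (𝓝 X)) :
    Tendsto (fun i => thetaH (b₁ i) (b₂ i) (u₁ i + Complex.I * δ i) (u₂ i + 1) /
      thetaH (b₁ i) (b₂ i) (u₁ i) (u₂ i)) l
      (𝓝 (Complex.exp (-Real.pi * Complex.I * Δ / 2))) := by
  have hu : Tendsto (fun i => (u₁ i : ℂ)) l (𝓝 ((1 / 2 : ℝ) : ℂ)) :=
    (Complex.continuous_ofReal.tendsto _).comp hu₁
  have hδ' : Tendsto (fun i => (δ i : ℂ)) l (𝓝 ((0 : ℝ) : ℂ)) :=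
    (Complex.continuous_ofReal.tendsto _).comp hδ
  have hΔ' : Tendsto (fun i => (δ i : ℂ) / b₁ i) l (𝓝 (Δ : ℂ)) := by
    refine ((Complex.continuous_ofReal.tendsto _).comp hΔ).congr fun i => ?_
    simp
  have hX' : Tendsto (fun i => (1 - 2 * u₁ i : ℂ) / b₁ i) l (𝓝 (X : ℂ)) := by
    refine ((Complex.continuous_ofReal.tendsto _).comp hX).congr fun i => ?_
    simp
  have hw : Tendsto (fun i => (u₁ i + Complex.I * δ i : ℂ)) l (𝓝 ((1 / 2 : ℝ) : ℂ)) := by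
    have := hu.add (hδ'.const_mul Complex.I)
    simpa using this
  have r1 : |(((1 / 2 : ℝ) : ℂ)).re| < 3 / 4 := by rw [Complex.ofReal_re]; norm_num
  have r2 : |(((1 / 2 : ℝ) : ℂ) - 1).re| < 3 / 4 := by
    rw [Complex.sub_re, Complex.ofReal_re, Complex.one_re]; norm_num [abs_lt]
  have hur := eventually_abs_re_le hu r1
  have hur' := eventually_abs_re_le (hu.sub_const 1) r2
  have hwr := eventually_abs_re_le hw r1
  have hwr' := eventually_abs_re_le (hw.sub_const 1) r2
  have hρu := tendsto_thetaSum_div (X := (X : ℂ)) hb₁ hur hur' (by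
    refine hX'.congr fun i => ?_
    ring)
  have hρw := tendsto_thetaSum_div (X := (X - 2 * Complex.I * Δ : ℂ)) hb₁ hwr hwr' (by
    refine (hX'.sub (hΔ'.const_mul (2 * Complex.I))).congr fun i => ?_
    ring)
  have hq := tendsto_thetaSum_div (X := (Complex.I * Δ : ℂ)) hb₁ hur hwr (by
    have := ((hu.const_mul 2).mul (hΔ'.const_mul Complex.I)).sub (hδ'.mul hΔ')
    have e : 2 * ((1 / 2 : ℝ) : ℂ) * (Complex.I * Δ) - ((0 : ℝ) : ℂ) * Δ = Complex.I * Δ := by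
      push_cast; ring
    rw [e] at this
    refine this.congr fun i => ?_
    linear_combination -((δ i : ℂ) * (δ i / b₁ i)) * Complex.I_mul_I)
  have hnum := (tendsto_theta3_one (u := u₂) hb₂).sub
    (hρw.mul (tendsto_theta2_zero (u := u₂) hb₂))
  have hden := (tendsto_theta3_one (u := u₂) hb₂).add
    (hρu.mul (tendsto_theta2_zero (u := u₂) hb₂))
  rw [mul_zero, sub_zero] at hnum
  rw [mul_zero, add_zero] at hden
  have h := hq.mul (hnum.div hden one_ne_zero)
  have e0 : Complex.exp (-Real.pi / 2 * (Complex.I * Δ)) * (1 / 1) =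
      Complex.exp (-Real.pi * Complex.I * Δ / 2) := by
    rw [div_one, mul_one]; congr 1; ring
  rw [e0] at h
  refine h.congr' ?_
  filter_upwards [hb₁.eventually self_mem_nhdsWithin,
    (tendsto_dualTheta_one hb₁ hur).eventually_ne one_ne_zero,
    (tendsto_dualTheta_one hb₁ hwr).eventually_ne one_ne_zero] with i h2 h3 h4
  have h2 : 0 < b₁ i := h2
  have h5 := thetaSum_ne_zero h2 h3
  have h6 := thetaSum_ne_zero h2 h4
  rw [thetaH_eq_left h2, thetaH_eq_left h2, theta3_add_one, theta2_add_one]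
  simp only [Pi.div_apply]
  have e1 : ∀ s s' t t' : ℂ, s ≠ 0 → s * t + s' * t' = s * (t + s' / s * t') := by
    intro s s' t t' hs
    field_simp
  rw [e1 _ _ _ _ h5, e1 _ _ _ _ h6, mul_div_mul_comm, mul_neg, sub_eq_add_neg]

end Limits

end FocusingNLS

namespace FocusingNLS

/-! ### Bounds for the periods -/

section Bounds

variable {a b c : ℝ}

theorem arcsineWeight_mul_inv_sqrt_ge {p q s z k : ℝ} (hs : s ∈ Set.Ioo p q) (hz : 0 < z)
    (hk : 0 < k) (h : (s - p) * (q - s) ≤ k ^ 2 * z) :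
    1 / k * (1 / z) ≤ arcsineWeight p q s * (1 / √z) := by
  have h0 : 0 < (s - p) * (q - s) := mul_pos (by linarith [hs.1]) (by linarith [hs.2])
  rw [arcsineWeight, one_div_mul_one_div, one_div_mul_one_div]
  refine one_div_le_one_div_of_le (mul_pos (Real.sqrt_pos.2 h0) (Real.sqrt_pos.2 hz)) ?_
  calc √((s - p) * (q - s)) * √z ≤ √(k ^ 2 * z) * √z := by gcongr
    _ = k * z := by
      rw [Real.sqrt_mul (sq_nonneg k), Real.sqrt_sq hk.le, mul_assoc, Real.mul_self_sqrt hz.le]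

theorem integral_inv_const_sub {p q z : ℝ} (hpq : p ≤ q) (hz : q < z) :
    ∫ s in p..q, 1 / (z - s) = Real.log ((z - p) / (z - q)) := by
  rw [intervalIntegral.integral_comp_sub_left (fun x => 1 / x) z]
  exact integral_one_div_of_pos (by linarith) (by linarith)

theorem integral_inv_sub_const {p q z : ℝ} (hpq : p ≤ q) (hz : z < p) :
    ∫ s in p..q, 1 / (s - z) = Real.log ((q - z) / (p - z)) := by
  rw [intervalIntegral.integral_comp_sub_right (fun x => 1 / x) z]
  exact integral_one_div_of_pos (by linarith) (by linarith)

theorem intervalIntegrable_inv_const_sub {p q z : ℝ} (hpq : p ≤ q) (hz : q < z) :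
    IntervalIntegrable (fun s => 1 / (z - s)) volume p q := by
  refine ContinuousOn.intervalIntegrable ?_
  rw [Set.uIcc_of_le hpq]
  refine ContinuousOn.div continuousOn_const (by fun_prop) fun s hs => ?_
  have := hs.2
  have : 0 < z - s := by linarith
  exact this.ne'

theorem intervalIntegrable_inv_sub_const {p q z : ℝ} (hpq : p ≤ q) (hz : z < p) :
    IntervalIntegrable (fun s => 1 / (s - z)) volume p q := by
  refine ContinuousOn.intervalIntegrable ?_
  rw [Set.uIcc_of_le hpq]
  refine ContinuousOn.div continuousOn_const (by fun_prop) fun s hs => ?_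
  have := hs.1
  have : 0 < s - z := by linarith
  exact this.ne'

theorem log_le_Aplus (ha : 0 < a) (hab : a < b) (hbc : b < c) :
    1 / √(b ^ 2 - a ^ 2) * Real.log ((c ^ 2 - a ^ 2) / (c ^ 2 - b ^ 2)) ≤ Aplus a b c := by
  have h1 : a ^ 2 < b ^ 2 := by nlinarith
  have h2 : b ^ 2 < c ^ 2 := by nlinarith
  rw [Aplus_eq ha hab hbc, ← integral_inv_const_sub h1.le h2,
    ← intervalIntegral.integral_const_mul]
  refine intervalIntegral.integral_mono_on_of_le_Ioo h1.le
    ((intervalIntegrable_inv_const_sub h1.le h2).const_mul _)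
    (intervalIntegrable_gap_mul ha hab hbc continuous_const) fun s hs => ?_
  have := hs.1
  have := hs.2
  refine arcsineWeight_mul_inv_sqrt_ge hs (by linarith) (Real.sqrt_pos.2 (by linarith)) ?_
  rw [Real.sq_sqrt (by linarith)]
  apply mul_le_mul <;> linarith

theorem continuousOn_Bplus (ha : 0 < a) (hab : a < b) :
    ContinuousOn (fun s : ℝ => 1 / √(s - a ^ 2)) (Set.Icc (b ^ 2) (c ^ 2)) :=
  continuousOn_div_sqrt continuousOn_const (by fun_prop) fun s hs => by
    have := hs.1
    nlinarith

theorem log_le_Bplus (ha : 0 < a) (hab : a < b) (hbc : b < c) :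
    1 / √(c ^ 2 - b ^ 2) * Real.log ((c ^ 2 - a ^ 2) / (b ^ 2 - a ^ 2)) ≤ Bplus a b c := by
  have h1 : a ^ 2 < b ^ 2 := by nlinarith
  have h2 : b ^ 2 < c ^ 2 := by nlinarith
  rw [Bplus_eq ha hab hbc, ← integral_inv_sub_const h2.le h1,
    ← intervalIntegral.integral_const_mul]
  refine intervalIntegral.integral_mono_on_of_le_Ioo h2.le
    ((intervalIntegrable_inv_sub_const h2.le h1).const_mul _)
    (intervalIntegrable_arcsineWeight_mul h2 (continuousOn_Bplus ha hab)) fun s hs => ?_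
  have := hs.1
  have := hs.2
  refine arcsineWeight_mul_inv_sqrt_ge hs (by linarith) (Real.sqrt_pos.2 (by linarith)) ?_
  rw [Real.sq_sqrt (by linarith), mul_comm]
  apply mul_le_mul <;> linarith

theorem log_le_Aminus (ha : 0 < a) (hab : a < b) (hbc : b < c) :
    1 / (b * c) * Real.log (b ^ 2 / (b ^ 2 - a ^ 2)) ≤ Aminus a b c := by
  have h1 : a ^ 2 < b ^ 2 := by nlinarith
  have h2 : b ^ 2 < c ^ 2 := by nlinarith
  have h0 : 0 < a ^ 2 := by positivity
  have hb : 0 < b := by linarith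
  have hc : 0 < c := by linarith
  have hint := integral_inv_const_sub h0.le h1
  rw [sub_zero] at hint
  rw [Aminus_eq ha hab hbc, ← hint, ← intervalIntegral.integral_const_mul]
  refine intervalIntegral.integral_mono_on_of_le_Ioo h0.le
    ((intervalIntegrable_inv_const_sub h0.le h1).const_mul _)
    (intervalIntegrable_central_mul ha hab hbc continuous_const) fun s hs => ?_
  have h3 := hs.1
  have h4 := hs.2
  have h5 : 0 < b ^ 2 - s := by linarith
  have h6 : 0 < c ^ 2 - s := by linarith
  have key := arcsineWeight_mul_inv_sqrt_ge hs h5 hb (by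
    rw [sub_zero]; apply mul_le_mul <;> linarith)
  have hw := arcsineWeight_nonneg 0 (a ^ 2) s
  calc 1 / (b * c) * (1 / (b ^ 2 - s)) = 1 / b * (1 / (b ^ 2 - s)) * (1 / c) := by
        field_simp
    _ ≤ arcsineWeight 0 (a ^ 2) s * (1 / √(b ^ 2 - s)) * (1 / √(c ^ 2 - s)) := by
        refine mul_le_mul key ?_ (by positivity) (by positivity)
        refine one_div_le_one_div_of_le (Real.sqrt_pos.2 h6) ?_
        rw [Real.sqrt_le_left hc.le]; linarith
    _ = _ := by rw [Real.sqrt_mul h5.le, mul_assoc, one_div_mul_one_div]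

theorem Aminus_le (ha : 0 < a) (hab : a < b) (hbc : b < c) :
    Aminus a b c ≤ Real.pi / √(b ^ 2 * (b ^ 2 - a ^ 2)) := by
  have h1 : a ^ 2 < b ^ 2 := by nlinarith
  have h2 : b ^ 2 < c ^ 2 := by nlinarith
  have h0 : 0 < a ^ 2 := by positivity
  rw [Aminus_eq ha hab hbc, ← integral_arcsineWeight_mul_inv_sub h0 h1]
  refine intervalIntegral.integral_mono_on h0.le
    (intervalIntegrable_central_mul ha hab hbc continuous_const)
    (intervalIntegrable_arcsineWeight_mul h0 ?_) fun s hs => ?_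
  · refine ContinuousOn.div continuousOn_const (by fun_prop) fun s hs => ?_
    have := hs.2
    have : 0 < b ^ 2 - s := by linarith
    exact this.ne'
  · have h4 := hs.2
    have h5 : 0 < b ^ 2 - s := by linarith
    refine mul_le_mul_of_nonneg_left ?_ (arcsineWeight_nonneg _ _ _)
    refine one_div_le_one_div_of_le h5 (Real.le_sqrt_of_sq_le ?_)
    rw [sq]
    exact mul_le_mul_of_nonneg_left (by linarith) h5.le

theorem le_Aminus (ha : 0 < a) (hab : a < b) (hbc : b < c) :
    Real.pi / √(c ^ 2 * (c ^ 2 - a ^ 2)) ≤ Aminus a b c := by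
  have h1 : a ^ 2 < b ^ 2 := by nlinarith
  have h2 : b ^ 2 < c ^ 2 := by nlinarith
  have h0 : 0 < a ^ 2 := by positivity
  rw [Aminus_eq ha hab hbc, ← integral_arcsineWeight_mul_inv_sub h0 (h1.trans h2)]
  refine intervalIntegral.integral_mono_on h0.le
    (intervalIntegrable_arcsineWeight_mul h0 ?_)
    (intervalIntegrable_central_mul ha hab hbc continuous_const) fun s hs => ?_
  · refine ContinuousOn.div continuousOn_const (by fun_prop) fun s hs => ?_
    have := hs.2
    have : 0 < c ^ 2 - s := by linarith
    exact this.ne'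
  · have h4 := hs.2
    have h5 : 0 < b ^ 2 - s := by linarith
    have h6 : 0 < c ^ 2 - s := by linarith
    refine mul_le_mul_of_nonneg_left ?_ (arcsineWeight_nonneg _ _ _)
    refine one_div_le_one_div_of_le (Real.sqrt_pos.2 (by positivity)) ?_
    rw [Real.sqrt_le_left h6.le]
    nlinarith

theorem Bplus_le (ha : 0 < a) (hab : a < b) (hbc : b < c) :
    Bplus a b c ≤ Real.pi * (1 / √(b ^ 2 - a ^ 2)) := by
  have h1 : a ^ 2 < b ^ 2 := by nlinarith
  have h2 : b ^ 2 < c ^ 2 := by nlinarith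
  rw [Bplus_eq ha hab hbc]
  refine integral_arcsineWeight_mul_le h2 (continuousOn_Bplus ha hab) fun s hs => ?_
  have := hs.1
  exact one_div_le_one_div_of_le (Real.sqrt_pos.2 (by linarith)) (Real.sqrt_le_sqrt (by linarith))

theorem le_Bplus (ha : 0 < a) (hab : a < b) (hbc : b < c) :
    Real.pi * (1 / √(c ^ 2 - a ^ 2)) ≤ Bplus a b c := by
  have h1 : a ^ 2 < b ^ 2 := by nlinarith
  have h2 : b ^ 2 < c ^ 2 := by nlinarith
  rw [Bplus_eq ha hab hbc]
  refine le_integral_arcsineWeight_mul h2 (continuousOn_Bplus ha hab) fun s hs => ?_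
  have := hs.1
  have := hs.2
  exact one_div_le_one_div_of_le (Real.sqrt_pos.2 (by linarith)) (Real.sqrt_le_sqrt (by linarith))

theorem Aplus_le (ha : 0 < a) (hab : a < b) (hbc : b < c) :
    Aplus a b c ≤ Real.pi * (1 / √(c ^ 2 - b ^ 2)) := by
  have h1 : a ^ 2 < b ^ 2 := by nlinarith
  have h2 : b ^ 2 < c ^ 2 := by nlinarith
  rw [Aplus_eq ha hab hbc]
  refine integral_arcsineWeight_mul_le h1 (continuousOn_div_sqrt continuousOn_const
    (by fun_prop) fun s hs => by have := hs.2; linarith) fun s hs => ?_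
  have := hs.2
  exact one_div_le_one_div_of_le (Real.sqrt_pos.2 (by linarith)) (Real.sqrt_le_sqrt (by linarith))

theorem continuousOn_Bminus (ha : 0 < a) (hbc : b < c) (hb : 0 < b) :
    ContinuousOn (fun s : ℝ => 1 / √(s * (c ^ 2 - s))) (Set.Icc (a ^ 2) (b ^ 2)) :=
  continuousOn_div_sqrt continuousOn_const (by fun_prop) fun s hs => by
    have := hs.1
    have := hs.2
    exact mul_pos (by nlinarith) (by nlinarith)

theorem Bminus_le (ha : 0 < a) (hab : a < b) (hbc : b < c) :
    Bminus a b c ≤ Real.pi * (1 / √(a ^ 2 * (c ^ 2 - b ^ 2))) := by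
  have h1 : a ^ 2 < b ^ 2 := by nlinarith
  have h2 : b ^ 2 < c ^ 2 := by nlinarith
  have h0 : 0 < a ^ 2 := by positivity
  rw [Bminus_eq ha hab hbc]
  refine integral_arcsineWeight_mul_le h1 (continuousOn_Bminus ha hbc (ha.trans hab))
    fun s hs => ?_
  have := hs.1
  have := hs.2
  refine one_div_le_one_div_of_le (Real.sqrt_pos.2 (mul_pos h0 (by linarith)))
    (Real.sqrt_le_sqrt ?_)
  apply mul_le_mul <;> linarith

theorem le_Bminus (ha : 0 < a) (hab : a < b) (hbc : b < c) :
    Real.pi * (1 / √(b ^ 2 * (c ^ 2 - a ^ 2))) ≤ Bminus a b c := by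
  have h1 : a ^ 2 < b ^ 2 := by nlinarith
  have h2 : b ^ 2 < c ^ 2 := by nlinarith
  have h0 : 0 < a ^ 2 := by positivity
  rw [Bminus_eq ha hab hbc]
  refine le_integral_arcsineWeight_mul h1 (continuousOn_Bminus ha hbc (ha.trans hab))
    fun s hs => ?_
  have := hs.1
  have := hs.2
  refine one_div_le_one_div_of_le (Real.sqrt_pos.2 (mul_pos (by linarith) (by linarith)))
    (Real.sqrt_le_sqrt ?_)
  apply mul_le_mul <;> linarith

theorem Aplus_le_Bminus (ha : 0 < a) (hab : a < b) (hbc : b < c) :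
    1 / b * Aplus a b c ≤ Bminus a b c := by
  have h1 : a ^ 2 < b ^ 2 := by nlinarith
  have h2 : b ^ 2 < c ^ 2 := by nlinarith
  have h0 : 0 < a ^ 2 := by positivity
  have hb : 0 < b := by linarith
  rw [Aplus_eq ha hab hbc, Bminus_eq ha hab hbc, ← intervalIntegral.integral_const_mul]
  refine intervalIntegral.integral_mono_on h1.le
    ((intervalIntegrable_gap_mul ha hab hbc continuous_const).const_mul _)
    (intervalIntegrable_arcsineWeight_mul h1 (continuousOn_Bminus ha hbc hb)) fun s hs => ?_
  have h3 := hs.1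
  have h4 := hs.2
  rw [mul_left_comm]
  refine mul_le_mul_of_nonneg_left ?_ (arcsineWeight_nonneg _ _ _)
  rw [one_div_mul_one_div, Real.sqrt_mul (by linarith)]
  have h5 : 0 < √s := Real.sqrt_pos.2 (by linarith)
  have h6 : 0 < √(c ^ 2 - s) := Real.sqrt_pos.2 (by linarith)
  refine one_div_le_one_div_of_le (by positivity) ?_
  gcongr
  rw [Real.sqrt_le_left hb.le]; exact h4

/-- The difference of the two half-periods that grow together as `c → b`. -/
noncomputable def Jminus (a b c : ℝ) : ℝ :=
  ∫ v in Set.Ioi (0 : ℝ), firstKindDensity (c ^ 2) (b ^ 2) (a ^ 2) v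

theorem Bminus_eq_BminusOne_add (ha : 0 < a) (hab : a < b) (hbc : b < c) :
    Bminus a b c = BminusOne a b c + Jminus a b c := by
  have h1 : a ^ 2 < b ^ 2 := by nlinarith
  have h2 : b ^ 2 < c ^ 2 := by nlinarith
  have h0 : 0 < a ^ 2 := by positivity
  have hi : IntervalIntegrable (fun s => 1 / √(s * (s - a ^ 2) * (b ^ 2 - s) * (c ^ 2 - s)))
      volume (a ^ 2) (b ^ 2) := by
    refine intervalIntegrable_congr_uIcc (intervalIntegrable_arcsineWeight_mul h1
      (continuousOn_Bminus ha hbc (ha.trans hab))) ?_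
    rw [Set.uIcc_of_le h1.le]
    intro s hs
    have h3 := hs.1
    have h4 := hs.2
    have e : s * (s - a ^ 2) * (b ^ 2 - s) * (c ^ 2 - s) =
      ((s - a ^ 2) * (b ^ 2 - s)) * (s * (c ^ 2 - s)) := by ring
    simp only
    rw [arcsineWeight, one_div_mul_one_div, e,
      Real.sqrt_mul' _ (mul_nonneg (by linarith) (by linarith) : 0 ≤ s * (c ^ 2 - s))]
  rw [intervalIntegrable_iff_integrableOn_Ioo_of_le h1.le] at hi
  rw [Bminus, intervalIntegral.integral_of_le h1.le, integral_Ioc_eq_integral_Ioo,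
    integral_Ioo_eq_integral_Ioi_add h0 h1 h2 hi, BminusOne_eq, Jminus]

theorem BminusOne_nonneg (a b c : ℝ) : 0 ≤ BminusOne a b c := by
  rw [BminusOne_eq]
  exact integral_nonneg fun v => firstKindDensity_nonneg _ _ _ v

theorem BminusOne_le (ha : 0 < a) (hab : a < b) (hbc : b < c) :
    BminusOne a b c ≤ 1 / √(c ^ 2 - b ^ 2) * (Real.pi / √(c ^ 2 - a ^ 2)) := by
  rw [BminusOne_eq]
  exact integral_firstKindDensity_le (by nlinarith) (by nlinarith) (by nlinarith)

theorem sqrt_central_bounds {s : ℝ} (ha : 0 < a) (hab : a < b) (hbc : b < c)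
    (hs : s ∈ Set.Icc 0 (a ^ 2)) :
    b ^ 2 - s ≤ √((b ^ 2 - s) * (c ^ 2 - s)) ∧ √((b ^ 2 - s) * (c ^ 2 - s)) ≤ c ^ 2 - s := by
  have h4 := hs.2
  have h5 : 0 < b ^ 2 - s := by nlinarith
  have h6 : b ^ 2 < c ^ 2 := by nlinarith
  constructor
  · refine Real.le_sqrt_of_sq_le ?_
    nlinarith
  · rw [Real.sqrt_le_left (by linarith)]
    nlinarith

theorem abs_ratio_sub_one_le {s : ℝ} (ha : 0 < a) (hab : a < b) (hbc : b < c)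
    (hs : s ∈ Set.Icc 0 (a ^ 2)) :
    |(c ^ 2 - s) / √((b ^ 2 - s) * (c ^ 2 - s)) - 1| ≤
      (c ^ 2 - b ^ 2) / (b ^ 2 - a ^ 2) := by
  obtain ⟨h1, h2⟩ := sqrt_central_bounds ha hab hbc hs
  have h4 := hs.2
  have h5 : 0 < b ^ 2 - a ^ 2 := by nlinarith
  have h6 : b ^ 2 < c ^ 2 := by nlinarith
  have hD : 0 < √((b ^ 2 - s) * (c ^ 2 - s)) := by linarith
  rw [div_sub_one hD.ne', abs_div, abs_of_pos hD, abs_of_nonneg (by linarith)]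
  apply div_le_div₀ <;> linarith

theorem two_mul_Dminus_add_pi_sub (ha : 0 < a) (hab : a < b) (hbc : b < c) :
    |2 * Dminus a b c + Real.pi - c ^ 2 * Aminus a b c| ≤
      Real.pi * ((c ^ 2 - b ^ 2) / (b ^ 2 - a ^ 2)) := by
  have h0 : 0 < a ^ 2 := by positivity
  have i1 := intervalIntegrable_central_mul ha hab hbc (f := fun s => s) (by fun_prop)
  have i2 := intervalIntegrable_central_mul ha hab hbc (f := fun _ => 1) (by fun_prop)
  have e : 2 * Dminus a b c + Real.pi - c ^ 2 * Aminus a b c =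
      ∫ s in (0 : ℝ)..(a ^ 2), arcsineWeight 0 (a ^ 2) s *
        (-((c ^ 2 - s) / √((b ^ 2 - s) * (c ^ 2 - s)) - 1)) := by
    rw [Dminus_eq ha hab hbc, Aminus_eq ha hab hbc, ← integral_arcsineWeight h0, ← mul_assoc,
      mul_one_div_cancel two_ne_zero, one_mul, ← intervalIntegral.integral_add i1
      (intervalIntegrable_arcsineWeight h0), ← intervalIntegral.integral_const_mul,
      ← intervalIntegral.integral_sub (i1.add (intervalIntegrable_arcsineWeight h0))
      (i2.const_mul _)]
    refine intervalIntegral.integral_congr fun s _ => ?_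
    ring
  rw [e]
  refine abs_integral_arcsineWeight_mul_le h0 ?_ fun s hs => ?_
  · exact ((continuousOn_div_sqrt (by fun_prop) (by fun_prop)
      (central_pos ha hab hbc)).sub continuousOn_const).neg
  · rw [abs_neg]
    exact abs_ratio_sub_one_le ha hab hbc hs

theorem abs_div_sqrt_central_le_one {s : ℝ} (ha : 0 < a) (hab : a < b) (hbc : b < c)
    (hs : s ∈ Set.Icc 0 (a ^ 2)) : |(b ^ 2 - s) / √((b ^ 2 - s) * (c ^ 2 - s))| ≤ 1 := by
  obtain ⟨h1, h2⟩ := sqrt_central_bounds ha hab hbc hs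
  have h4 := hs.2
  have h5 : 0 < b ^ 2 - s := by nlinarith
  rw [abs_of_nonneg (by positivity), div_le_one (by linarith)]
  exact h1

theorem abs_mul_Aminus_sub_two_mul_Dminus (ha : 0 < a) (hab : a < b) (hbc : b < c) :
    |b ^ 2 * Aminus a b c - 2 * Dminus a b c| ≤ Real.pi * 1 := by
  have h0 : 0 < a ^ 2 := by positivity
  have i1 := intervalIntegrable_central_mul ha hab hbc (f := fun s => s) (by fun_prop)
  have i2 := intervalIntegrable_central_mul ha hab hbc (f := fun _ => 1) (by fun_prop)
  have e : b ^ 2 * Aminus a b c - 2 * Dminus a b c =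
      ∫ s in (0 : ℝ)..(a ^ 2), arcsineWeight 0 (a ^ 2) s *
        ((b ^ 2 - s) / √((b ^ 2 - s) * (c ^ 2 - s))) := by
    rw [Dminus_eq ha hab hbc, Aminus_eq ha hab hbc, ← mul_assoc,
      mul_one_div_cancel two_ne_zero, one_mul, ← intervalIntegral.integral_const_mul,
      ← intervalIntegral.integral_sub (i2.const_mul _) i1]
    refine intervalIntegral.integral_congr fun s _ => ?_
    ring
  rw [e]
  exact abs_integral_arcsineWeight_mul_le h0 (continuousOn_div_sqrt (by fun_prop) (by fun_prop)
      (central_pos ha hab hbc)) fun s hs => abs_div_sqrt_central_le_one ha hab hbc hs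

/-- The value of the quadratic numerator of the normalized second kind differential at `s = γ`. -/
noncomputable def qGamma (a b c : ℝ) : ℝ := qConst a b c - c ^ 2 * ((a ^ 2 + b ^ 2 - c ^ 2) / 2)

theorem qGamma_mul_Aminus (ha : 0 < a) (hab : a < b) (hbc : b < c) :
    qGamma a b c * Aminus a b c =
      ∫ s in (0 : ℝ)..(a ^ 2), arcsineWeight 0 (a ^ 2) s *
        ((c ^ 2 - s) * (s - (a ^ 2 + b ^ 2 - c ^ 2) / 2) / √((b ^ 2 - s) * (c ^ 2 - s))) := by
  have i1 := intervalIntegrable_central_mul ha hab hbc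
    (f := fun s => s ^ 2 - (a ^ 2 + b ^ 2 + c ^ 2) / 2 * s + qConst a b c) (by fun_prop)
  have i2 := intervalIntegrable_central_mul ha hab hbc (f := fun _ => 1) (by fun_prop)
  have h := integral_qConst ha hab hbc
  rw [integral_central_eq ha hab hbc
    (fun s => s ^ 2 - (a ^ 2 + b ^ 2 + c ^ 2) / 2 * s + qConst a b c)] at h
  have hsub := intervalIntegral.integral_sub (i2.const_mul (qGamma a b c)) i1
  rw [h, sub_zero, intervalIntegral.integral_const_mul] at hsub
  rw [Aminus_eq ha hab hbc, ← hsub]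
  refine intervalIntegral.integral_congr fun s _ => ?_
  simp only [qGamma]
  ring

theorem integral_arcsineWeight_mul_sub_half {al : ℝ} (h0 : 0 < al) :
    ∫ s in (0 : ℝ)..al, arcsineWeight 0 al s * (s - al / 2) = 0 := by
  rw [intervalIntegral.integral_eq_sub_of_hasDerivAt_of_le h0.le
    (f := fun s => -√((s - 0) * (al - s))) (by fun_prop) (fun s hs => ?_)
    (intervalIntegrable_arcsineWeight_mul h0 (by fun_prop))]
  · simp
  · have hp : 0 < (s - 0) * (al - s) := mul_pos (by linarith [hs.1]) (by linarith [hs.2])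
    have := ((((hasDerivAt_id s).sub_const 0).mul ((hasDerivAt_id s).const_sub al)).sqrt hp.ne').neg
    refine this.congr_deriv ?_
    have := Real.sqrt_pos.2 hp
    simp only [id, arcsineWeight, Pi.mul_apply]
    field_simp
    ring

theorem abs_qGamma_mul_Aminus_le (ha : 0 < a) (hab : a < b) (hbc : b < c)
    (hc : c ^ 2 - b ^ 2 ≤ 1) :
    |qGamma a b c * Aminus a b c| ≤
      Real.pi * ((c ^ 2 - b ^ 2) * ((a ^ 2 + 1) / (b ^ 2 - a ^ 2) + 1)) := by
  have h0 : 0 < a ^ 2 := by positivity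
  have h1 : a ^ 2 < b ^ 2 := by nlinarith
  have h2 : b ^ 2 < c ^ 2 := by nlinarith
  have i1 := intervalIntegrable_central_mul ha hab hbc
    (f := fun s => (c ^ 2 - s) * (s - (a ^ 2 + b ^ 2 - c ^ 2) / 2)) (by fun_prop)
  have i2 : IntervalIntegrable (fun s => arcsineWeight 0 (a ^ 2) s * (s - a ^ 2 / 2)) volume 0
    (a ^ 2) := intervalIntegrable_arcsineWeight_mul h0 (by fun_prop)
  have hcont := continuousOn_div_sqrt
    (f := fun s => (c ^ 2 - s) * (s - (a ^ 2 + b ^ 2 - c ^ 2) / 2))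
    (by fun_prop) (by fun_prop) (central_pos ha hab hbc)
  have hsub := intervalIntegral.integral_sub i1 i2
  rw [integral_arcsineWeight_mul_sub_half h0, sub_zero] at hsub
  rw [qGamma_mul_Aminus ha hab hbc, ← hsub]
  simp only [← mul_sub]
  refine abs_integral_arcsineWeight_mul_le h0 (hcont.sub (by fun_prop)) fun s hs => ?_
  have h3 := hs.1
  have h4 := hs.2
  have hr := abs_ratio_sub_one_le ha hab hbc hs
  have h5 : 0 < b ^ 2 - a ^ 2 := by linarith
  have e : (c ^ 2 - s) * (s - (a ^ 2 + b ^ 2 - c ^ 2) / 2) / √((b ^ 2 - s) * (c ^ 2 - s)) -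
      (s - a ^ 2 / 2) = ((c ^ 2 - s) / √((b ^ 2 - s) * (c ^ 2 - s)) - 1) *
      (s - (a ^ 2 + b ^ 2 - c ^ 2) / 2) + (c ^ 2 - b ^ 2) / 2 := by ring
  rw [e]
  have h6 : |s - (a ^ 2 + b ^ 2 - c ^ 2) / 2| ≤ a ^ 2 + 1 := by
    rw [abs_le]; constructor <;> linarith
  have h7 : |(c ^ 2 - b ^ 2) / 2| ≤ c ^ 2 - b ^ 2 := by
    rw [abs_le]; constructor <;> linarith
  refine (abs_add_le _ _).trans ?_
  rw [abs_mul]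
  calc _ ≤ (c ^ 2 - b ^ 2) / (b ^ 2 - a ^ 2) * (a ^ 2 + 1) + (c ^ 2 - b ^ 2) := by
        refine add_le_add (mul_le_mul hr h6 (abs_nonneg _) ?_) h7
        exact div_nonneg (by linarith) h5.le
    _ = _ := by ring

theorem abs_qGamma_sub_mul_Aminus_le (ha : 0 < a) (hab : a < b) (hbc : b < c) :
    |(qGamma a b c - (c ^ 2 - b ^ 2) * (b ^ 2 - (a ^ 2 + b ^ 2 - c ^ 2) / 2)) * Aminus a b c| ≤
      Real.pi * (1 * (4 * c ^ 2)) := by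
  have h0 : 0 < a ^ 2 := by positivity
  have h1 : a ^ 2 < b ^ 2 := by nlinarith
  have h2 : b ^ 2 < c ^ 2 := by nlinarith
  have i1 := intervalIntegrable_central_mul ha hab hbc
    (f := fun s => (c ^ 2 - s) * (s - (a ^ 2 + b ^ 2 - c ^ 2) / 2)) (by fun_prop)
  have i2 := intervalIntegrable_central_mul ha hab hbc (f := fun _ => 1) (by fun_prop)
  have e : (qGamma a b c - (c ^ 2 - b ^ 2) * (b ^ 2 - (a ^ 2 + b ^ 2 - c ^ 2) / 2)) *
      Aminus a b c = ∫ s in (0 : ℝ)..(a ^ 2), arcsineWeight 0 (a ^ 2) s *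
        ((b ^ 2 - s) / √((b ^ 2 - s) * (c ^ 2 - s)) *
          (s + b ^ 2 - c ^ 2 - (a ^ 2 + b ^ 2 - c ^ 2) / 2)) := by
    rw [sub_mul, qGamma_mul_Aminus ha hab hbc, Aminus_eq ha hab hbc,
      ← intervalIntegral.integral_const_mul, ← intervalIntegral.integral_sub i1 (i2.const_mul _)]
    refine intervalIntegral.integral_congr fun s _ => ?_
    ring
  rw [e]
  refine abs_integral_arcsineWeight_mul_le h0 ?_ fun s hs => ?_
  · exact (continuousOn_div_sqrt (by fun_prop) (by fun_prop)
      (central_pos ha hab hbc)).mul (by fun_prop)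
  · have h3 := hs.1
    have h4 := hs.2
    rw [abs_mul]
    refine mul_le_mul (abs_div_sqrt_central_le_one ha hab hbc hs) ?_ (abs_nonneg _) zero_le_one
    rw [abs_le]; constructor <;> linarith

theorem evenConst_eq (a b c : ℝ) : evenConst a b c =
    1 / 2 * ((∫ v in Set.Ioi (0 : ℝ),
      secondKindDensity (c ^ 2) (c ^ 2 - a ^ 2) (c ^ 2 - b ^ 2) v) +
    qGamma a b c * BminusOne a b c) - c ^ 2 / 2 := rfl

end Bounds

end FocusingNLS

namespace FocusingNLS

/-! ### The integrals over `(γ, ∞)` on the degenerate curves -/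

section Degenerate

variable {ga r v : ℝ}

theorem firstKindDensity_self_left (hg : 0 < ga) (hv : 0 < v) :
    firstKindDensity ga ga r v = 1 / (√(v * (v + r)) * (v + ga)) := by
  rw [firstKindDensity, sqrt_eq_sqrt_mul_of_eq (x := v * (v + r)) (t := v + ga) (by linarith)
    (by ring)]

theorem firstKindDensity_self_right (hr : 0 < r) (hv : 0 < v) :
    firstKindDensity ga r r v = 1 / (√(v * (v + ga)) * (v + r)) := by
  rw [firstKindDensity, sqrt_eq_sqrt_mul_of_eq (x := v * (v + ga)) (t := v + r) (by linarith)
    (by ring)]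

theorem integral_firstKindDensity_self_left (hr : 0 < r) (hrg : r < ga) :
    ∫ v in Set.Ioi (0 : ℝ), firstKindDensity ga ga r v =
      1 / (√(ga - r) * √ga) * Real.log ((√ga + √(ga - r)) / (√ga - √(ga - r))) := by
  rw [← integral_inv_sqrt_mul_add_of_gt hr hrg]
  exact setIntegral_congr_fun measurableSet_Ioi fun v hv =>
    firstKindDensity_self_left (hr.trans hrg) hv

theorem integral_firstKindDensity_self_right (hr : 0 < r) (hrg : r < ga) :
    ∫ v in Set.Ioi (0 : ℝ), firstKindDensity ga r r v =
      2 / (√(ga - r) * √r) * Real.arctan (√(ga - r) / √r) := by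
  rw [← integral_inv_sqrt_mul_add_of_lt hr hrg]
  exact setIntegral_congr_fun measurableSet_Ioi fun v hv =>
    firstKindDensity_self_right hr hv

theorem integral_thirdKindDensity_zero {al x0 : ℝ} (h0 : 0 < al) (h : al < x0) :
    ∫ v in Set.Ioi (0 : ℝ), thirdKindDensity x0 (x0 - al) 0 v =
      2 * Real.log 2 - 2 * Real.log (1 + √(1 - al / x0)) := by
  rw [← integral_inv_sqrt_sub_inv h0 h.le]
  refine setIntegral_congr_fun measurableSet_Ioi fun v (hv : 0 < v) => ?_
  have h1 := Real.sqrt_pos.2 hv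
  have h2 : 0 < (v + x0) * (v + (x0 - al)) := mul_pos (by linarith) (by linarith)
  simp only [thirdKindDensity, add_zero]
  rw [Real.sqrt_mul h2.le, add_sub_assoc]
  field_simp

theorem integral_secondKindDensity_zero {al x0 : ℝ} (h0 : 0 < al) (h : al < x0) :
    ∫ v in Set.Ioi (0 : ℝ), secondKindDensity x0 (x0 - al) 0 v =
      x0 - al / 2 - √(x0 * (x0 - al)) := by
  rw [← integral_sub_half_div_sqrt_sub_one h0 h.le]
  refine setIntegral_congr_fun measurableSet_Ioi fun v (hv : 0 < v) => ?_
  have h1 := Real.sqrt_pos.2 hv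
  have h2 : 0 < (v + x0) * (v + (x0 - al)) := mul_pos (by linarith) (by linarith)
  have h3 := Real.sqrt_pos.2 h2
  simp only [secondKindDensity, add_zero]
  rw [Real.sqrt_mul h2.le, add_sub_assoc v x0 al]
  field_simp
  ring

theorem sqrt_div_sqrt_self_right (hr : 0 < r) (hv : 0 < v) :
    √v / √((v + ga) * (v + r) * (v + r)) = v * (1 / (√(v * (v + ga)) * (v + r))) := by
  rw [← firstKindDensity_self_right hr hv, mul_firstKindDensity hv]

theorem mul_integral_firstKindDensity_add_third (hr : 0 < r) (hrg : r < ga) :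
    r * (∫ v in Set.Ioi (0 : ℝ), firstKindDensity ga r r v) +
      ∫ v in Set.Ioi (0 : ℝ), thirdKindDensity ga r r v = 2 * Real.log 2 := by
  have hg := hr.trans hrg
  have h := integral_inv_sqrt_sub_inv hg le_rfl
  rw [div_self hg.ne', sub_self, Real.sqrt_zero, add_zero, Real.log_one, mul_zero, sub_zero] at h
  rw [← h, ← integral_const_mul,
    ← integral_add ((integrableOn_firstKindDensity hr hrg.le hr).const_mul r)
      (integrableOn_thirdKindDensity hr hrg.le hr.le le_rfl)]
  refine setIntegral_congr_fun measurableSet_Ioi fun v (hv : 0 < v) => ?_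
  have h2 : 0 < √(v * (v + ga)) := Real.sqrt_pos.2 (by positivity)
  simp only [thirdKindDensity]
  rw [sqrt_div_sqrt_self_right hr hv, firstKindDensity_self_right hr hv,
    add_sub_cancel_right, mul_comm (v + ga)]
  field_simp
  ring

theorem integral_secondKindDensity_add_mul (hr : 0 < r) (hrg : r < ga) :
    (∫ v in Set.Ioi (0 : ℝ), secondKindDensity ga r r v) +
      r * ga / 2 * ∫ v in Set.Ioi (0 : ℝ), firstKindDensity ga r r v = ga / 2 := by
  have hg := hr.trans hrg
  have h := integral_sub_half_div_sqrt_sub_one hg le_rfl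
  rw [sub_self, mul_zero, Real.sqrt_zero, sub_zero, sub_half] at h
  rw [← h, ← integral_const_mul, ← integral_add
      (integrableOn_secondKindDensity hr hrg.le hr.le le_rfl)
      ((integrableOn_firstKindDensity hr hrg.le hr).const_mul _)]
  refine setIntegral_congr_fun measurableSet_Ioi fun v (hv : 0 < v) => ?_
  have h2 : 0 < √(v * (v + ga)) := Real.sqrt_pos.2 (by positivity)
  simp only [secondKindDensity]
  rw [mul_div_right_comm, sqrt_div_sqrt_self_right hr hv, firstKindDensity_self_right hr hv,
    add_sub_cancel_right, mul_comm (v + ga)]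
  field_simp
  ring

end Degenerate

end FocusingNLS

namespace FocusingNLS

/-! ### The limit `c → b` -/

theorem tendsto_mul_zero_of_abs_le {ι : Type*} {l : Filter ι} {f g B : ι → ℝ} {K : ℝ}
    (h : ∀ᶠ i in l, |f i| ≤ K * g i) (hB : ∀ᶠ i in l, 0 ≤ B i)
    (hBg : Tendsto (fun i => g i * B i) l (𝓝 0)) : Tendsto (fun i => f i * B i) l (𝓝 0) := by
  have h0 := hBg.const_mul K
  rw [mul_zero] at h0
  refine squeeze_zero_norm' ?_ h0
  filter_upwards [h, hB] with i h1 h2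
  rw [Real.norm_eq_abs, abs_mul, abs_of_nonneg h2, ← mul_assoc]
  exact mul_le_mul_of_nonneg_right h1 h2

theorem tendsto_sq_nhdsGT (b : ℝ) : Tendsto (fun c : ℝ => c ^ 2) (𝓝[>] b) (𝓝 (b ^ 2)) :=
  ((continuous_pow 2).tendsto b).mono_left nhdsWithin_le_nhds

section Right

variable {a b : ℝ}

theorem eventually_sq_lt_nhdsGT (hab : 0 < b) {y : ℝ} (hy : b ^ 2 < y) :
    ∀ᶠ c in 𝓝[>] b, b < c ∧ b ^ 2 < c ^ 2 ∧ c ^ 2 < y := by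
  filter_upwards [self_mem_nhdsWithin, (tendsto_sq_nhdsGT b).eventually_lt_const hy] with c h1 h2
  exact ⟨h1, pow_lt_pow_left₀ h1 hab.le two_ne_zero, h2⟩

theorem tendsto_Aminus_nhdsGT (ha : 0 < a) (hab : a < b) :
    Tendsto (fun c => Aminus a b c) (𝓝[>] b) (𝓝 (Real.pi / √(b ^ 2 * (b ^ 2 - a ^ 2)))) := by
  have h1 : a ^ 2 < b ^ 2 := by nlinarith
  have h : 0 < b ^ 2 * (b ^ 2 - a ^ 2) := mul_pos (by nlinarith) (by linarith)
  have ht : Tendsto (fun c : ℝ => Real.pi / √(c ^ 2 * (c ^ 2 - a ^ 2))) (𝓝[>] b)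
      (𝓝 (Real.pi / √(b ^ 2 * (b ^ 2 - a ^ 2)))) :=
    tendsto_const_nhds.div ((Real.continuous_sqrt.tendsto _).comp
      ((tendsto_sq_nhdsGT b).mul ((tendsto_sq_nhdsGT b).sub_const _))) (Real.sqrt_pos.2 h).ne'
  refine tendsto_of_tendsto_of_tendsto_of_le_of_le' ht tendsto_const_nhds ?_ ?_
  · filter_upwards [self_mem_nhdsWithin] with c hc using le_Aminus ha hab hc
  · filter_upwards [self_mem_nhdsWithin] with c hc using Aminus_le ha hab hc

theorem tendsto_sq_sub_sq_nhdsGT (hb : 0 < b) :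
    Tendsto (fun c : ℝ => c ^ 2 - b ^ 2) (𝓝[>] b) (𝓝[>] 0) := by
  refine tendsto_nhdsWithin_iff.2 ⟨?_, ?_⟩
  · rw [← sub_self (b ^ 2)]
    exact (tendsto_sq_nhdsGT b).sub_const (b ^ 2)
  · filter_upwards [self_mem_nhdsWithin] with c hc
    exact sub_pos.2 (pow_lt_pow_left₀ hc hb.le two_ne_zero)

theorem tendsto_Aplus_nhdsGT (ha : 0 < a) (hab : a < b) :
    Tendsto (fun c => Aplus a b c) (𝓝[>] b) atTop := by
  have h1 : 0 < b ^ 2 - a ^ 2 := by nlinarith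
  have h2 : Tendsto (fun c : ℝ => (c ^ 2 - a ^ 2) / (c ^ 2 - b ^ 2)) (𝓝[>] b) atTop := by
    simp only [div_eq_mul_inv]
    exact Tendsto.pos_mul_atTop h1 ((tendsto_sq_nhdsGT b).sub_const _)
      (tendsto_inv_nhdsGT_zero.comp (tendsto_sq_sub_sq_nhdsGT (ha.trans hab)))
  refine tendsto_atTop_mono' _ ?_ ((Real.tendsto_log_atTop.comp h2).const_mul_atTop
    (r := 1 / √(b ^ 2 - a ^ 2)) (one_div_pos.2 (Real.sqrt_pos.2 h1)))
  filter_upwards [self_mem_nhdsWithin] with c hc using log_le_Aplus ha hab hc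

theorem tendsto_Bplus_nhdsGT (ha : 0 < a) (hab : a < b) :
    Tendsto (fun c => Bplus a b c) (𝓝[>] b) (𝓝 (Real.pi * (1 / √(b ^ 2 - a ^ 2)))) := by
  have h1 : 0 < b ^ 2 - a ^ 2 := by nlinarith
  have ht : Tendsto (fun c : ℝ => Real.pi * (1 / √(c ^ 2 - a ^ 2))) (𝓝[>] b)
      (𝓝 (Real.pi * (1 / √(b ^ 2 - a ^ 2)))) :=
    (tendsto_const_nhds.div ((Real.continuous_sqrt.tendsto _).comp
      ((tendsto_sq_nhdsGT b).sub_const _)) (Real.sqrt_pos.2 h1).ne').const_mul _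
  refine tendsto_of_tendsto_of_tendsto_of_le_of_le' ht tendsto_const_nhds ?_ ?_
  · filter_upwards [self_mem_nhdsWithin] with c hc using le_Bplus ha hab hc
  · filter_upwards [self_mem_nhdsWithin] with c hc using Bplus_le ha hab hc

theorem Bplus_pos {c : ℝ} (ha : 0 < a) (hab : a < b) (hbc : b < c) : 0 < Bplus a b c := by
  have h1 : 0 < c ^ 2 - a ^ 2 := by nlinarith
  have h2 := Real.sqrt_pos.2 h1
  exact lt_of_lt_of_le (by positivity) (le_Bplus ha hab hbc)

theorem Bminus_pos {c : ℝ} (ha : 0 < a) (hab : a < b) (hbc : b < c) : 0 < Bminus a b c := by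
  have h1 : 0 < b ^ 2 * (c ^ 2 - a ^ 2) := mul_pos (by nlinarith) (by nlinarith)
  have h2 := Real.sqrt_pos.2 h1
  exact lt_of_lt_of_le (by positivity) (le_Bminus ha hab hbc)

theorem tendsto_bplus_nhdsGT (ha : 0 < a) (hab : a < b) :
    Tendsto (fun c => bplus a b c) (𝓝[>] b) (𝓝[>] 0) := by
  refine tendsto_nhdsWithin_iff.2
    ⟨(tendsto_Bplus_nhdsGT ha hab).div_atTop (tendsto_Aplus_nhdsGT ha hab), ?_⟩
  filter_upwards [self_mem_nhdsWithin] with c hc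
  exact div_pos (Bplus_pos ha hab hc) (Aplus_pos ha hab hc)

theorem tendsto_bminus_nhdsGT (ha : 0 < a) (hab : a < b) :
    Tendsto (fun c => bminus a b c) (𝓝[>] b) atTop := by
  have h1 : 0 < b ^ 2 * (b ^ 2 - a ^ 2) := mul_pos (by nlinarith) (by nlinarith)
  have h2 := Real.sqrt_pos.2 h1
  have h3 : 0 < Real.pi / √(b ^ 2 * (b ^ 2 - a ^ 2)) := by positivity
  have hB : Tendsto (fun c => Bminus a b c) (𝓝[>] b) atTop := by
    refine tendsto_atTop_mono' _ ?_ ((tendsto_Aplus_nhdsGT ha hab).const_mul_atTop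
      (one_div_pos.2 (ha.trans hab)))
    filter_upwards [self_mem_nhdsWithin] with c hc using Aplus_le_Bminus ha hab hc
  exact hB.atTop_mul_pos (inv_pos.2 h3) ((tendsto_Aminus_nhdsGT ha hab).inv₀ h3.ne')

theorem tendsto_Jminus_nhdsGT (ha : 0 < a) (hab : a < b) :
    Tendsto (fun c => Jminus a b c) (𝓝[>] b)
      (𝓝 (∫ v in Set.Ioi (0 : ℝ), firstKindDensity (b ^ 2) (b ^ 2) (a ^ 2) v)) := by
  have h1 : a ^ 2 < b ^ 2 := by nlinarith
  have h0 : 0 < a ^ 2 := by positivity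
  refine tendsto_integral_firstKindDensity h0 (Eventually.of_forall fun _ => h1.le) ?_
    (Eventually.of_forall fun _ => le_rfl) (tendsto_sq_nhdsGT b) tendsto_const_nhds
    tendsto_const_nhds (h0.trans h1) (h0.trans h1) h0
  filter_upwards [eventually_sq_lt_nhdsGT (ha.trans hab) (lt_add_one _)] with c hc
  linarith [hc.2.1]

theorem tendsto_mul_BminusOne_nhdsGT (ha : 0 < a) (hab : a < b) :
    Tendsto (fun c => (c ^ 2 - b ^ 2) * BminusOne a b c) (𝓝[>] b) (𝓝 0) := by
  have h1 : 0 < b ^ 2 - a ^ 2 := by nlinarith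
  have ht : Tendsto (fun c : ℝ => √(c ^ 2 - b ^ 2) * (Real.pi / √(c ^ 2 - a ^ 2))) (𝓝[>] b)
      (𝓝 (√(b ^ 2 - b ^ 2) * (Real.pi / √(b ^ 2 - a ^ 2)))) :=
    ((Real.continuous_sqrt.tendsto _).comp ((tendsto_sq_nhdsGT b).sub_const _)).mul
      (tendsto_const_nhds.div ((Real.continuous_sqrt.tendsto _).comp
      ((tendsto_sq_nhdsGT b).sub_const _)) (Real.sqrt_pos.2 h1).ne')
  rw [sub_self, Real.sqrt_zero, zero_mul] at ht
  refine squeeze_zero' ?_ ?_ ht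
  · filter_upwards [eventually_sq_lt_nhdsGT (ha.trans hab) (lt_add_one _)] with c hc
    exact mul_nonneg (by linarith [hc.2.1]) (BminusOne_nonneg _ _ _)
  · filter_upwards [eventually_sq_lt_nhdsGT (ha.trans hab) (lt_add_one _)] with c hc
    have h2 : 0 < c ^ 2 - b ^ 2 := by linarith [hc.2.1]
    refine (mul_le_mul_of_nonneg_left (BminusOne_le ha hab hc.1) h2.le).trans (le_of_eq ?_)
    rw [← mul_assoc, mul_one_div, Real.div_sqrt]

theorem tendsto_integral_thirdKindDensity_nhdsGT (ha : 0 < a) (hab : a < b) :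
    Tendsto (fun c => ∫ v in Set.Ioi (0 : ℝ),
      thirdKindDensity (c ^ 2) (c ^ 2 - a ^ 2) (c ^ 2 - b ^ 2) v) (𝓝[>] b)
      (𝓝 (2 * Real.log 2 - 2 * Real.log (1 + √(1 - a ^ 2 / b ^ 2)))) := by
  have h1 : a ^ 2 < b ^ 2 := by nlinarith
  have h0 : 0 < a ^ 2 := by positivity
  rw [← integral_thirdKindDensity_zero h0 h1]
  have hev := eventually_sq_lt_nhdsGT (ha.trans hab) (lt_add_one _)
  refine tendsto_integral_thirdKindDensity (m := b ^ 2 - a ^ 2) (G := b ^ 2 + 1) (by linarith)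
    (hev.mono fun c hc => hc.2.2.le) (hev.mono fun c hc => by linarith [hc.2.1])
    (hev.mono fun c hc => by linarith) (hev.mono fun c hc => by linarith [hc.2.1])
    (hev.mono fun c hc => by linarith [hc.2.1]) (tendsto_sq_nhdsGT b)
    ((tendsto_sq_nhdsGT b).sub_const _) ?_ (by linarith) (by linarith) le_rfl
  exact tendsto_nhds_of_tendsto_nhdsWithin (tendsto_sq_sub_sq_nhdsGT (ha.trans hab))

theorem tendsto_integral_secondKindDensity_nhdsGT (ha : 0 < a) (hab : a < b) :
    Tendsto (fun c => ∫ v in Set.Ioi (0 : ℝ),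
      secondKindDensity (c ^ 2) (c ^ 2 - a ^ 2) (c ^ 2 - b ^ 2) v) (𝓝[>] b)
      (𝓝 (b ^ 2 - a ^ 2 / 2 - √(b ^ 2 * (b ^ 2 - a ^ 2)))) := by
  have h1 : a ^ 2 < b ^ 2 := by nlinarith
  have h0 : 0 < a ^ 2 := by positivity
  rw [← integral_secondKindDensity_zero h0 h1]
  have hev := eventually_sq_lt_nhdsGT (ha.trans hab) (lt_add_one _)
  refine tendsto_integral_secondKindDensity (m := b ^ 2 - a ^ 2) (G := b ^ 2 + 1) (by linarith)
    (hev.mono fun c hc => hc.2.2.le) (hev.mono fun c hc => by linarith [hc.2.1])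
    (hev.mono fun c hc => by linarith) (hev.mono fun c hc => by linarith [hc.2.1])
    (hev.mono fun c hc => by linarith [hc.2.1]) (tendsto_sq_nhdsGT b)
    ((tendsto_sq_nhdsGT b).sub_const _) ?_ (by linarith) (by linarith) le_rfl
  exact tendsto_nhds_of_tendsto_nhdsWithin (tendsto_sq_sub_sq_nhdsGT (ha.trans hab))

theorem tendsto_evenConst_nhdsGT (ha : 0 < a) (hab : a < b) :
    Tendsto (fun c => evenConst a b c) (𝓝[>] b)
      (𝓝 (-(a ^ 2 / 4) - √(b ^ 2 * (b ^ 2 - a ^ 2)) / 2)) := by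
  have h1 : 0 < b ^ 2 - a ^ 2 := by nlinarith
  have hm := Real.sqrt_pos.2 (mul_pos (h1.trans (by nlinarith : b ^ 2 - a ^ 2 < b ^ 2)) h1)
  have hA := tendsto_Aminus_nhdsGT ha hab
  have hev := eventually_sq_lt_nhdsGT (ha.trans hab) (lt_add_one _)
  have hq : Tendsto (fun c => qGamma a b c * Aminus a b c * BminusOne a b c) (𝓝[>] b) (𝓝 0) := by
    refine tendsto_mul_zero_of_abs_le (K := Real.pi * ((a ^ 2 + 1) / (b ^ 2 - a ^ 2) + 1))
      (hev.mono fun c hc => ?_) (Eventually.of_forall fun c => BminusOne_nonneg _ _ _)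
      (tendsto_mul_BminusOne_nhdsGT ha hab)
    refine (abs_qGamma_mul_Aminus_le ha hab hc.1 (by linarith [hc.2.2])).trans (le_of_eq ?_)
    ring
  have hq2 : Tendsto (fun c => qGamma a b c * BminusOne a b c) (𝓝[>] b) (𝓝 0) := by
    have := hq.div hA (by positivity)
    rw [zero_div] at this
    refine this.congr' (hev.mono fun c hc => ?_)
    have := (Aminus_pos ha hab hc.1).ne'
    simp only [Pi.div_apply]
    field_simp
  have := ((((tendsto_integral_secondKindDensity_nhdsGT ha hab).add hq2).const_mul (1 / 2)).sub
    ((tendsto_sq_nhdsGT b).div_const 2))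
  refine (this.congr fun c => (evenConst_eq a b c).symm).trans (le_of_eq ?_)
  congr 1
  ring

theorem exponent_eq {c : ℝ} (ha : 0 < a) (hab : a < b) (hbc : b < c) :
    Dminus a b c * delta a b c - Fminus a b c + Real.pi * delta a b c -
        Real.pi * bminus a b c / 2 =
      (2 * Dminus a b c + Real.pi - c ^ 2 * Aminus a b c) * BminusOne a b c / (2 * Aminus a b c) -
      1 / 2 * (∫ v in Set.Ioi (0 : ℝ), thirdKindDensity (c ^ 2) (c ^ 2 - a ^ 2) (c ^ 2 - b ^ 2) v) -
      Real.pi * Jminus a b c / (2 * Aminus a b c) := by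
  have := (Aminus_pos ha hab hbc).ne'
  rw [Fminus_eq ha hab hbc, delta, bminus, Bminus_eq_BminusOne_add ha hab hbc]
  field_simp
  ring

theorem log_value_eq (ha : 0 < a) (hab : a < b) :
    -(1 / 2) * (2 * Real.log 2 - 2 * Real.log (1 + √(1 - a ^ 2 / b ^ 2))) -
      √(b ^ 2 * (b ^ 2 - a ^ 2)) / 2 * (1 / (√(b ^ 2 - a ^ 2) * √(b ^ 2)) *
        Real.log ((√(b ^ 2) + √(b ^ 2 - a ^ 2)) / (√(b ^ 2) - √(b ^ 2 - a ^ 2)))) =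
      Real.log (a / (2 * b)) := by
  have hb := ha.trans hab
  have h1 : 0 < b ^ 2 - a ^ 2 := by nlinarith
  have hd := Real.sqrt_pos.2 h1
  have hd2 := Real.sq_sqrt h1.le
  have hdb : √(b ^ 2 - a ^ 2) < b := by
    rw [Real.sqrt_lt' hb]; nlinarith
  have e1 : √(1 - a ^ 2 / b ^ 2) = √(b ^ 2 - a ^ 2) / b := by
    have : 1 - a ^ 2 / b ^ 2 = (b ^ 2 - a ^ 2) / b ^ 2 := by field_simp
    rw [this, Real.sqrt_div h1.le, Real.sqrt_sq hb.le]
  rw [Real.sqrt_mul (by positivity), e1, Real.sqrt_sq hb.le]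
  set d := √(b ^ 2 - a ^ 2)
  have e2 : (b + d) / (b - d) = ((b + d) / a) ^ 2 := by
    have : b - d ≠ 0 := by linarith
    field_simp
    linear_combination hd2
  have e3 : 1 + d / b = (b + d) / b := by field_simp
  rw [e2, e3, Real.log_pow, Real.log_div (by positivity) hb.ne', Real.log_div (by positivity) ha.ne',
    Real.log_div ha.ne' (by positivity), Real.log_mul two_ne_zero hb.ne']
  field_simp
  push_cast
  ring

theorem tendsto_exponent_nhdsGT (ha : 0 < a) (hab : a < b) :
    Tendsto (fun c => Dminus a b c * delta a b c - Fminus a b c + Real.pi * delta a b c -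
        Real.pi * bminus a b c / 2) (𝓝[>] b) (𝓝 (Real.log (a / (2 * b)))) := by
  have h0 : 0 < a ^ 2 := by positivity
  have h1 : 0 < b ^ 2 - a ^ 2 := by nlinarith
  have hm := Real.sqrt_pos.2 (mul_pos (h1.trans (by nlinarith : b ^ 2 - a ^ 2 < b ^ 2)) h1)
  have hA := (tendsto_Aminus_nhdsGT ha hab).const_mul 2
  have hev := eventually_sq_lt_nhdsGT (ha.trans hab) (lt_add_one _)
  have hX : Tendsto (fun c => (2 * Dminus a b c + Real.pi - c ^ 2 * Aminus a b c) *
      BminusOne a b c) (𝓝[>] b) (𝓝 0) := by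
    refine tendsto_mul_zero_of_abs_le (K := Real.pi / (b ^ 2 - a ^ 2))
      (hev.mono fun c hc => ?_) (Eventually.of_forall fun c => BminusOne_nonneg _ _ _)
      (tendsto_mul_BminusOne_nhdsGT ha hab)
    refine (two_mul_Dminus_add_pi_sub ha hab hc.1).trans (le_of_eq ?_)
    ring
  have hne : 2 * (Real.pi / √(b ^ 2 * (b ^ 2 - a ^ 2))) ≠ 0 := by positivity
  have h := ((hX.div hA hne).sub
    ((tendsto_integral_thirdKindDensity_nhdsGT ha hab).const_mul (1 / 2))).sub
    (((tendsto_Jminus_nhdsGT ha hab).const_mul Real.pi).div hA hne)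
  rw [integral_firstKindDensity_self_left h0 (by linarith)] at h
  refine (h.congr' (hev.mono fun c hc => (exponent_eq ha hab hc.1).symm)).trans (le_of_eq ?_)
  rw [← log_value_eq ha hab]
  congr 1
  field_simp
  ring

end Right

end FocusingNLS

namespace FocusingNLS

section Right

variable {a b : ℝ}

theorem tendsto_phase2_nhdsGT (ha : 0 < a) (hab : a < b) (l0 x t : ℝ) :
    Tendsto (fun c => phase2 l0 a b c (1 / 4) x t) (𝓝[>] b) (𝓝 (1 / 2)) := by
  have hA := tendsto_Aplus_nhdsGT ha hab
  have h := (((tendsto_const_nhds (x := (2 : ℝ))).div_atTop hA).mul_const x).add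
    (((tendsto_const_nhds (x := 8 * l0)).div_atTop hA).mul_const t) |>.add_const (2 * (1 / 4))
  refine h.trans (le_of_eq ?_)
  norm_num

theorem tendsto_phase2_div_nhdsGT (ha : 0 < a) (hab : a < b) (l0 x t : ℝ) :
    Tendsto (fun c => (1 - 2 * phase2 l0 a b c (1 / 4) x t) / bplus a b c) (𝓝[>] b)
      (𝓝 (-(4 * x + 16 * l0 * t) / (Real.pi * (1 / √(b ^ 2 - a ^ 2))))) := by
  have h1 : 0 < b ^ 2 - a ^ 2 := by nlinarith
  have := Real.sqrt_pos.2 h1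
  refine ((tendsto_const_nhds (x := -(4 * x + 16 * l0 * t))).div (tendsto_Bplus_nhdsGT ha hab)
    (by positivity)).congr' ?_
  filter_upwards [self_mem_nhdsWithin] with c hc
  have hA := (Aplus_pos ha hab hc).ne'
  have hB := (Bplus_pos ha hab hc).ne'
  simp only [phase2, bplus, Pi.div_apply]
  field_simp
  ring

theorem delta_sub_bminus {c : ℝ} (ha : 0 < a) (hab : a < b) (hbc : b < c) :
    delta a b c - bminus a b c = -(Jminus a b c / Aminus a b c) := by
  rw [delta, bminus, Bminus_eq_BminusOne_add ha hab hbc]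
  ring

theorem eventually_abs_delta_sub_le (ha : 0 < a) (hab : a < b) :
    ∃ S, ∀ᶠ c in 𝓝[>] b, |delta a b c - bminus a b c| ≤ S := by
  have h1 : 0 < b ^ 2 - a ^ 2 := by nlinarith
  have hm := Real.sqrt_pos.2 (mul_pos (h1.trans (by nlinarith : b ^ 2 - a ^ 2 < b ^ 2)) h1)
  have h := ((tendsto_Jminus_nhdsGT ha hab).div (tendsto_Aminus_nhdsGT ha hab)
    (by positivity)).neg.abs
  obtain ⟨S, hS⟩ := exists_gt |(-((∫ v in Set.Ioi (0 : ℝ),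
    firstKindDensity (b ^ 2) (b ^ 2) (a ^ 2) v) / (Real.pi / √(b ^ 2 * (b ^ 2 - a ^ 2)))))|
  refine ⟨S, ?_⟩
  filter_upwards [h.eventually_lt_const hS, self_mem_nhdsWithin] with c h1 hc
  rw [delta_sub_bminus ha hab hc]
  exact h1.le

theorem twoPhase_eq {c : ℝ} (ha : 0 < a) (hab : a < b) (hbc : b < c) (l0 Z₁ Z₂ x t : ℝ) :
    twoPhase l0 a b c Z₁ Z₂ x t =
      2 * c * Complex.exp ((Dminus a b c * delta a b c - Fminus a b c : ℝ) : ℂ) *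
      (thetaH (bminus a b c) (bplus a b c) (phase1 a b c Z₁ t + Complex.I * delta a b c)
        (phase2 l0 a b c Z₂ x t + 1) /
      thetaH (bminus a b c) (bplus a b c) (phase1 a b c Z₁ t) (phase2 l0 a b c Z₂ x t)) *
      Complex.exp (-2 * Complex.I * l0 * x +
        2 * Complex.I * (-2 * l0 ^ 2 - 4 * (evenConst a b c : ℝ)) * t) := by
  rw [twoPhase, K1_eq ha hab hbc, K2_eq ha hab hbc, K0, Complex.ofReal_exp]
  change _ * (thetaH _ _ _ _ / thetaH _ _ _ _) * _ = _
  congr 2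
  · linear_combination (-2 * (c : ℂ) * Complex.exp ((Dminus a b c * delta a b c - Fminus a b c :
      ℝ) : ℂ)) * Complex.I_sq
  · ring

theorem mul_exp_mul_exp_mul_exp (k q : ℂ) {x₁ x₂ x₃ y₁ y₂ : ℂ} (h : x₁ + x₂ + x₃ = y₁ + y₂) :
    k * Complex.exp x₁ * (q * Complex.exp x₂) * Complex.exp x₃ =
      k * Complex.exp y₁ * q * Complex.exp y₂ := by
  have e : Complex.exp x₁ * Complex.exp x₂ * Complex.exp x₃ = Complex.exp y₁ * Complex.exp y₂ := by
    rw [← Complex.exp_add, ← Complex.exp_add, h, Complex.exp_add]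
  linear_combination (k * q) * e

theorem tendsto_twoPhase_nhdsGT (ha : 0 < a) (hab : a < b) (l0 x t : ℝ) :
    Tendsto (fun c : ℝ => twoPhase l0 a b c 0 (1 / 4) x t) (𝓝[>] b)
      (𝓝 ((a : ℂ) * Complex.exp
        (-2 * Complex.I * l0 * x - 2 * Complex.I * (2 * (l0 : ℂ) ^ 2 - (a : ℂ) ^ 2) * t))) := by
  have hb := ha.trans hab
  have h1 : 0 < b ^ 2 - a ^ 2 := by nlinarith
  have hm := Real.sqrt_pos.2 (mul_pos (h1.trans (by nlinarith : b ^ 2 - a ^ 2 < b ^ 2)) h1)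
  have hev := eventually_sq_lt_nhdsGT (ha.trans hab) (lt_add_one _)
  obtain ⟨S, hS⟩ := eventually_abs_delta_sub_le ha hab
  have hA := tendsto_Aminus_nhdsGT ha hab
  set m := √(b ^ 2 * (b ^ 2 - a ^ 2)) with hmdef
  have hR := tendsto_thetaH_ratio_of_right (u₁ := fun c => phase1 a b c 0 t)
    (tendsto_bminus_nhdsGT ha hab) (tendsto_bplus_nhdsGT ha hab) hS
    (tendsto_phase2_nhdsGT ha hab l0 x t) (tendsto_phase2_div_nhdsGT ha hab l0 x t)
  have hu : Tendsto (fun c => phase1 a b c 0 t) (𝓝[>] b) (𝓝 (4 / (Real.pi / m) * t)) := by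
    have := ((tendsto_const_nhds (x := (4 : ℝ))).div hA (by positivity)).mul_const t
    refine this.congr fun c => ?_
    simp [phase1]
  have hG := (Complex.continuous_exp.tendsto _).comp
    ((Complex.continuous_ofReal.tendsto _).comp (tendsto_exponent_nhdsGT ha hab))
  have hE := (Complex.continuous_ofReal.tendsto _).comp (tendsto_evenConst_nhdsGT ha hab)
  have hU := (Complex.continuous_ofReal.tendsto _).comp hu
  have hEE : Tendsto (fun c => Complex.exp (-2 * Complex.I * l0 * x +
        2 * Complex.I * (-2 * l0 ^ 2 - 4 * (evenConst a b c : ℝ)) * t -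
        Real.pi * Complex.I * (phase1 a b c 0 t : ℝ))) (𝓝[>] b) (𝓝 (Complex.exp
        (-2 * Complex.I * l0 * x +
        2 * Complex.I * (-2 * l0 ^ 2 - 4 * ((-(a ^ 2 / 4) - m / 2 : ℝ) : ℂ)) * t -
        Real.pi * Complex.I * ((4 / (Real.pi / m) * t : ℝ) : ℂ)))) := by
    refine (Complex.continuous_exp.tendsto _).comp (Tendsto.sub (Tendsto.const_add _
      (Tendsto.mul_const _ (Tendsto.const_mul _ (Tendsto.const_sub _ (Tendsto.const_mul _ hE)))))
      (Tendsto.const_mul _ hU))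
  have hc : Tendsto (fun c : ℝ => (2 * c : ℂ)) (𝓝[>] b) (𝓝 (2 * b)) :=
    (((Complex.continuous_ofReal.tendsto b).mono_left nhdsWithin_le_nhds)).const_mul 2
  have h := ((hc.mul hG).mul hR).mul hEE
  refine (h.congr' (hev.mono fun c hc => ?_)).trans (le_of_eq ?_)
  · rw [twoPhase_eq ha hab hc.1]
    simp only [Function.comp_apply]
    exact mul_exp_mul_exp_mul_exp _ _ (by push_cast; ring)
  · congr 1
    rw [← Complex.ofReal_exp, Real.exp_log (by positivity), mul_one]
    have hb' : (b : ℂ) ≠ 0 := by exact_mod_cast hb.ne'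
    have hm' : (m : ℂ) ≠ 0 := by exact_mod_cast hm.ne'
    have hpi : (Real.pi : ℂ) ≠ 0 := by exact_mod_cast Real.pi_ne_zero
    congr 1
    · push_cast; field_simp
    · congr 1
      push_cast
      field_simp
      ring

end Right

end FocusingNLS

namespace FocusingNLS

/-! ### The limit `a → b` -/

section Left

variable {b c : ℝ}

theorem tendsto_sq_nhdsLT (b : ℝ) : Tendsto (fun a : ℝ => a ^ 2) (𝓝[<] b) (𝓝 (b ^ 2)) :=
  ((continuous_pow 2).tendsto b).mono_left nhdsWithin_le_nhds

theorem eventually_sq_lt_nhdsLT (hb : 0 < b) :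
    ∀ᶠ a in 𝓝[<] b, 0 < a ∧ a < b ∧ a ^ 2 < b ^ 2 := by
  filter_upwards [Ioo_mem_nhdsLT hb] with a h
  exact ⟨h.1, h.2, pow_lt_pow_left₀ h.2 h.1.le two_ne_zero⟩

theorem tendsto_sq_sub_sq_nhdsLT (hb : 0 < b) :
    Tendsto (fun a : ℝ => b ^ 2 - a ^ 2) (𝓝[<] b) (𝓝[>] 0) := by
  refine tendsto_nhdsWithin_iff.2 ⟨?_, ?_⟩
  · rw [← sub_self (b ^ 2)]
    exact (tendsto_sq_nhdsLT b).const_sub (b ^ 2)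
  · filter_upwards [eventually_sq_lt_nhdsLT hb] with a ha
    exact sub_pos.2 ha.2.2

theorem tendsto_Aminus_nhdsLT (hb : 0 < b) (hbc : b < c) :
    Tendsto (fun a => Aminus a b c) (𝓝[<] b) atTop := by
  have h2 : Tendsto (fun a : ℝ => b ^ 2 / (b ^ 2 - a ^ 2)) (𝓝[<] b) atTop := by
    simp only [div_eq_mul_inv]
    exact Tendsto.const_mul_atTop (by positivity)
      (tendsto_inv_nhdsGT_zero.comp (tendsto_sq_sub_sq_nhdsLT hb))
  have hc := hb.trans hbc
  refine tendsto_atTop_mono' _ ?_ ((Real.tendsto_log_atTop.comp h2).const_mul_atTop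
    (r := 1 / (b * c)) (by positivity))
  filter_upwards [eventually_sq_lt_nhdsLT hb] with a ha using log_le_Aminus ha.1 ha.2.1 hbc

theorem tendsto_Bminus_nhdsLT (hb : 0 < b) (hbc : b < c) :
    Tendsto (fun a => Bminus a b c) (𝓝[<] b)
      (𝓝 (Real.pi * (1 / √(b ^ 2 * (c ^ 2 - b ^ 2))))) := by
  have h1 : 0 < b ^ 2 * (c ^ 2 - b ^ 2) := mul_pos (by positivity) (by nlinarith)
  have ht1 : Tendsto (fun a : ℝ => Real.pi * (1 / √(b ^ 2 * (c ^ 2 - a ^ 2)))) (𝓝[<] b)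
      (𝓝 (Real.pi * (1 / √(b ^ 2 * (c ^ 2 - b ^ 2))))) :=
    (tendsto_const_nhds.div ((Real.continuous_sqrt.tendsto _).comp
      (((tendsto_sq_nhdsLT b).const_sub _).const_mul _)) (Real.sqrt_pos.2 h1).ne').const_mul _
  have ht2 : Tendsto (fun a : ℝ => Real.pi * (1 / √(a ^ 2 * (c ^ 2 - b ^ 2)))) (𝓝[<] b)
      (𝓝 (Real.pi * (1 / √(b ^ 2 * (c ^ 2 - b ^ 2))))) :=
    (tendsto_const_nhds.div ((Real.continuous_sqrt.tendsto _).comp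
      ((tendsto_sq_nhdsLT b).mul_const _)) (Real.sqrt_pos.2 h1).ne').const_mul _
  refine tendsto_of_tendsto_of_tendsto_of_le_of_le' ht1 ht2 ?_ ?_
  · filter_upwards [eventually_sq_lt_nhdsLT hb] with a ha using le_Bminus ha.1 ha.2.1 hbc
  · filter_upwards [eventually_sq_lt_nhdsLT hb] with a ha using Bminus_le ha.1 ha.2.1 hbc

theorem tendsto_bminus_nhdsLT (hb : 0 < b) (hbc : b < c) :
    Tendsto (fun a => bminus a b c) (𝓝[<] b) (𝓝[>] 0) := by
  refine tendsto_nhdsWithin_iff.2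
    ⟨(tendsto_Bminus_nhdsLT hb hbc).div_atTop (tendsto_Aminus_nhdsLT hb hbc), ?_⟩
  filter_upwards [eventually_sq_lt_nhdsLT hb] with a ha
  exact div_pos (Bminus_pos ha.1 ha.2.1 hbc) (Aminus_pos ha.1 ha.2.1 hbc)

theorem tendsto_bplus_nhdsLT (hb : 0 < b) (hbc : b < c) :
    Tendsto (fun a => bplus a b c) (𝓝[<] b) atTop := by
  have h1 : 0 < c ^ 2 - b ^ 2 := by nlinarith
  have hs := Real.sqrt_pos.2 h1
  have h2 : Tendsto (fun a : ℝ => (c ^ 2 - a ^ 2) / (b ^ 2 - a ^ 2)) (𝓝[<] b) atTop := by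
    simp only [div_eq_mul_inv]
    exact Tendsto.pos_mul_atTop h1 ((tendsto_sq_nhdsLT b).const_sub _)
      (tendsto_inv_nhdsGT_zero.comp (tendsto_sq_sub_sq_nhdsLT hb))
  have hL := Real.tendsto_log_atTop.comp h2
  have hL' := hL.const_mul_atTop (r := 1 / √(c ^ 2 - b ^ 2) / (Real.pi * (1 / √(c ^ 2 - b ^ 2))))
    (by positivity)
  refine tendsto_atTop_mono' _ ?_ hL'
  filter_upwards [eventually_sq_lt_nhdsLT hb, hL.eventually_ge_atTop 0] with a ha h3
  rw [div_mul_eq_mul_div, bplus]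
  exact div_le_div₀ (Bplus_pos ha.1 ha.2.1 hbc).le (log_le_Bplus ha.1 ha.2.1 hbc)
    (Aplus_pos ha.1 ha.2.1 hbc) (Aplus_le ha.1 ha.2.1 hbc)

theorem eventually_density_nhdsLT (hb : 0 < b) (c : ℝ) :
    ∀ᶠ a in 𝓝[<] b, c ^ 2 - b ^ 2 ≤ c ^ 2 - a ^ 2 ∧ c ^ 2 - a ^ 2 ≤ c ^ 2 := by
  filter_upwards [eventually_sq_lt_nhdsLT hb] with a ha
  exact ⟨by linarith [ha.2.2], by linarith [sq_nonneg a]⟩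

theorem tendsto_BminusOne_nhdsLT (hb : 0 < b) (hbc : b < c) :
    Tendsto (fun a => BminusOne a b c) (𝓝[<] b)
      (𝓝 (∫ v in Set.Ioi (0 : ℝ),
        firstKindDensity (c ^ 2) (c ^ 2 - b ^ 2) (c ^ 2 - b ^ 2) v)) := by
  have h1 : 0 < c ^ 2 - b ^ 2 := by nlinarith
  have h2 : 0 < b ^ 2 := by positivity
  simp only [BminusOne_eq]
  exact tendsto_integral_firstKindDensity h1 ((eventually_density_nhdsLT hb c).mono fun a h => h.1)
    (Eventually.of_forall fun _ => by linarith) (Eventually.of_forall fun _ => le_rfl)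
    tendsto_const_nhds ((tendsto_sq_nhdsLT b).const_sub _) tendsto_const_nhds (by linarith) h1 h1

theorem tendsto_integral_thirdKindDensity_nhdsLT (hb : 0 < b) (hbc : b < c) :
    Tendsto (fun a => ∫ v in Set.Ioi (0 : ℝ),
      thirdKindDensity (c ^ 2) (c ^ 2 - a ^ 2) (c ^ 2 - b ^ 2) v) (𝓝[<] b)
      (𝓝 (∫ v in Set.Ioi (0 : ℝ),
        thirdKindDensity (c ^ 2) (c ^ 2 - b ^ 2) (c ^ 2 - b ^ 2) v)) := by
  have h1 : 0 < c ^ 2 - b ^ 2 := by nlinarith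
  have h2 : 0 < b ^ 2 := by positivity
  have hev := eventually_density_nhdsLT hb c
  exact tendsto_integral_thirdKindDensity h1 (Eventually.of_forall fun _ => le_rfl)
    (hev.mono fun a h => h.1) (hev.mono fun a h => h.2) (Eventually.of_forall fun _ => h1.le)
    (hev.mono fun a h => h.1) tendsto_const_nhds ((tendsto_sq_nhdsLT b).const_sub _)
    tendsto_const_nhds (by linarith) h1 h1.le

theorem tendsto_integral_secondKindDensity_nhdsLT (hb : 0 < b) (hbc : b < c) :
    Tendsto (fun a => ∫ v in Set.Ioi (0 : ℝ),
      secondKindDensity (c ^ 2) (c ^ 2 - a ^ 2) (c ^ 2 - b ^ 2) v) (𝓝[<] b)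
      (𝓝 (∫ v in Set.Ioi (0 : ℝ),
        secondKindDensity (c ^ 2) (c ^ 2 - b ^ 2) (c ^ 2 - b ^ 2) v)) := by
  have h1 : 0 < c ^ 2 - b ^ 2 := by nlinarith
  have h2 : 0 < b ^ 2 := by positivity
  have hev := eventually_density_nhdsLT hb c
  exact tendsto_integral_secondKindDensity h1 (Eventually.of_forall fun _ => le_rfl)
    (hev.mono fun a h => h.1) (hev.mono fun a h => h.2) (Eventually.of_forall fun _ => h1.le)
    (hev.mono fun a h => h.1) tendsto_const_nhds ((tendsto_sq_nhdsLT b).const_sub _)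
    tendsto_const_nhds (by linarith) h1 h1.le

theorem tendsto_zero_of_abs_mul_le {ι : Type*} {l : Filter ι} {f A : ι → ℝ} {K : ℝ}
    (h : ∀ᶠ i in l, |f i * A i| ≤ K) (hA : Tendsto A l atTop) : Tendsto f l (𝓝 0) := by
  refine squeeze_zero_norm' ?_ ((tendsto_const_nhds (x := K)).div_atTop hA)
  filter_upwards [h, hA.eventually_gt_atTop 0] with i h1 h2
  rw [abs_mul, abs_of_pos h2] at h1
  rwa [Real.norm_eq_abs, le_div_iff₀ h2]

theorem tendsto_Dminus_div_Aminus_nhdsLT (hb : 0 < b) (hbc : b < c) :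
    Tendsto (fun a => Dminus a b c / Aminus a b c) (𝓝[<] b) (𝓝 (b ^ 2 / 2)) := by
  have h := tendsto_zero_of_abs_mul_le (f := fun a => b ^ 2 - 2 * (Dminus a b c / Aminus a b c))
    (A := fun a => Aminus a b c) (K := Real.pi * 1) (l := 𝓝[<] b) ?_
    (tendsto_Aminus_nhdsLT hb hbc)
  · have h2 := (h.const_sub (b ^ 2)).div_const 2
    rw [sub_zero] at h2
    refine h2.congr fun a => ?_
    ring
  · filter_upwards [eventually_sq_lt_nhdsLT hb] with a ha
    refine (le_of_eq ?_).trans (abs_mul_Aminus_sub_two_mul_Dminus ha.1 ha.2.1 hbc)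
    have := (Aminus_pos ha.1 ha.2.1 hbc).ne'
    congr 1
    field_simp

theorem tendsto_evenConst_nhdsLT (hb : 0 < b) (hbc : b < c) :
    Tendsto (fun a => evenConst a b c) (𝓝[<] b) (𝓝 (-(c ^ 2 / 4))) := by
  have h1 : 0 < c ^ 2 - b ^ 2 := by nlinarith
  have h2 : 0 < b ^ 2 := by positivity
  have hq0 := tendsto_zero_of_abs_mul_le (l := 𝓝[<] b)
    ((eventually_sq_lt_nhdsLT hb).mono fun a ha => abs_qGamma_sub_mul_Aminus_le ha.1 ha.2.1 hbc)
    (tendsto_Aminus_nhdsLT hb hbc)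
  have hq1 : Tendsto (fun a : ℝ => (c ^ 2 - b ^ 2) * (b ^ 2 - (a ^ 2 + b ^ 2 - c ^ 2) / 2)) (𝓝[<] b)
      (𝓝 ((c ^ 2 - b ^ 2) * (b ^ 2 - (b ^ 2 + b ^ 2 - c ^ 2) / 2))) :=
    (((((tendsto_sq_nhdsLT b).add_const _).sub_const _).div_const _).const_sub _).const_mul _
  have hq : Tendsto (fun a => qGamma a b c) (𝓝[<] b) (𝓝 ((c ^ 2 - b ^ 2) * c ^ 2 / 2)) := by
    refine ((hq0.add hq1).congr fun a => by ring).trans (le_of_eq ?_)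
    congr 1
    ring
  have h := (((tendsto_integral_secondKindDensity_nhdsLT hb hbc).add
    (hq.mul (tendsto_BminusOne_nhdsLT hb hbc))).const_mul (1 / 2)).sub_const (c ^ 2 / 2)
  rw [integral_secondKindDensity_add_mul h1 (by linarith)] at h
  refine (h.congr fun a => (evenConst_eq a b c).symm).trans (le_of_eq ?_)
  congr 1
  ring

theorem tendsto_Dminus_mul_delta_sub_nhdsLT (hb : 0 < b) (hbc : b < c) :
    Tendsto (fun a => Dminus a b c * delta a b c - Fminus a b c) (𝓝[<] b)
      (𝓝 (-Real.log 2)) := by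
  have h1 : 0 < c ^ 2 - b ^ 2 := by nlinarith
  have h2 : 0 < b ^ 2 := by positivity
  have h := ((((tendsto_Dminus_div_Aminus_nhdsLT hb hbc).sub_const (c ^ 2 / 2)).mul
    (tendsto_BminusOne_nhdsLT hb hbc)).sub
    ((tendsto_integral_thirdKindDensity_nhdsLT hb hbc).const_mul (1 / 2)))
  refine (h.congr' ?_).trans (le_of_eq ?_)
  · filter_upwards [eventually_sq_lt_nhdsLT hb] with a ha
    rw [Fminus_eq ha.1 ha.2.1 hbc, delta]
    ring
  · congr 1
    linear_combination (-(1 / 2) : ℝ) * mul_integral_firstKindDensity_add_third h1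
      (by linarith : c ^ 2 - b ^ 2 < c ^ 2)

theorem tendsto_phase1_nhdsLT (hb : 0 < b) (hbc : b < c) (t : ℝ) :
    Tendsto (fun a => phase1 a b c (1 / 4) t) (𝓝[<] b) (𝓝 (1 / 2)) := by
  have h := (((tendsto_const_nhds (x := (4 : ℝ))).div_atTop
    (tendsto_Aminus_nhdsLT hb hbc)).mul_const t).add_const (2 * (1 / 4))
  refine h.trans (le_of_eq ?_)
  norm_num

theorem tendsto_phase1_div_nhdsLT (hb : 0 < b) (hbc : b < c) (t : ℝ) :
    Tendsto (fun a => (1 - 2 * phase1 a b c (1 / 4) t) / bminus a b c) (𝓝[<] b)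
      (𝓝 (-(8 * t) / (Real.pi * (1 / √(b ^ 2 * (c ^ 2 - b ^ 2)))))) := by
  have h1 : 0 < b ^ 2 * (c ^ 2 - b ^ 2) := mul_pos (by positivity) (by nlinarith)
  have := Real.sqrt_pos.2 h1
  refine ((tendsto_const_nhds (x := -(8 * t))).div (tendsto_Bminus_nhdsLT hb hbc)
    (by positivity)).congr' ?_
  filter_upwards [eventually_sq_lt_nhdsLT hb] with a ha
  have hA := (Aminus_pos ha.1 ha.2.1 hbc).ne'
  have hB := (Bminus_pos ha.1 ha.2.1 hbc).ne'
  simp only [phase1, bminus, Pi.div_apply]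
  field_simp
  ring

theorem tendsto_delta_div_bminus_nhdsLT (hb : 0 < b) (hbc : b < c) :
    Tendsto (fun a => delta a b c / bminus a b c) (𝓝[<] b)
      (𝓝 (2 / Real.pi * Real.arctan (b / √(c ^ 2 - b ^ 2)))) := by
  have h1 : 0 < c ^ 2 - b ^ 2 := by nlinarith
  have h2 : 0 < b ^ 2 := by positivity
  have hs := Real.sqrt_pos.2 h1
  have hm : 0 < √(b ^ 2 * (c ^ 2 - b ^ 2)) := Real.sqrt_pos.2 (by positivity)
  have h := (tendsto_BminusOne_nhdsLT hb hbc).div (tendsto_Bminus_nhdsLT hb hbc) (by positivity)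
  rw [integral_firstKindDensity_self_right h1 (by linarith), sub_sub_cancel,
    Real.sqrt_mul h2.le, Real.sqrt_sq hb.le] at h
  refine (h.congr' ?_).trans (le_of_eq ?_)
  · filter_upwards [eventually_sq_lt_nhdsLT hb] with a ha
    have hA := (Aminus_pos ha.1 ha.2.1 hbc).ne'
    have hB := (Bminus_pos ha.1 ha.2.1 hbc).ne'
    simp only [delta, bminus, Pi.div_apply]
    field_simp
  · congr 1
    field_simp

theorem arccos_eq_two_mul_arctan (hb : 0 < b) (hbc : b < c) :
    Real.arccos ((c ^ 2 - 2 * b ^ 2) / c ^ 2) = 2 * Real.arctan (b / √(c ^ 2 - b ^ 2)) := by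
  have h1 : 0 < c ^ 2 - b ^ 2 := by nlinarith
  have hs := Real.sqrt_pos.2 h1
  have hc := hb.trans hbc
  set y := b / √(c ^ 2 - b ^ 2) with hy
  have hy2 : y ^ 2 = b ^ 2 / (c ^ 2 - b ^ 2) := by rw [hy, div_pow, Real.sq_sqrt h1.le]
  have hcos : Real.cos (2 * Real.arctan y) = (c ^ 2 - 2 * b ^ 2) / c ^ 2 := by
    rw [Real.cos_two_mul, Real.cos_sq_arctan, hy2]
    field_simp
    ring
  rw [← hcos]
  have h2 : 0 < Real.arctan y := Real.arctan_pos.2 (by positivity)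
  exact Real.arccos_cos (by linarith) (by linarith [Real.arctan_lt_pi_div_two y])

theorem tendsto_twoPhase_nhdsLT (hb : 0 < b) (hbc : b < c) (l0 x t : ℝ) :
    Tendsto (fun a : ℝ => twoPhase l0 a b c (1 / 4) 0 x t) (𝓝[<] b)
      (𝓝 ((c : ℂ) * Complex.exp
        (-2 * Complex.I * l0 * x - 2 * Complex.I * (2 * (l0 : ℂ) ^ 2 - (c : ℂ) ^ 2) * t
          - Complex.I * (Real.arccos ((c ^ 2 - 2 * b ^ 2) / c ^ 2) : ℝ) / 2))) := by
  have hc := hb.trans hbc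
  have hδ : Tendsto (fun a => delta a b c) (𝓝[<] b) (𝓝 0) :=
    (tendsto_BminusOne_nhdsLT hb hbc).div_atTop (tendsto_Aminus_nhdsLT hb hbc)
  have hR := tendsto_thetaH_ratio_of_left (u₂ := fun a => phase2 l0 a b c 0 x t)
    (tendsto_bminus_nhdsLT hb hbc) (tendsto_bplus_nhdsLT hb hbc) hδ
    (tendsto_delta_div_bminus_nhdsLT hb hbc) (tendsto_phase1_nhdsLT hb hbc t)
    (tendsto_phase1_div_nhdsLT hb hbc t)
  have hG := (Complex.continuous_exp.tendsto _).comp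
    ((Complex.continuous_ofReal.tendsto _).comp (tendsto_Dminus_mul_delta_sub_nhdsLT hb hbc))
  have hE := (Complex.continuous_ofReal.tendsto _).comp (tendsto_evenConst_nhdsLT hb hbc)
  have hEE : Tendsto (fun a => Complex.exp (-2 * Complex.I * l0 * x +
        2 * Complex.I * (-2 * l0 ^ 2 - 4 * (evenConst a b c : ℝ)) * t)) (𝓝[<] b) (𝓝 (Complex.exp
        (-2 * Complex.I * l0 * x +
        2 * Complex.I * (-2 * l0 ^ 2 - 4 * ((-(c ^ 2 / 4) : ℝ) : ℂ)) * t))) :=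
    (Complex.continuous_exp.tendsto _).comp (Tendsto.const_add _
      (Tendsto.mul_const _ (Tendsto.const_mul _ (Tendsto.const_sub _ (Tendsto.const_mul _ hE)))))
  have h := ((hG.const_mul (2 * (c : ℂ))).mul hR).mul hEE
  refine (h.congr' ((eventually_sq_lt_nhdsLT hb).mono fun a ha =>
    (twoPhase_eq ha.1 ha.2.1 hbc l0 _ _ x t).symm)).trans (le_of_eq ?_)
  congr 1
  have hpi : (Real.pi : ℂ) ≠ 0 := by exact_mod_cast Real.pi_ne_zero
  rw [← Complex.ofReal_exp, Real.exp_neg, Real.exp_log two_pos, arccos_eq_two_mul_arctan hb hbc,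
    mul_assoc (2 * (c : ℂ) * _), ← Complex.exp_add]
  congr 1
  · push_cast; field_simp
  · congr 1
    push_cast
    field_simp
    ring

end Left

end FocusingNLS

theorem mainTheorem3 (l0 : ℝ) :
    (∀ a b c : ℝ, 0 < a → a < b → b < c →
      (∃! K : ℂ, FocusingNLS.IsAbelianConstant l0 a b c 1 1 K) ∧
      (∃! K : ℂ, FocusingNLS.IsAbelianConstant l0 a b c 2 2 K)) ∧
    (∀ a b : ℝ, 0 < a → a < b → ∀ x t : ℝ,
      Tendsto (fun c : ℝ => FocusingNLS.twoPhase l0 a b c 0 (1 / 4) x t) (𝓝[>] b)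
        (𝓝 ((a : ℂ) * Complex.exp
          (-2 * Complex.I * l0 * x - 2 * Complex.I * (2 * (l0 : ℂ) ^ 2 - (a : ℂ) ^ 2) * t)))) ∧
    (∀ b c : ℝ, 0 < b → b < c → ∀ x t : ℝ,
      Tendsto (fun a : ℝ => FocusingNLS.twoPhase l0 a b c (1 / 4) 0 x t) (𝓝[<] b)
        (𝓝 ((c : ℂ) * Complex.exp
          (-2 * Complex.I * l0 * x - 2 * Complex.I * (2 * (l0 : ℂ) ^ 2 - (c : ℂ) ^ 2) * t
            - Complex.I * (Real.arccos ((c ^ 2 - 2 * b ^ 2) / c ^ 2) : ℝ) / 2)))) := by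
  exact ⟨fun _ _ _ ha hab hbc => ⟨FocusingNLS.existsUnique_K1 ha hab hbc l0,
    FocusingNLS.existsUnique_K2 ha hab hbc l0⟩,
    fun _ _ ha hab x t => FocusingNLS.tendsto_twoPhase_nhdsGT ha hab l0 x t,
    fun _ _ hb hbc x t => FocusingNLS.tendsto_twoPhase_nhdsLT hb hbc l0 x t⟩
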